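/- **Model.** Let $\mathrm{L},\mathrm{N}$ denote line-of-sight and non-line-of-sight. A link of length $r$ has type $\mathrm L$ with probability $p_{\mathrm L}(r)$ and type $\mathrm N$ with probability $p_{\mathrm N}(r)=1-p_{\mathrm L}(r)$, where $p_{\mathrm L}:[0,\infty)\to[0,1]$ is measurable; a type-$t$ link of length $r$ has path loss $\ell_t(r)=C_t r^{-\alpha_t}$ with $C_t,\alpha_t>0$. Fading variables are exponential with mean $1$. Primary base stations (BSs) $\{\mathbf x_i\}$, secondary BSs $\{\mathbf y_i\}$ and primary users form independent homogeneous Poisson point processes in $\mathbb R^2$ with intensities $\lambda_P,\lambda_S,\lambda_U>0$. A BS of operator $O\in\{P,S\}$ has antenna gain $G_{O,1}>0$ at angles $|\theta|\le\theta_O/2$ off its beam and $G_{O,2}>0$ otherwise ($0\le\theta_O\le2\pi$); put $b_1=\theta_P/2\pi$, $b_2=1-b_1$, $a_1=\theta_S/2\pi$, $a_2=1-a_1$. The angle between the beam of an interfering BS and the typical user is uniform on $[-\pi,\pi]$. Given the BS locations, the link types, fadings and angles are independent. A typical primary user at the origin is served, with gain $G_{P,1}$, by the primary BS giving it the highest average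 received power; primary BSs transmit with power $P_P>0$. Each secondary BS has as *home user* the primary user to which it provides the highest average received power, and transmits with power $\xi/\ell$ where $\ell$ is the path loss to its home user ($\xi>0$). Let $R_i,T_i$ be the distance and link type from the $i$-th secondary BS to the strongest of the primary users other than the typical one; the pairs $(R_i,T_i)$ are assumed independent over $i$ and of everything else, each with the distribution of this pair for a single BS. Thus the typical user is the home user of BS $i$ (the BS is *native*) iff $\ell_{T_i}(R_i)\le\ell_{t_i}(\|\mathbf y_i\|)$, where $t_i$ is the type of the link from BS $i$ to the typical user. With noise power $\sigma^2\ge0$, SINR is the received power from the serving BS divided by $\sigma^2$ plus the interference from all other primary BSs and from all secondary BSs. **Functions.** With $V_t(r)=2\pi\int_0^r p_t(s)s\,ds$ and $D^T_t(r)=(C_t/C_T)^{1/\alpha_t}r^{\alpha_T/\alpha_t}$ let $$f(r,T)=2\pi\lambda_U\,p_T(r)\,r\,\exp\bigl(-\lambda_U(V_{\mathrm L}(D^T_{\mathrm L}(r))+V_{\mathrm N}(D^T_{\mathrm N}(r)))\bigr),$$ $$K_t(u)=C_t^{2/\alpha_t}\sum_{T}\int_0^\infty p_t\bigl(u\,\bar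 p^{1/\alpha_t}C_t^{1/\alpha_t}\bigr)\,\bar p^{2/\alpha_t}f(r,T)\,dr,\quad \bar p=r^{\alpha_T}/C_T,$$ $$M_t(u)=p_t\bigl(u\,P_P^{1/\alpha_t}C_t^{1/\alpha_t}\bigr)P_P^{2/\alpha_t}C_t^{2/\alpha_t},$$ $$E_P(B,e)=\sum_t B^{2/\alpha_t}\int_{(e/B)^{1/\alpha_t}}^\infty\frac{M_t(vB^{1/\alpha_t})}{1+v^{\alpha_t}}2\pi v\,dv,$$ $$E_{FS}(B,\xi)=\sum_t (B\xi)^{2/\alpha_t}\int_{(\xi B)^{-1/\alpha_t}}^\infty\frac{K_t(v(B\xi)^{1/\alpha_t})}{1+v^{\alpha_t}}2\pi v\,dv,$$ $$E_{NS}(B)=\frac1{1+(B\xi)^{-1}}\int_0^1(K_{\mathrm L}(v)+K_{\mathrm N}(v))\,2\pi v\,dv .$$ **Theorem.** For every $\tau>0$, with $s_{t_0}(u)=\tau u^{\alpha_{t_0}}/G_{P,1}$, the coverage probability $\mathbb P[\mathrm{SINR}>\tau]$ of the typical primary user equals $$\sum_{t_0\in\{\mathrm L,\mathrm N\}}\int_0^\infty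 2\pi\lambda_P M_{t_0}(u)\,e^{-s_{t_0}(u)\sigma^2}\exp\Bigl(-\lambda_P\sum_{k=1}^2 b_kE_P\bigl(s_{t_0}(u)G_{P,k},u^{\alpha_{t_0}}\bigr)-\lambda_S\sum_{k=1}^2a_kE_{FS}\bigl(s_{t_0}(u)G_{S,k},\xi\bigr)\Bigr)$$ $$\times\exp\Bigl(-\lambda_S\sum_{k=1}^2a_kE_{NS}\bigl(s_{t_0}(u)G_{S,k}\bigr)\Bigr)\exp\Bigl(-2\pi\lambda_P\sum_{t\in\{\mathrm L,\mathrm N\}}\int_0^{u^{\alpha_{t_0}/\alpha_t}}M_t(z)z\,dz\Bigr)u\,du$$ (with $e^{-\infty}=0$). Moreover, the secondary interference is $I_{FS}+I_{NS}$, where $I_{FS}$ comes from the secondary BSs whose home user is not the typical user and $I_{NS}$ from the native ones; a native BS (not located at the origin itself) has transmit power times path loss to the typical user exactly $\xi$; and for all $s>0$, $\mathbb E[e^{-sI_{FS}}]=\exp(-\lambda_S\sum_k a_kE_{FS}(sG_{S,k},\xi))$ and $\mathbb E[e^{-sI_{NS}}]=\exp(-\lambda_S\sum_k a_kE_{NS}(sG_{S,k}))$.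 -/

import Mathlib

open MeasureTheory ProbabilityTheory Set
open scoped ENNReal NNReal

noncomputable section

/-! ### Poisson point processes and independent marking -/

/-- The counting measure `∑ᵢ δ_{xᵢ}` of a random sequence of points. -/
def pointMeasure {Ω E : Type*} [MeasurableSpace E] (x : ℕ → Ω → E) (ω : Ω) : Measure E :=
  Measure.sum fun i => Measure.dirac (x i ω)

/-- The random points `x₀, x₁, …` (in some enumeration) form a Poisson point process with intensity
measure `μ`: the number of points in a measurable set of finite intensity is Poisson distributed,
and the numbers of points in pairwise disjoint measurable sets are independent. -/
structure IsPoissonProcess {Ω E : Type*} [MeasurableSpace Ω] [MeasurableSpace E]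
    (P : Measure Ω) (x : ℕ → Ω → E) (μ : Measure E) : Prop where
  measurable : ∀ i, Measurable (x i)
  law_count : ∀ A : Set E, MeasurableSet A → μ A ≠ ∞ →
    P.map (fun ω => pointMeasure x ω A) =
      (poissonMeasure (μ A).toNNReal).map (fun n : ℕ => (n : ℝ≥0∞))
  indep_count : ∀ (n : ℕ) (A : Fin n → Set E), (∀ k, MeasurableSet (A k)) →
    Pairwise (fun k l => Disjoint (A k) (A l)) →
    iIndepFun (fun k ω => pointMeasure x ω (A k)) P

/-- The marks `mᵢ` of the points `xᵢ` are conditionally independent given all the points, and the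
conditional law of `mᵢ` is `κ (xᵢ)`. -/
structure IsIndependentMarking {Ω E M : Type*} [MeasurableSpace Ω] [MeasurableSpace E]
    [MeasurableSpace M] (P : Measure Ω) (x : ℕ → Ω → E) (m : ℕ → Ω → M)
    (κ : E → Measure M) : Prop where
  measurable : ∀ i, Measurable (m i)
  cond_law : ∀ A : Set (ℕ → E), MeasurableSet A → ∀ (s : Finset ℕ) (B : ℕ → Set M),
    (∀ i, MeasurableSet (B i)) →
    P {ω | (fun i => x i ω) ∈ A ∧ ∀ i ∈ s, m i ω ∈ B i} =
      ∫⁻ ω in {ω | (fun i => x i ω) ∈ A}, ∏ i ∈ s, κ (x i ω) (B i) ∂P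

/-! ### Parameters -/

/-- Locations in the plane. -/
abbrev Plane : Type := EuclideanSpace ℝ (Fin 2)

/-- A link is line-of-sight or non-line-of-sight. -/
inductive LinkType : Type
  | los : LinkType
  | nlos : LinkType
  deriving DecidableEq

instance : Fintype LinkType where
  elems := {LinkType.los, LinkType.nlos}
  complete := by intro t; cases t <;> simp

instance : MeasurableSpace LinkType := ⊤

/-- A sectored antenna pattern: main lobe gain, side lobe gain, half-power beamwidth. -/
structure Antenna where
  mainGain : ℝ
  sideGain : ℝ
  beamwidth : ℝ

/-- The two lobe gains, `G₁` (index `0`) and `G₂` (index `1`). -/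
def Antenna.lobe (a : Antenna) : Fin 2 → ℝ := ![a.mainGain, a.sideGain]

/-- The fraction of directions covered by each of the two lobes. -/
def Antenna.lobeProb (a : Antenna) : Fin 2 → ℝ :=
  ![a.beamwidth / (2 * Real.pi), 1 - a.beamwidth / (2 * Real.pi)]

open Classical in
/-- The radiation pattern: the gain at angle `θ` off the beam direction. -/
def Antenna.gain (a : Antenna) (θ : ℝ) : ℝ :=
  if |θ| ≤ a.beamwidth / 2 then a.mainGain else a.sideGain

structure Antenna.Valid (a : Antenna) : Prop where
  mainGain_pos : 0 < a.mainGain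
  sideGain_pos : 0 < a.sideGain
  beamwidth_nonneg : 0 ≤ a.beamwidth
  beamwidth_le : a.beamwidth ≤ 2 * Real.pi

/-- The deterministic parameters of the two networks. -/
structure Params where
  /-- intensity of the primary base stations -/
  lamP : ℝ
  /-- intensity of the secondary base stations -/
  lamS : ℝ
  /-- intensity of the primary users -/
  lamU : ℝ
  /-- transmit power of the primary base stations -/
  powP : ℝ
  /-- limit on the average interference of a secondary base station at its home user -/
  xi : ℝ
  /-- noise power at a primary user -/
  noise : ℝ
  /-- near-field gains -/
  C : LinkType → ℝ
  /-- path-loss exponents -/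
  al : LinkType → ℝ
  /-- probability that a link of a given length is line-of-sight -/
  pLos : ℝ → ℝ
  antP : Antenna
  antS : Antenna

namespace Params

structure Valid (q : Params) : Prop where
  lamP_pos : 0 < q.lamP
  lamS_pos : 0 < q.lamS
  lamU_pos : 0 < q.lamU
  powP_pos : 0 < q.powP
  xi_pos : 0 < q.xi
  noise_nonneg : 0 ≤ q.noise
  C_pos : ∀ t, 0 < q.C t
  al_pos : ∀ t, 0 < q.al t
  pLos_measurable : Measurable q.pLos
  pLos_nonneg : ∀ r, 0 ≤ r → 0 ≤ q.pLos r
  pLos_le_one : ∀ r, 0 ≤ r → q.pLos r ≤ 1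
  antP_valid : q.antP.Valid
  antS_valid : q.antS.Valid

/-- `p_t(r)`: the probability that a link of length `r` has type `t`. -/
def p (q : Params) : LinkType → ℝ → ℝ
  | LinkType.los, r => q.pLos r
  | LinkType.nlos, r => 1 - q.pLos r

/-- The path loss `C_t r^{-α_t}`. -/
def pathLoss (q : Params) (t : LinkType) (r : ℝ) : ℝ := q.C t * r ^ (-q.al t)

/-- The law of the type of a link of length `r`. -/
def linkLaw (q : Params) (r : ℝ) : Measure LinkType :=
  ENNReal.ofReal (q.p LinkType.los r) • Measure.dirac LinkType.los +
    ENNReal.ofReal (q.p LinkType.nlos r) • Measure.dirac LinkType.nlos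

end Params

/-- Normalised Rayleigh fading: exponential power with mean `1`. -/
def fadingLaw : Measure ℝ := expMeasure 1

/-- The uniform law on `[-π, π]`. -/
def angleLaw : Measure ℝ := cond volume (Icc (-Real.pi) Real.pi)

/-! ### The random network seen by a typical primary user at the origin -/

/-- The random quantities. The typical primary user is at the origin. -/
structure Network (Ω : Type*) where
  /-- locations of the primary base stations -/
  x : ℕ → Ω → Plane
  /-- type of the link from a primary base station to the typical user -/
  linkP : ℕ → Ω → LinkType
  /-- fading on that link -/
  fadP : ℕ → Ω → ℝ
  /-- angle between the beam of a primary base station and the typical user -/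
  angP : ℕ → Ω → ℝ
  /-- locations of the secondary base stations -/
  y : ℕ → Ω → Plane
  /-- type of the link from a secondary base station to the typical user -/
  linkS : ℕ → Ω → LinkType
  /-- fading on that link -/
  fadS : ℕ → Ω → ℝ
  /-- angle between the beam of a secondary base station and the typical user -/
  angS : ℕ → Ω → ℝ
  /-- distance from a secondary base station to the radio-closest one of the other primary users -/
  R : ℕ → Ω → ℝ
  /-- type of the link from that base station to that user -/
  T : ℕ → Ω → LinkType

/-- `(D, L)` are the distance and the link type between a base station at the origin and the primary
user that it provides with the highest average received power, where `z` are the locations of the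
primary users and `w` the types of their links to the base station. -/
structure IsRadioClosest {Ω : Type*} [MeasurableSpace Ω] (q : Params) (P : Measure Ω)
    (z : ℕ → Ω → Plane) (w : ℕ → Ω → LinkType) (D : Ω → ℝ) (L : Ω → LinkType) : Prop where
  poisson : IsPoissonProcess P z (ENNReal.ofReal q.lamU • volume)
  marking : IsIndependentMarking P z w (fun v => q.linkLaw ‖v‖)
  measurable_dist : Measurable D
  measurable_link : Measurable L
  strongest : ∀ᵐ ω ∂P, ∃ k, D ω = ‖z k ω‖ ∧ L ω = w k ω ∧
    ∀ j, q.pathLoss (w j ω) ‖z j ω‖ ≤ q.pathLoss (w k ω) ‖z k ω‖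

namespace Network

variable {Ω : Type*}

/-- The probabilistic assumptions. `ν` is the law of the pair `(Rᵢ, Tᵢ)`; these pairs are independent
over `i` and of everything else. -/
structure IsModel [MeasurableSpace Ω] (N : Network Ω) (q : Params) (ν : Measure (ℝ × LinkType))
    (P : Measure Ω) : Prop where
  poissonP : IsPoissonProcess P N.x (ENNReal.ofReal q.lamP • volume)
  poissonS : IsPoissonProcess P N.y (ENNReal.ofReal q.lamS • volume)
  markingP : IsIndependentMarking P N.x (fun i ω => (N.linkP i ω, N.fadP i ω, N.angP i ω))
    (fun v => (q.linkLaw ‖v‖).prod (fadingLaw.prod angleLaw))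
  markingS : IsIndependentMarking P N.y
    (fun i ω => (N.linkS i ω, N.fadS i ω, N.angS i ω, (N.R i ω, N.T i ω)))
    (fun v => (q.linkLaw ‖v‖).prod (fadingLaw.prod (angleLaw.prod ν)))
  indep : IndepFun
    (fun ω i => (N.x i ω, N.linkP i ω, N.fadP i ω, N.angP i ω))
    (fun ω i => (N.y i ω, N.linkS i ω, N.fadS i ω, N.angS i ω, N.R i ω, N.T i ω)) P

/-- Path loss between the `i`th primary base station and the typical user. -/
def lossP (N : Network Ω) (q : Params) (i : ℕ) (ω : Ω) : ℝ := q.pathLoss (N.linkP i ω) ‖N.x i ω‖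

/-- Path loss between the `i`th secondary base station and the typical user. -/
def lossS (N : Network Ω) (q : Params) (i : ℕ) (ω : Ω) : ℝ := q.pathLoss (N.linkS i ω) ‖N.y i ω‖

/-- The `i`th primary base station gives the typical user the highest average received power. -/
def IsTagged (N : Network Ω) (q : Params) (i : ℕ) (ω : Ω) : Prop :=
  ∀ j, q.powP * N.lossP q j ω ≤ q.powP * N.lossP q i ω

/-- The typical user is the home user of the `i`th secondary base station: it is at least as close,
radio-distance wise, as every other primary user. -/
def IsNative (N : Network Ω) (q : Params) (i : ℕ) (ω : Ω) : Prop :=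
  q.pathLoss (N.T i ω) (N.R i ω) ≤ N.lossS q i ω

open Classical in
/-- Length and type of the link from the `i`th secondary base station to its home user. -/
def homeLink (N : Network Ω) (q : Params) (i : ℕ) (ω : Ω) : ℝ × LinkType :=
  if N.IsNative q i ω then (‖N.y i ω‖, N.linkS i ω) else (N.R i ω, N.T i ω)

/-- Transmit power of the `i`th secondary base station: its average interference at its home user
equals `ξ`. -/
def powS (N : Network Ω) (q : Params) (i : ℕ) (ω : Ω) : ℝ :=
  q.xi * (N.homeLink q i ω).1 ^ q.al (N.homeLink q i ω).2 / q.C (N.homeLink q i ω).2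

/-- Interference of the `j`th secondary base station at the typical user. -/
def recvS (N : Network Ω) (q : Params) (j : ℕ) (ω : Ω) : ℝ :=
  N.powS q j ω * q.antS.gain (N.angS j ω) * N.fadS j ω * N.lossS q j ω

open Classical in
/-- Interference of all primary base stations other than the `i`th one. -/
def interfP (N : Network Ω) (q : Params) (i : ℕ) (ω : Ω) : ℝ≥0∞ :=
  ∑' j, if j = i then 0 else
    ENNReal.ofReal (q.powP * q.antP.gain (N.angP j ω) * N.fadP j ω * N.lossP q j ω)

/-- Interference of all secondary base stations. -/
def interfS (N : Network Ω) (q : Params) (ω : Ω) : ℝ≥0∞ :=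
  ∑' j, ENNReal.ofReal (N.recvS q j ω)

open Classical in
/-- Interference of the secondary base stations whose home user is not the typical user. -/
def interfForeign (N : Network Ω) (q : Params) (ω : Ω) : ℝ≥0∞ :=
  ∑' j, if N.IsNative q j ω then 0 else ENNReal.ofReal (N.recvS q j ω)

open Classical in
/-- Interference of the native secondary base stations. -/
def interfNative (N : Network Ω) (q : Params) (ω : Ω) : ℝ≥0∞ :=
  ∑' j, if N.IsNative q j ω then ENNReal.ofReal (N.recvS q j ω) else 0

/-- SINR of the typical user when it is served, in the main lobe, by the `i`th primary base
station. -/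
def sinr (N : Network Ω) (q : Params) (i : ℕ) (ω : Ω) : ℝ≥0∞ :=
  ENNReal.ofReal (q.powP * q.antP.mainGain * N.fadP i ω * N.lossP q i ω) /
    (ENNReal.ofReal q.noise + N.interfP q i ω + N.interfS q ω)

/-- The event that the SINR from the tagged base station exceeds `τ`. -/
def covered (N : Network Ω) (q : Params) (τ : ℝ) : Set Ω :=
  {ω | ∃ i, N.IsTagged q i ω ∧ ENNReal.ofReal τ < N.sinr q i ω}

end Network

/-! ### The functions in the coverage formula -/

/-- `e^{-a}` for `a ∈ [0, ∞]`, with `e^{-∞} = 0`. -/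
def expNeg (a : ℝ≥0∞) : ℝ≥0∞ := EReal.exp (-(a : EReal))

namespace Params

/-- `V_t(r) = 2π ∫₀^r p_t(s) s ds`. -/
def V (q : Params) (t : LinkType) (r : ℝ) : ℝ := 2 * Real.pi * ∫ s in (0 : ℝ)..r, q.p t s * s

/-- The exclusion radius `D^T_t(r) = (C_t / C_T)^{1/α_t} r^{α_T/α_t}`. -/
def exclusion (q : Params) (T t : LinkType) (r : ℝ) : ℝ :=
  (q.C t / q.C T) ^ (1 / q.al t) * r ^ (q.al T / q.al t)

/-- The joint density of the distance and the link type between a secondary base station and its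
radio-closest primary user. -/
def homeDensity (q : Params) (T : LinkType) (r : ℝ) : ℝ :=
  2 * Real.pi * q.lamU * q.p T r * r *
    Real.exp (-(q.lamU * (q.V LinkType.los (q.exclusion T LinkType.los r) +
      q.V LinkType.nlos (q.exclusion T LinkType.nlos r))))

/-- `K_t(u) = E[p_t(u P̄^{1/α_t} C_t^{1/α_t}) P̄^{2/α_t}] C_t^{2/α_t}`, where `P̄ = R^{α_T} / C_T` and
`(R, T)` has density `homeDensity`. -/
def K (q : Params) (t : LinkType) (u : ℝ) : ℝ≥0∞ :=
  (∑ T : LinkType, ∫⁻ r in Ioi (0 : ℝ), ENNReal.ofReal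
    (q.p t (u * (r ^ q.al T / q.C T) ^ (1 / q.al t) * q.C t ^ (1 / q.al t)) *
      (r ^ q.al T / q.C T) ^ (2 / q.al t) * q.homeDensity T r)) *
    ENNReal.ofReal (q.C t ^ (2 / q.al t))

/-- `M_t(u) = p_t(u P_P^{1/α_t} C_t^{1/α_t}) P_P^{2/α_t} C_t^{2/α_t}`. -/
def M (q : Params) (t : LinkType) (u : ℝ) : ℝ :=
  q.p t (u * q.powP ^ (1 / q.al t) * q.C t ^ (1 / q.al t)) *
    q.powP ^ (2 / q.al t) * q.C t ^ (2 / q.al t)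

/-- `E_P(B, e)`. -/
def EP (q : Params) (B e : ℝ) : ℝ≥0∞ :=
  ∑ t : LinkType, ENNReal.ofReal (B ^ (2 / q.al t)) *
    ∫⁻ v in Ioi ((e / B) ^ (1 / q.al t)), ENNReal.ofReal
      (1 / (1 + v ^ q.al t) * q.M t (v * B ^ (1 / q.al t)) * (2 * Real.pi * v))

/-- `E_FS(B, ξ)`. -/
def EF (q : Params) (B ξ : ℝ) : ℝ≥0∞ :=
  ∑ t : LinkType, ENNReal.ofReal ((B * ξ) ^ (2 / q.al t)) *
    ∫⁻ v in Ioi ((ξ * B) ^ (-(1 / q.al t))),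
      q.K t (v * (B * ξ) ^ (1 / q.al t)) *
        ENNReal.ofReal (1 / (1 + v ^ q.al t) * (2 * Real.pi * v))

/-- `E_NS(B)`. -/
def EN (q : Params) (B : ℝ) : ℝ≥0∞ :=
  ENNReal.ofReal (1 / (1 + (B * q.xi)⁻¹)) *
    ∫⁻ v in Ioo (0 : ℝ) 1,
      (q.K LinkType.los v + q.K LinkType.nlos v) * ENNReal.ofReal (2 * Real.pi * v)

/-- `∑ₜ 2π λ_P ∫₀^{u^{α_{t₀}/α_t}} M_t(z) z dz`. -/
def assocExponent (q : Params) (t₀ : LinkType) (u : ℝ) : ℝ≥0∞ :=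
  ∑ t : LinkType, ENNReal.ofReal (2 * Real.pi * q.lamP) *
    ∫⁻ z in Ioo (0 : ℝ) (u ^ (q.al t₀ / q.al t)), ENNReal.ofReal (q.M t z * z)

end Params

end

/-! ### The function `expNeg` -/

/-! With exponential fading, P(F > y) = e^{-y} for every y in [0, ∞], so the coverage probability is
the expectation of an exponential functional. Let ρ = r^α / C be the reciprocal path loss
(`radial`). A tagged base station i covers the user iff its fading exceeds s (noise + interference),
where s = τ ρ_i / (P_P G_{P,1}). The association rule goes into the same exponent: every other
primary base station with smaller ρ contributes ∞. The intensity of ρ is diffuse, so there are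
almost surely no ties and the events for different i are disjoint up to null sets. Coverage is
therefore a sum over i of E[g(ρ_i) exp(-∑_{j ≠ i} φ_{ρ_i}(z_j))] (`measure_covered`), where g
contains the noise and the Laplace transform of the independent secondary interference. The
Campbell–Mecke formula (`tsum_lintegral_mul_expNeg`) turns this sum into an integral. In the
resulting exponent, the base stations stronger than the server give the association factor and the
others give E_P (`lintegral_primaryExponent`).

All the point process tools come from the Laplace functional E exp(-∑ φ(e_i)) = exp(-∫ (1 - e^{-φ})
dΛ). It holds for simple φ by independence of counts, passes to monotone limits, and is inherited by
independently marked processes. Differentiating it along φ + ε 1_A gives E[e^{-∑ φ} N(A)]. Dividing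
out the point's own term gives sums over the other points, and further limits allow φ to be infinite
and to depend on the typical point through one real parameter.

For the secondary network, distances are measured in units of the length ℓ at which the link to the
typical user has the path loss of the link to the best other user. At normalised distance x = r / ℓ
the station is native iff x ≤ 1. Its received power, up to antenna gain and fading, is then ξ, and
it is ξ x^{-α} otherwise. Averaging over the other user's link turns p_t(r) r dr into K_t(x) x dx
(`lintegral_home_rescale`). No station is both foreign and native, so the two exponents add and the
Laplace transforms multiply. The law of the home link is a small Mecke computation of the same kind:
a user is strongest iff no other one is radially closer (`IsRadioClosest.lintegral_eq`). -/

@[simp] theorem expNeg_zero : expNeg 0 = 1 := by simp [expNeg]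

@[simp] theorem expNeg_top : expNeg ∞ = 0 := by simp [expNeg]

theorem expNeg_ofReal {x : ℝ} (hx : 0 ≤ x) :
    expNeg (ENNReal.ofReal x) = ENNReal.ofReal (Real.exp (-x)) := by
  rw [expNeg, EReal.coe_ennreal_ofReal, max_eq_left hx, ← EReal.coe_neg, EReal.exp_coe]

theorem expNeg_coe (x : ℝ≥0) : expNeg (x : ℝ≥0∞) = ENNReal.ofReal (Real.exp (-(x : ℝ))) := by
  rw [← expNeg_ofReal x.coe_nonneg, ENNReal.ofReal_coe_nnreal]

theorem expNeg_antitone : Antitone expNeg := fun _ _ h =>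
  EReal.exp_monotone (EReal.neg_le_neg_iff.2 (EReal.coe_ennreal_le_coe_ennreal_iff.2 h))

theorem expNeg_le_one (a : ℝ≥0∞) : expNeg a ≤ 1 := by
  simpa using expNeg_antitone (zero_le (a := a))

theorem expNeg_ne_top (a : ℝ≥0∞) : expNeg a ≠ ∞ :=
  ((expNeg_le_one a).trans_lt ENNReal.one_lt_top).ne

theorem continuous_expNeg : Continuous expNeg :=
  ENNReal.continuous_exp.comp (continuous_neg.comp continuous_coe_ennreal_ereal)

@[fun_prop] theorem measurable_expNeg : Measurable expNeg := continuous_expNeg.measurable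

theorem expNeg_add (a b : ℝ≥0∞) : expNeg (a + b) = expNeg a * expNeg b := by
  induction a with
  | top => simp
  | coe a =>
    induction b with
    | top => simp
    | coe b =>
      rw [← ENNReal.coe_add, expNeg_coe, expNeg_coe, expNeg_coe,
        ← ENNReal.ofReal_mul (Real.exp_nonneg _), ← Real.exp_add, NNReal.coe_add, neg_add]

theorem expNeg_finset_sum {ι : Type*} (s : Finset ι) (f : ι → ℝ≥0∞) :
    expNeg (∑ i ∈ s, f i) = ∏ i ∈ s, expNeg (f i) := by
  classical
  induction s using Finset.induction_on with
  | empty => simp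
  | insert a s ha ih => rw [Finset.sum_insert ha, Finset.prod_insert ha, expNeg_add, ih]

theorem expNeg_nat_mul (n : ℕ) (a : ℝ≥0∞) : expNeg (n * a) = expNeg a ^ n := by
  have := expNeg_finset_sum (Finset.range n) (fun _ => a)
  simpa using this

theorem expNeg_eq_zero {a : ℝ≥0∞} : expNeg a = 0 ↔ a = ∞ := by
  constructor
  · intro h
    induction a with
    | top => rfl
    | coe a => simp [expNeg_coe] at h; exact absurd h (not_le.2 (Real.exp_pos _))
  · rintro rfl; simp

/-- Minus the logarithm, as a measurable map `[0, ∞] → [0, ∞]`. -/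
noncomputable def negLog (t : ℝ≥0∞) : ℝ≥0∞ := (-(ENNReal.log t)).toENNReal

@[fun_prop] theorem measurable_negLog : Measurable negLog := by
  unfold negLog
  exact (ENNReal.measurable_log.neg).ereal_toENNReal

/-- Writes any factor in [0, 1], including 0, as an exponential, so that products of such factors
fall under a Laplace functional. -/
theorem expNeg_negLog {t : ℝ≥0∞} (ht : t ≤ 1) : expNeg (negLog t) = t := by
  have h : ENNReal.log t ≤ 0 := by simpa using ENNReal.log_monotone ht
  rw [expNeg, negLog, EReal.coe_toENNReal (EReal.neg_nonneg.2 h), neg_neg, ENNReal.exp_log]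

theorem measurable_one_sub_expNeg {E : Type*} [MeasurableSpace E] {φ : E → ℝ≥0∞}
    (hφ : Measurable φ) : Measurable fun v => 1 - expNeg (φ v) :=
  measurable_const.sub (measurable_expNeg.comp hφ)

/-! ### The Laplace functional of a Poisson process -/

theorem lintegral_pointMeasure {Ω E : Type*} [MeasurableSpace E] (x : ℕ → Ω → E) (ω : Ω)
    {φ : E → ℝ≥0∞} (hφ : Measurable φ) :
    ∫⁻ v, φ v ∂(pointMeasure x ω) = ∑' i, φ (x i ω) := by
  rw [pointMeasure, lintegral_sum_measure]
  exact tsum_congr fun i => lintegral_dirac' _ hφ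

theorem pointMeasure_apply {Ω E : Type*} [MeasurableSpace E] (x : ℕ → Ω → E) (ω : Ω)
    {A : Set E} (hA : MeasurableSet A) :
    pointMeasure x ω A = ∑' i, A.indicator 1 (x i ω) := by
  rw [pointMeasure, Measure.sum_apply _ hA]
  exact tsum_congr fun i => Measure.dirac_apply' _ hA

theorem measurable_pointMeasure_apply {Ω E : Type*} [MeasurableSpace Ω] [MeasurableSpace E]
    {x : ℕ → Ω → E} (hx : ∀ i, Measurable (x i)) {A : Set E} (hA : MeasurableSet A) :
    Measurable fun ω => pointMeasure x ω A := by
  simp_rw [pointMeasure_apply x _ hA]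
  exact Measurable.tsum fun i => (measurable_one.indicator hA).comp (hx i)

/-- The generating function of the Poisson law at r = e^{-c}. The case c = ∞, r = 0 is included,
since ∞ * 0 = 0 agrees with 0 ^ 0 = 1. -/
theorem lintegral_expNeg_mul_poisson (m : ℝ≥0) (c : ℝ≥0∞) :
    ∫⁻ n : ℕ, expNeg (c * n) ∂(poissonMeasure m) = expNeg (m * (1 - expNeg c)) := by
  set t := expNeg c with ht
  have htop : t ≠ ∞ := expNeg_ne_top c
  have hle : t ≤ 1 := expNeg_le_one c
  obtain ⟨r, hr⟩ : ∃ r : ℝ≥0, t = r := ⟨t.toNNReal, (ENNReal.coe_toNNReal htop).symm⟩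
  have hr1 : r ≤ 1 := by rw [hr] at hle; exact_mod_cast hle
  have h1 : ∀ n : ℕ, expNeg (c * n) = ENNReal.ofReal ((r : ℝ) ^ n) := by
    intro n
    rw [mul_comm, expNeg_nat_mul, ← ht, hr, ENNReal.ofReal_pow r.coe_nonneg,
      ENNReal.ofReal_coe_nnreal]
  simp_rw [h1]
  rw [poissonMeasure, lintegral_sum_measure]
  simp_rw [lintegral_smul_measure, lintegral_dirac, smul_eq_mul]
  have h2 : ∀ n : ℕ, ENNReal.ofReal (Real.exp (-(m : ℝ)) * (m : ℝ) ^ n / (n.factorial : ℝ)) *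
      ENNReal.ofReal ((r : ℝ) ^ n) =
      ENNReal.ofReal (Real.exp (-(m : ℝ)) * (((m * r : ℝ)) ^ n / (n.factorial : ℝ))) := by
    intro n
    rw [← ENNReal.ofReal_mul (by positivity)]
    congr 1
    rw [mul_pow]; ring
  simp_rw [h2]
  have hs : HasSum (fun n : ℕ => Real.exp (-(m : ℝ)) * (((m * r : ℝ)) ^ n / (n.factorial : ℝ)))
      (Real.exp (-(m : ℝ)) * Real.exp (m * r)) := by
    refine HasSum.mul_left _ ?_
    have := NormedSpace.expSeries_div_hasSum_exp (𝔸 := ℝ) (m * r : ℝ)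
    rwa [← Real.exp_eq_exp_ℝ] at this
  rw [← ENNReal.ofReal_tsum_of_nonneg (fun n => by positivity) hs.summable, hs.tsum_eq, hr]
  have : (m : ℝ≥0∞) * (1 - (r : ℝ≥0∞)) = ((m * (1 - r) : ℝ≥0) : ℝ≥0∞) := by
    push_cast; rfl
  rw [this, expNeg_coe, ← Real.exp_add]
  congr 2
  rw [NNReal.coe_mul, NNReal.coe_sub hr1]
  push_cast; ring

namespace IsPoissonProcess

variable {Ω E : Type*} [MeasurableSpace Ω] [MeasurableSpace E] {P : Measure Ω}
  {x : ℕ → Ω → E} {μ : Measure E}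

theorem lintegral_expNeg_count (h : IsPoissonProcess P x μ) {A : Set E} (hA : MeasurableSet A)
    (hμ : μ A ≠ ∞) (c : ℝ≥0∞) :
    ∫⁻ ω, expNeg (c * pointMeasure x ω A) ∂P = expNeg (μ A * (1 - expNeg c)) := by
  have hm := measurable_pointMeasure_apply h.measurable hA
  have hf : Measurable fun a : ℝ≥0∞ => expNeg (c * a) := by fun_prop
  rw [← lintegral_map (f := fun a => expNeg (c * a)) hf hm, h.law_count A hA hμ,
    lintegral_map hf (by fun_prop), lintegral_expNeg_mul_poisson, ENNReal.coe_toNNReal hμ]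

/-- For a simple function the sum over the points is a combination of the counts of disjoint level
sets, and their independence gives a product of Poisson generating functions. -/
theorem lintegral_expNeg_simpleFunc (h : IsPoissonProcess P x μ) (f : SimpleFunc E ℝ≥0∞)
    (hf : ∀ c ≠ 0, μ (f ⁻¹' {c}) ≠ ∞) :
    ∫⁻ ω, expNeg (∑' i, f (x i ω)) ∂P = expNeg (∫⁻ v, 1 - expNeg (f v) ∂μ) := by
  classical
  -- The value 0 is dropped: its level set contributes nothing and may have infinite intensity.
  set s : Finset ℝ≥0∞ := f.range.filter (· ≠ 0) with hs
  let e := s.equivFin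
  let A : Fin s.card → Set E := fun k => f ⁻¹' {((e.symm k : s) : ℝ≥0∞)}
  have hA : ∀ k, MeasurableSet (A k) := fun k => f.measurableSet_preimage _
  have hAd : Pairwise fun k l => Disjoint (A k) (A l) := by
    intro k l hkl
    refine Disjoint.preimage _ (Set.disjoint_singleton.2 fun heq => hkl ?_)
    exact e.symm.injective (Subtype.ext heq)
  have hAf : ∀ k, μ (A k) ≠ ∞ := fun k =>
    hf _ (Finset.mem_filter.1 (e.symm k).2).2
  -- Used twice: with the counting measure and `id` for the sum over the points, and with `μ` and
  -- `fun c => 1 - expNeg c` for the exponent.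
  have key : ∀ (ν : Measure E) (g : ℝ≥0∞ → ℝ≥0∞), g 0 = 0 →
      ∫⁻ v, g (f v) ∂ν = ∑ k, g (e.symm k : s) * ν (A k) := by
    intro ν g hg
    have h1 : ∫⁻ v, g (f v) ∂ν = ∑ c ∈ f.range, g c * ν (f ⁻¹' {c}) := by
      rw [← SimpleFunc.map_lintegral]
      exact SimpleFunc.lintegral_eq_lintegral (f.map g) ν
    rw [h1, Equiv.sum_comp e.symm (fun c : s => g c * ν (f ⁻¹' {(c : ℝ≥0∞)})),
      Finset.sum_coe_sort s (fun c => g c * ν (f ⁻¹' {c})), hs, Finset.sum_filter]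
    refine Finset.sum_congr rfl fun c _ => ?_
    by_cases hc : c = 0 <;> simp [hc, hg]
  have h1 : ∀ ω, expNeg (∑' i, f (x i ω)) =
      ∏ k, expNeg ((e.symm k : s) * pointMeasure x ω (A k)) := by
    intro ω
    rw [← lintegral_pointMeasure x ω f.measurable, ← expNeg_finset_sum]
    exact congrArg expNeg (key _ id rfl)
  simp_rw [h1]
  have hind := h.indep_count s.card A hA hAd
  have hind' := hind.comp (fun k a => expNeg ((e.symm k : s) * a)) (fun k => by fun_prop)
  refine (lintegral_prod_eq_prod_lintegral_of_indepFun Finset.univ _ hind'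
    (fun k => Measurable.comp (g := fun a => expNeg ((e.symm k : s) * a)) (by fun_prop)
      (measurable_pointMeasure_apply h.measurable (hA k)))).trans ?_
  simp only [Function.comp_apply]
  rw [key μ (fun c => 1 - expNeg c) (by simp), expNeg_finset_sum]
  refine Finset.prod_congr rfl fun k _ => ?_
  rw [h.lintegral_expNeg_count (hA k) (hAf k), mul_comm]

end IsPoissonProcess

theorem tendsto_lintegral_expNeg {Ω : Type*} [MeasurableSpace Ω] {P : Measure Ω}
    [IsFiniteMeasure P] {X : ℕ → Ω → ℝ≥0∞} {Y : Ω → ℝ≥0∞} (hX : ∀ n, Measurable (X n))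
    (h : ∀ ω, Filter.Tendsto (fun n => X n ω) Filter.atTop (nhds (Y ω))) :
    Filter.Tendsto (fun n => ∫⁻ ω, expNeg (X n ω) ∂P) Filter.atTop
      (nhds (∫⁻ ω, expNeg (Y ω) ∂P)) := by
  refine tendsto_lintegral_of_dominated_convergence (fun _ => 1)
    (fun n => measurable_expNeg.comp (hX n)) (fun n => ?_) (by simp) ?_
  · exact Filter.Eventually.of_forall fun ω => expNeg_le_one _
  · exact Filter.Eventually.of_forall fun ω => (continuous_expNeg.tendsto _).comp (h ω)

theorem tendsto_tsum_of_monotone {φ : ℕ → ℕ → ℝ≥0∞} {ψ : ℕ → ℝ≥0∞} (hm : ∀ i, Monotone fun n => φ n i)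
    (h : ∀ i, Filter.Tendsto (fun n => φ n i) Filter.atTop (nhds (ψ i))) :
    Filter.Tendsto (fun n => ∑' i, φ n i) Filter.atTop (nhds (∑' i, ψ i)) := by
  simp_rw [← lintegral_count]
  exact lintegral_tendsto_of_tendsto_of_monotone (fun n => (measurable_of_countable _).aemeasurable)
    (Filter.Eventually.of_forall hm) (Filter.Eventually.of_forall h)

theorem tendsto_lintegral_one_sub_expNeg {E : Type*} [MeasurableSpace E] {μ : Measure E}
    {φ : ℕ → E → ℝ≥0∞} {ψ : E → ℝ≥0∞} (hφ : ∀ n, Measurable (φ n))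
    (hm : ∀ v, Monotone fun n => φ n v)
    (h : ∀ v, Filter.Tendsto (fun n => φ n v) Filter.atTop (nhds (ψ v))) :
    Filter.Tendsto (fun n => ∫⁻ v, 1 - expNeg (φ n v) ∂μ) Filter.atTop
      (nhds (∫⁻ v, 1 - expNeg (ψ v) ∂μ)) := by
  refine lintegral_tendsto_of_tendsto_of_monotone
    (fun n => (measurable_one_sub_expNeg (hφ n)).aemeasurable)
    (Filter.Eventually.of_forall fun v m n hmn => tsub_le_tsub_left (expNeg_antitone (hm v hmn)) _)
    (Filter.Eventually.of_forall fun v => ?_)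
  exact ENNReal.Tendsto.sub tendsto_const_nhds ((continuous_expNeg.tendsto _).comp (h v))
    (Or.inl ENNReal.one_ne_top)

/-- The Laplace functional of the point process `e₀, e₁, …` is that of a Poisson process of
intensity measure `Λ`. -/
structure HasPoissonLaplace {Ω Z : Type*} [MeasurableSpace Ω] [MeasurableSpace Z]
    (P : Measure Ω) (e : ℕ → Ω → Z) (Λ : Measure Z) : Prop where
  measurable : ∀ i, Measurable (e i)
  laplace : ∀ φ : Z → ℝ≥0∞, Measurable φ →
    ∫⁻ ω, expNeg (∑' i, φ (e i ω)) ∂P = expNeg (∫⁻ z, 1 - expNeg (φ z) ∂Λ)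

/-- Simple functions carried by sets of finite intensity increase to `φ`. The left side converges
boundedly and the exponent on the right monotonically. -/
theorem IsPoissonProcess.hasPoissonLaplace {Ω E : Type*} [MeasurableSpace Ω] [MeasurableSpace E]
    {P : Measure Ω} [IsProbabilityMeasure P] {x : ℕ → Ω → E} {μ : Measure E} [SigmaFinite μ]
    (h : IsPoissonProcess P x μ) : HasPoissonLaplace P x μ := by
  refine ⟨h.measurable, fun φ hφ => ?_⟩
  let f : ℕ → SimpleFunc E ℝ≥0∞ := fun n => (SimpleFunc.eapprox φ n).restrict (spanningSets μ n)
  have hf : ∀ n v, f n v = (spanningSets μ n).indicator (SimpleFunc.eapprox φ n) v := fun n v => by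
    rw [SimpleFunc.restrict_apply _ (measurableSet_spanningSets μ n)]
  have hmono : ∀ v, Monotone fun n => f n v := by
    intro v m n hmn
    simp only [hf]
    refine (Set.indicator_le_indicator_of_subset (monotone_spanningSets μ hmn)
      (fun _ => zero_le) v).trans ?_
    exact Set.indicator_le_indicator (SimpleFunc.monotone_eapprox φ hmn v)
  have hlim : ∀ v, Filter.Tendsto (fun n => f n v) Filter.atTop (nhds (φ v)) := by
    intro v
    have h1 : Filter.Tendsto (fun n => SimpleFunc.eapprox φ n v) Filter.atTop (nhds (φ v)) := by
      rw [← SimpleFunc.iSup_eapprox_apply hφ v]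
      exact tendsto_atTop_iSup fun m n hmn => SimpleFunc.monotone_eapprox φ hmn v
    refine h1.congr' ?_
    have hv : v ∈ ⋃ n, spanningSets μ n := by rw [iUnion_spanningSets]; trivial
    obtain ⟨k, hk⟩ := mem_iUnion.1 hv
    filter_upwards [Filter.eventually_ge_atTop k] with n hn
    rw [hf, indicator_of_mem (monotone_spanningSets μ hn hk)]
  have hstep : ∀ n, ∫⁻ ω, expNeg (∑' i, f n (x i ω)) ∂P =
      expNeg (∫⁻ v, 1 - expNeg (f n v) ∂μ) := by
    intro n
    refine h.lintegral_expNeg_simpleFunc _ fun c hc => ?_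
    rw [SimpleFunc.restrict_preimage_singleton _ (measurableSet_spanningSets μ n) hc]
    exact ((measure_mono inter_subset_left).trans_lt (measure_spanningSets_lt_top μ n)).ne
  have hL : Filter.Tendsto (fun n => ∫⁻ ω, expNeg (∑' i, f n (x i ω)) ∂P) Filter.atTop
      (nhds (∫⁻ ω, expNeg (∑' i, φ (x i ω)) ∂P)) :=
    tendsto_lintegral_expNeg
      (fun n => Measurable.tsum fun i => (f n).measurable.comp (h.measurable i))
      fun ω => tendsto_tsum_of_monotone (fun i => hmono _) fun i => hlim _
  have hR := (continuous_expNeg.tendsto _).comp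
    (tendsto_lintegral_one_sub_expNeg (μ := μ) (fun n => (f n).measurable) hmono hlim)
  refine tendsto_nhds_unique hL (hR.congr fun n => ?_)
  exact (hstep n).symm

/-! ### Independent marking -/

namespace IsIndependentMarking

variable {Ω E M : Type*} [MeasurableSpace Ω] [MeasurableSpace E] [MeasurableSpace M]
  {P : Measure Ω} {x : ℕ → Ω → E} {m : ℕ → Ω → M} {κ : Kernel E M}

/-- Restricted to the event that the marks lie in the given sets, the law of the points has density
∏ κ (x_i) (B_i). This is `cond_law` read as an identity of measures, which can be integrated against
any `g`. -/
theorem setLIntegral_marks (h : IsIndependentMarking P x m κ) (hx : ∀ i, Measurable (x i))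
    (s : Finset ℕ) {B : ℕ → Set M} (hB : ∀ i, MeasurableSet (B i)) {g : (ℕ → E) → ℝ≥0∞}
    (hg : Measurable g) :
    ∫⁻ ω in {ω | ∀ i ∈ s, m i ω ∈ B i}, g (fun i => x i ω) ∂P =
      ∫⁻ ω, (∏ i ∈ s, κ (x i ω) (B i)) * g (fun i => x i ω) ∂P := by
  have hX : Measurable fun ω => (fun i => x i ω) := measurable_pi_lambda _ hx
  have hS : MeasurableSet {ω | ∀ i ∈ s, m i ω ∈ B i} := by
    have : {ω | ∀ i ∈ s, m i ω ∈ B i} = ⋂ i ∈ s, m i ⁻¹' B i := by ext; simp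
    rw [this]
    exact Finset.measurableSet_biInter s fun i _ => h.measurable i (hB i)
  have hd : Measurable fun v : ℕ → E => ∏ i ∈ s, κ (v i) (B i) :=
    Finset.measurable_prod s fun i _ => (κ.measurable_coe (hB i)).comp (measurable_pi_apply i)
  have hme : (P.restrict {ω | ∀ i ∈ s, m i ω ∈ B i}).map (fun ω i => x i ω) =
      (P.map fun ω i => x i ω).withDensity fun v => ∏ i ∈ s, κ (v i) (B i) := by
    ext A hA
    rw [Measure.map_apply hX hA, Measure.restrict_apply (hX hA), withDensity_apply _ hA,
      setLIntegral_map hA hd hX]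
    exact h.cond_law A hA s B hB
  rw [← lintegral_map hg hX, hme, lintegral_withDensity_eq_lintegral_mul _ hd hg,
    lintegral_map (hd.mul hg) hX]
  rfl

variable [IsProbabilityMeasure P] [IsMarkovKernel κ]

/-- Conditionally on all points and all other marks, the `i`th mark has law `κ (xᵢ)`. -/
theorem lintegral_resample (h : IsIndependentMarking P x m κ) (hx : ∀ i, Measurable (x i))
    (i : ℕ) (d : M) {H : ((ℕ → E) × (ℕ → M)) × M → ℝ≥0∞} (hH : Measurable H) :
    ∫⁻ ω, H ((fun j => x j ω, Function.update (fun j => m j ω) i d), m i ω) ∂P =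
      ∫⁻ ω, ∫⁻ a, H ((fun j => x j ω, Function.update (fun j => m j ω) i d), a) ∂κ (x i ω) ∂P := by
  classical
  have hX : Measurable fun ω => (fun i => x i ω) := measurable_pi_lambda _ hx
  -- Overwriting the `i`th mark by the constant `d` keeps exactly the data other than that mark,
  -- without changing the index type.
  set W : Ω → (ℕ → E) × (ℕ → M) := fun ω => (fun j => x j ω, Function.update (fun j => m j ω) i d)
    with hW
  have hWm : Measurable W := by
    refine hX.prodMk (measurable_pi_lambda _ fun j => ?_)
    by_cases hj : j = i
    · subst hj; simp
    · simpa [Function.update_of_ne hj] using h.measurable j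
  have hWi : Measurable fun ω => (W ω, m i ω) := hWm.prodMk (h.measurable i)
  let κ' : Kernel ((ℕ → E) × (ℕ → M)) M := κ.comap (fun p => p.1 i) (by fun_prop)
  have : IsProbabilityMeasure (P.map W) := Measure.isProbabilityMeasure_map hWm.aemeasurable
  have : IsProbabilityMeasure (P.map fun ω => (W ω, m i ω)) :=
    Measure.isProbabilityMeasure_map hWi.aemeasurable
  -- It is enough to identify the joint law, and by a π-system argument to do so on boxes
  -- constraining the points, finitely many marks of `W`, and the `i`th mark.
  suffices hme : P.map (fun ω => (W ω, m i ω)) = (P.map W) ⊗ₘ κ' by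
    rw [← lintegral_map hH hWi, hme, Measure.lintegral_compProd hH, lintegral_map _ hWm]
    · rfl
    · exact hH.lintegral_kernel_prod_right'
  let D : Set (Set ((ℕ → E) × (ℕ → M))) :=
    image2 (· ×ˢ ·) {A | MeasurableSet A} (squareCylinders fun _ => {s | MeasurableSet s})
  have hDspan : IsCountablySpanning (squareCylinders fun _ : ℕ => {s : Set M | MeasurableSet s}) :=
    ⟨fun _ => univ, fun _ => ⟨∅, fun _ => univ, by simp, by simp⟩, by simp [iUnion_const]⟩
  have hpiD : IsPiSystem D := MeasurableSpace.isPiSystem_measurableSet.prod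
    (isPiSystem_squareCylinders (fun _ => MeasurableSpace.isPiSystem_measurableSet) (by simp))
  have hgenD : MeasurableSpace.generateFrom D = Prod.instMeasurableSpace :=
    generateFrom_eq_prod MeasurableSpace.generateFrom_measurableSet generateFrom_squareCylinders
      isCountablySpanning_measurableSet hDspan
  refine ext_of_generate_finite (image2 (· ×ˢ ·) D {B : Set M | MeasurableSet B})
    (generateFrom_eq_prod hgenD MeasurableSpace.generateFrom_measurableSet
      (isCountablySpanning_measurableSet.prod hDspan) isCountablySpanning_measurableSet).symm
    (hpiD.prod MeasurableSpace.isPiSystem_measurableSet) ?_ (by simp)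
  rintro _ ⟨_, ⟨A, hA, _, ⟨s, t, ht, rfl⟩, rfl⟩, B, hB, rfl⟩
  have ht' : ∀ j, MeasurableSet (t j) := fun j => ht j (mem_univ j)
  have hbox : MeasurableSet ((s : Set ℕ).pi t) := MeasurableSet.pi s.countable_toSet fun j _ => ht' j
  have hC : MeasurableSet (A ×ˢ (s : Set ℕ).pi t) := MeasurableSet.prod hA hbox
  simp only [mem_ofPred_eq] at hA hB
  rw [Measure.map_apply hWi (hC.prod hB), Measure.compProd_apply_prod hC hB,
    setLIntegral_map hC (κ'.measurable_coe hB) hWm]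
  -- If the box excludes the dummy `d` at index `i`, both sides vanish. Otherwise its constraint at
  -- `i` is void, and the slot `i` is free to carry `B`.
  by_cases hd : i ∈ s ∧ d ∉ t i
  · have h0 : W ⁻¹' (A ×ˢ (s : Set ℕ).pi t) = ∅ := by
      ext ω
      simp only [mem_preimage, mem_prod, mem_empty_iff_false, iff_false, not_and]
      intro _ hp
      have := hp i hd.1
      simp only [hW, Function.update_self] at this
      exact hd.2 this
    have h1 : (fun ω => (W ω, m i ω)) ⁻¹' ((A ×ˢ (s : Set ℕ).pi t) ×ˢ B) = ∅ := by
      rw [mk_preimage_prod, h0, empty_inter]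
    rw [h0, h1]; simp
  have hWpre : W ⁻¹' (A ×ˢ (s : Set ℕ).pi t) =
      {ω | (fun j => x j ω) ∈ A} ∩ {ω | ∀ j ∈ s.erase i, m j ω ∈ t j} := by
    ext ω
    simp only [hW, mem_preimage, mem_prod, mem_pi, Finset.mem_coe, mem_inter_iff, mem_ofPred_eq,
      Finset.mem_erase, and_imp]
    refine and_congr_right fun _ => ⟨fun hp j hji hj => ?_, fun hp j hj => ?_⟩
    · simpa [Function.update_of_ne hji] using hp j hj
    · by_cases hji : j = i
      · subst hji; simpa using not_not.1 fun hn => hd ⟨hj, hn⟩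
      · simpa [Function.update_of_ne hji] using hp j hji hj
  let B' : ℕ → Set M := Function.update t i B
  have hB' : ∀ j, MeasurableSet (B' j) := fun j => by
    by_cases hji : j = i
    · subst hji; simpa [B'] using hB
    · simpa [B', Function.update_of_ne hji] using ht' j
  have hpre : (fun ω => (W ω, m i ω)) ⁻¹' ((A ×ˢ (s : Set ℕ).pi t) ×ˢ B) =
      {ω | (fun j => x j ω) ∈ A ∧ ∀ j ∈ insert i (s.erase i), m j ω ∈ B' j} := by
    rw [mk_preimage_prod, hWpre]
    ext ω
    simp only [mem_inter_iff, mem_ofPred_eq, mem_preimage, Finset.forall_mem_insert, and_assoc]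
    refine and_congr_right fun _ => ?_
    rw [and_comm]
    refine and_congr (by simp [B']) (forall₂_congr fun j hj => ?_)
    simp [B', Function.update_of_ne (Finset.ne_of_mem_erase hj)]
  have hS : MeasurableSet {ω | (fun j => x j ω) ∈ A} := hX hA
  rw [hpre, h.cond_law A hA _ B' hB', hWpre, inter_comm]
  have h2 : ∫⁻ ω in {ω | ∀ j ∈ s.erase i, m j ω ∈ t j} ∩ {ω | (fun j => x j ω) ∈ A},
      κ' (W ω) B ∂P = ∫⁻ ω in {ω | ∀ j ∈ s.erase i, m j ω ∈ t j},
        A.indicator (fun v => κ (v i) B) (fun j => x j ω) ∂P := by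
    rw [inter_comm, ← Measure.restrict_restrict hS, ← lintegral_indicator hS]
    rfl
  rw [h2, h.setLIntegral_marks hx _ (g := A.indicator fun v => κ (v i) B) ht'
    (((κ.measurable_coe hB).comp (measurable_pi_apply i)).indicator hA), ← lintegral_indicator hS]
  refine lintegral_congr fun ω => ?_
  by_cases hω : (fun j => x j ω) ∈ A
  · rw [indicator_of_mem (by exact hω), indicator_of_mem hω,
      Finset.prod_insert (Finset.notMem_erase _ _), mul_comm]
    congr 1
    · exact Finset.prod_congr rfl fun j hj => by
        simp [B', Function.update_of_ne (Finset.ne_of_mem_erase hj)]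
    · simp [B']
  · rw [indicator_of_notMem (by exact hω), indicator_of_notMem hω, mul_zero]

/-- The marks are integrated out one at a time. `K` is arbitrary because each integrated factor has
become a function of the points alone and is absorbed into it. -/
theorem lintegral_prod_marks (h : IsIndependentMarking P x m κ) (hx : ∀ i, Measurable (x i))
    {G : E × M → ℝ≥0∞} (hG : Measurable G) (s : Finset ℕ) :
    ∀ {K : (ℕ → E) → ℝ≥0∞}, Measurable K →
    ∫⁻ ω, K (fun i => x i ω) * ∏ i ∈ s, G (x i ω, m i ω) ∂P =
      ∫⁻ ω, K (fun i => x i ω) * ∏ i ∈ s, ∫⁻ a, G (x i ω, a) ∂κ (x i ω) ∂P := by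
  classical
  induction s using Finset.induction_on with
  | empty => intro K _; simp
  | insert i s hi ih =>
    intro K hK
    -- A sample point is needed only to supply the dummy mark.
    rcases isEmpty_or_nonempty Ω with hΩ | ⟨⟨ω₀⟩⟩
    · simp [lintegral_of_isEmpty]
    let H : ((ℕ → E) × (ℕ → M)) × M → ℝ≥0∞ := fun p =>
      K p.1.1 * (G (p.1.1 i, p.2) * ∏ j ∈ s, G (p.1.1 j, p.1.2 j))
    have hH : Measurable H := by
      refine (hK.comp (by fun_prop)).mul ((hG.comp (by fun_prop)).mul ?_)
      exact Finset.measurable_prod s fun j _ => hG.comp (by fun_prop)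
    have hu : ∀ (ω : Ω) j, j ∈ s →
        Function.update (fun j => m j ω) i (m i ω₀) j = m j ω := fun ω j hj =>
      Function.update_of_ne (by rintro rfl; exact hi hj) _ _
    have hGκ : Measurable fun v : ℕ → E => ∫⁻ a, G (v i, a) ∂κ (v i) :=
      (hG.lintegral_kernel_prod_right' (κ := κ)).comp (measurable_pi_apply i)
    have h1 := h.lintegral_resample hx i (m i ω₀) hH
    have h2 : ∀ ω, H ((fun j => x j ω, Function.update (fun j => m j ω) i (m i ω₀)), m i ω) =
        K (fun i => x i ω) * ∏ j ∈ insert i s, G (x j ω, m j ω) := by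
      intro ω
      simp only [H]
      rw [Finset.prod_insert hi, Finset.prod_congr rfl fun j hj => by rw [hu ω j hj]]
    have h3 : ∀ ω, ∫⁻ a, H ((fun j => x j ω, Function.update (fun j => m j ω) i (m i ω₀)), a)
        ∂κ (x i ω) = (K (fun i => x i ω) * ∫⁻ a, G (x i ω, a) ∂κ (x i ω)) *
          ∏ j ∈ s, G (x j ω, m j ω) := by
      intro ω
      simp only [H]
      rw [Finset.prod_congr rfl fun j hj => by rw [hu ω j hj]]
      have hGm : Measurable fun a => G (x i ω, a) := hG.comp (by fun_prop)
      rw [lintegral_const_mul _ (hGm.mul_const _), lintegral_mul_const _ hGm, mul_assoc]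
    simp_rw [h2, h3] at h1
    rw [h1, ih (K := fun v => K v * ∫⁻ a, G (v i, a) ∂κ (v i)) (hK.mul hGκ)]
    refine lintegral_congr fun ω => ?_
    rw [Finset.prod_insert hi, mul_assoc]

/-- The marking theorem for Poisson processes. -/
theorem hasPoissonLaplace (h : IsIndependentMarking P x m κ) {μ : Measure E} [SFinite μ]
    (hp : HasPoissonLaplace P x μ) :
    HasPoissonLaplace P (fun i ω => (x i ω, m i ω)) (μ ⊗ₘ κ) := by
  have hx := hp.measurable
  refine ⟨fun i => (hx i).prodMk (h.measurable i), fun φ hφ => ?_⟩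
  -- Given the points, e^{-φ} averages over the mark to `t`. So the marked process with `φ` has the
  -- same Laplace functional as the unmarked one with -log t, which may be infinite.
  let t : E → ℝ≥0∞ := fun v => ∫⁻ a, expNeg (φ (v, a)) ∂κ v
  have hφe : Measurable fun p => expNeg (φ p) := measurable_expNeg.comp hφ
  have ht : Measurable t := hφe.lintegral_kernel_prod_right'
  have ht1 : ∀ v, t v ≤ 1 := fun v => by
    refine (lintegral_mono fun a => expNeg_le_one _).trans ?_
    simp
  -- Independence of the marks concerns finitely many at a time, hence partial sums. Both sides then
  -- converge boundedly.
  have hn : ∀ n : ℕ, ∫⁻ ω, expNeg (∑ i ∈ Finset.range n, φ (x i ω, m i ω)) ∂P =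
      ∫⁻ ω, expNeg (∑ i ∈ Finset.range n, negLog (t (x i ω))) ∂P := by
    intro n
    simp_rw [expNeg_finset_sum, expNeg_negLog (ht1 _)]
    simpa using h.lintegral_prod_marks hx hφe (Finset.range n) (K := fun _ => 1) measurable_const
  have hψ : Measurable fun v => negLog (t v) := measurable_negLog.comp ht
  have hL := tendsto_lintegral_expNeg (P := P)
    (X := fun n ω => ∑ i ∈ Finset.range n, φ (x i ω, m i ω))
    (Y := fun ω => ∑' i, φ (x i ω, m i ω))
    (fun n => Finset.measurable_sum _ fun i _ => hφ.comp ((hx i).prodMk (h.measurable i)))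
    fun ω => ENNReal.summable.hasSum.tendsto_sum_nat
  have hR := tendsto_lintegral_expNeg (P := P)
    (X := fun n ω => ∑ i ∈ Finset.range n, negLog (t (x i ω)))
    (Y := fun ω => ∑' i, negLog (t (x i ω)))
    (fun n => Finset.measurable_sum _ fun i _ => hψ.comp (hx i))
    fun ω => ENNReal.summable.hasSum.tendsto_sum_nat
  rw [tendsto_nhds_unique hL (hR.congr fun n => (hn n).symm), hp.laplace _ hψ,
    Measure.lintegral_compProd (measurable_one_sub_expNeg hφ)]
  congr 1
  refine lintegral_congr fun v => ?_
  have hm : Measurable fun a => expNeg (φ (v, a)) := hφe.comp (by fun_prop)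
  rw [expNeg_negLog (ht1 v), lintegral_sub hm
    ((ht1 v).trans_lt ENNReal.one_lt_top).ne (Filter.Eventually.of_forall fun a => expNeg_le_one _)]
  simp [t]

end IsIndependentMarking

/-! ### Limits at zero -/

theorem one_sub_expNeg_le (a : ℝ≥0∞) : 1 - expNeg a ≤ a := by
  induction a with
  | top => simp
  | coe a =>
    rw [expNeg_coe, ← ENNReal.ofReal_one, ← ENNReal.ofReal_sub _ (Real.exp_nonneg _),
      ← ENNReal.ofReal_coe_nnreal]
    exact ENNReal.ofReal_le_ofReal (by linarith [Real.one_sub_le_exp_neg (a : ℝ)])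

theorem HasDerivAt.tendsto_nat_mul {f : ℝ → ℝ} {c : ℝ} (hf : HasDerivAt f c 0) (h0 : f 0 = 0) :
    Filter.Tendsto (fun n : ℕ => ((n : ℝ) + 1) * f (1 / ((n : ℝ) + 1))) Filter.atTop (nhds c) := by
  have h1 := hasDerivAt_iff_tendsto_slope.1 hf
  have h2 : Filter.Tendsto (fun n : ℕ => 1 / ((n : ℝ) + 1)) Filter.atTop (nhdsWithin 0 {0}ᶜ) := by
    refine tendsto_nhdsWithin_iff.2 ⟨tendsto_one_div_add_atTop_nhds_zero_nat, ?_⟩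
    exact Filter.Eventually.of_forall fun n => (Nat.one_div_pos_of_nat (α := ℝ)).ne'
  refine (h1.comp h2).congr fun n => ?_
  simp [slope_def_field, h0, div_eq_mul_inv, mul_comm]

/-- The derivative of 1 - e^{-xa} at 0, taken along x = 1/(n+1). For a = ∞ the bracket is constantly
1. -/
theorem tendsto_nat_mul_one_sub_expNeg (a : ℝ≥0∞) :
    Filter.Tendsto (fun n : ℕ => ((n : ℝ≥0∞) + 1) *
      (1 - expNeg (ENNReal.ofReal (1 / ((n : ℝ) + 1)) * a))) Filter.atTop (nhds a) := by
  induction a with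
  | top =>
    have : ∀ n : ℕ, ENNReal.ofReal (1 / ((n : ℝ) + 1)) * ∞ = ∞ := fun n =>
      ENNReal.mul_top (by simpa using Nat.one_div_pos_of_nat (α := ℝ) (n := n))
    simp only [this, expNeg_top, tsub_zero, mul_one]
    exact ENNReal.tendsto_nat_nhds_top.comp (Filter.tendsto_add_atTop_nat 1) |>.congr
      fun n => by simp
  | coe a =>
    have hd : HasDerivAt (fun x : ℝ => 1 - Real.exp (-(x * a))) (a : ℝ) 0 := by
      have : HasDerivAt (fun x : ℝ => -(x * (a : ℝ))) (-(1 * (a : ℝ))) 0 :=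
        ((hasDerivAt_id (0 : ℝ)).mul_const _).neg
      simpa using (this.exp).const_sub 1
    have := ENNReal.tendsto_ofReal (hd.tendsto_nat_mul (by simp))
    rw [ENNReal.ofReal_coe_nnreal] at this
    refine this.congr fun n => ?_
    rw [← ENNReal.ofReal_coe_nnreal (p := a), ← ENNReal.ofReal_mul (by positivity),
      expNeg_ofReal (by positivity), ← ENNReal.ofReal_one, ← ENNReal.ofReal_sub _ (Real.exp_nonneg _),
      ENNReal.ofReal_mul (by positivity), ENNReal.ofReal_add (by positivity) zero_le_one,
      ENNReal.ofReal_natCast]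

/-- The derivative at ε = 0 of 1 - exp(-c (1 - e^{-ε})), the relative loss in the Laplace functional
when ε 1_A is added to the weight. -/
theorem tendsto_nat_mul_one_sub_expNeg_expNeg {c : ℝ≥0∞} (hc : c ≠ ∞) :
    Filter.Tendsto (fun n : ℕ => ((n : ℝ≥0∞) + 1) *
      (1 - expNeg (c * (1 - expNeg (ENNReal.ofReal (1 / ((n : ℝ) + 1)))))))
      Filter.atTop (nhds c) := by
  lift c to ℝ≥0 using hc
  have hd : HasDerivAt (fun x : ℝ => 1 - Real.exp (-(c * (1 - Real.exp (-x))))) (c : ℝ) 0 := by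
    have h1 : HasDerivAt (fun x : ℝ => Real.exp (-x)) (-1) 0 := by
      simpa using (hasDerivAt_id (0 : ℝ)).neg.exp
    have h2 := (((h1.const_sub 1).const_mul (c : ℝ)).neg.exp).const_sub 1
    simpa using h2
  have := ENNReal.tendsto_ofReal (hd.tendsto_nat_mul (by simp))
  rw [ENNReal.ofReal_coe_nnreal] at this
  refine this.congr fun n => ?_
  have h1 : Real.exp (-(1 / ((n : ℝ) + 1))) ≤ 1 := Real.exp_le_one_iff.2 (by
    rw [neg_nonpos]; positivity)
  rw [expNeg_ofReal (by positivity), ← ENNReal.ofReal_one,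
    ← ENNReal.ofReal_sub _ (Real.exp_nonneg _), ← ENNReal.ofReal_coe_nnreal (p := c),
    ← ENNReal.ofReal_mul c.coe_nonneg,
    expNeg_ofReal (mul_nonneg c.coe_nonneg (by linarith)), ← ENNReal.ofReal_sub _ (Real.exp_nonneg _),
    ENNReal.ofReal_mul (by positivity), ENNReal.ofReal_add (by positivity) zero_le_one,
    ENNReal.ofReal_natCast]

/-! ### The Campbell–Mecke formula -/

/-- The sum of `φ` over all points but the `i`th one. -/
noncomputable def reducedSum {Ω Z : Type*} (e : ℕ → Ω → Z) (φ : Z → ℝ≥0∞) (i : ℕ) (ω : Ω) : ℝ≥0∞ :=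
  ∑' j, if j = i then 0 else φ (e j ω)

theorem reducedSum_add {Ω Z : Type*} (e : ℕ → Ω → Z) (φ : Z → ℝ≥0∞) (i : ℕ) (ω : Ω) :
    φ (e i ω) + reducedSum e φ i ω = ∑' j, φ (e j ω) := by
  rw [ENNReal.tsum_eq_add_tsum_ite i, reducedSum]
  congr!

/-- The expectation of the sum over the points `z` in `A` of `exp (-∑ φ z z')`, where `z'` runs
through the other points. -/
noncomputable def palmSum {Ω Z : Type*} [MeasurableSpace Ω] (P : Measure Ω) (e : ℕ → Ω → Z)
    (A : Set Z) (φ : Z → Z → ℝ≥0∞) : ℝ≥0∞ :=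
  ∑' i, ∫⁻ ω, A.indicator 1 (e i ω) * expNeg (reducedSum e (φ (e i ω)) i ω) ∂P

namespace HasPoissonLaplace

variable {Ω Z : Type*} [MeasurableSpace Ω] [MeasurableSpace Z] {P : Measure Ω}
  {e : ℕ → Ω → Z} {Λ : Measure Z}

theorem measurable_tsum (h : HasPoissonLaplace P e Λ) {φ : Z → ℝ≥0∞} (hφ : Measurable φ) :
    Measurable fun ω => ∑' i, φ (e i ω) :=
  Measurable.tsum fun i => hφ.comp (h.measurable i)

theorem measurable_reducedSum (h : HasPoissonLaplace P e Λ) {φ : Z → Z → ℝ≥0∞}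
    (hφ : Measurable (Function.uncurry φ)) (i : ℕ) :
    Measurable fun ω => reducedSum e (φ (e i ω)) i ω := by
  refine Measurable.tsum fun j => ?_
  split_ifs
  · exact measurable_const
  · exact hφ.comp ((h.measurable i).prodMk (h.measurable j))

/-- Both sides are minus the derivative at ε = 0 of the Laplace functional of φ + ε 1_A. The finite
intensity of `A` makes the derivative finite. -/
theorem lintegral_count_mul_expNeg [IsProbabilityMeasure P] (h : HasPoissonLaplace P e Λ)
    {A : Set Z} (hA : MeasurableSet A)
    (hΛ : Λ A ≠ ∞) {φ : Z → ℝ≥0∞} (hφ : Measurable φ) :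
    ∫⁻ ω, expNeg (∑' i, φ (e i ω)) * ∑' i, A.indicator 1 (e i ω) ∂P =
      expNeg (∫⁻ z, 1 - expNeg (φ z) ∂Λ) * ∫⁻ z in A, expNeg (φ z) ∂Λ := by
  set c := ∫⁻ z in A, expNeg (φ z) ∂Λ with hc
  set L := expNeg (∫⁻ z, 1 - expNeg (φ z) ∂Λ) with hL
  have hctop : c ≠ ∞ := by
    refine ((lintegral_mono fun z => expNeg_le_one (φ z)).trans_lt ?_).ne
    simpa using hΛ.lt_top
  have h1A : Measurable (A.indicator (1 : Z → ℝ≥0∞)) := measurable_one.indicator hA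
  set w : Ω → ℝ≥0∞ := fun ω => expNeg (∑' i, φ (e i ω)) with hw
  set N : Ω → ℝ≥0∞ := fun ω => ∑' i, A.indicator 1 (e i ω) with hN
  have hφe : Measurable fun z => expNeg (φ z) := measurable_expNeg.comp hφ
  have hwm : Measurable w := measurable_expNeg.comp (h.measurable_tsum hφ)
  have hNm : Measurable N := h.measurable_tsum h1A
  have hlap : ∀ ε : ℝ≥0∞, ∫⁻ ω, w ω * expNeg (ε * N ω) ∂P = L * expNeg (c * (1 - expNeg ε)) := by
    intro ε
    have hm : Measurable fun z => φ z + ε * A.indicator 1 z := hφ.add (h1A.const_mul _)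
    have h1 := h.laplace _ hm
    have h2 : ∀ ω, expNeg (∑' i, (φ (e i ω) + ε * A.indicator 1 (e i ω))) =
        w ω * expNeg (ε * N ω) := fun ω => by
      rw [ENNReal.tsum_add, expNeg_add, ENNReal.tsum_mul_left]
    -- Adding ε on `A` raises 1 - e^{-φ} there by e^{-φ} (1 - e^{-ε}), so the exponent grows by `c *
    -- (1 - expNeg ε)`.
    have h3 : ∀ z, 1 - expNeg (φ z + ε * A.indicator 1 z) =
        (1 - expNeg (φ z)) + A.indicator (fun z => expNeg (φ z) * (1 - expNeg ε)) z := by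
      intro z
      by_cases hz : z ∈ A
      · simp only [indicator_of_mem hz, Pi.one_apply, mul_one, expNeg_add]
        rw [ENNReal.mul_sub (fun _ _ => expNeg_ne_top _), mul_one, tsub_add_tsub_cancel
          (expNeg_le_one _) (mul_le_of_le_one_right' (expNeg_le_one _))]
      · simp [indicator_of_notMem hz]
    simp_rw [h2, h3] at h1
    rw [h1, lintegral_add_left (measurable_one_sub_expNeg hφ), expNeg_add, lintegral_indicator hA,
      lintegral_mul_const _ hφe]
  have hw1 : ∫⁻ ω, w ω ∂P = L := h.laplace φ hφ
  -- The difference quotients at ε = 1/(n+1), integrated.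
  have hstep : ∀ n : ℕ, ∫⁻ ω, w ω * (((n : ℝ≥0∞) + 1) *
      (1 - expNeg (ENNReal.ofReal (1 / ((n : ℝ) + 1)) * N ω))) ∂P =
      L * (((n : ℝ≥0∞) + 1) *
      (1 - expNeg (c * (1 - expNeg (ENNReal.ofReal (1 / ((n : ℝ) + 1))))))) := by
    intro n
    set ε := ENNReal.ofReal (1 / ((n : ℝ) + 1))
    have hm : Measurable fun ω => w ω * expNeg (ε * N ω) :=
      hwm.mul (measurable_expNeg.comp (hNm.const_mul _))
    have h1 : ∫⁻ ω, (w ω - w ω * expNeg (ε * N ω)) ∂P = L - L * expNeg (c * (1 - expNeg ε)) := by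
      rw [lintegral_sub hm, hw1, hlap]
      · rw [hlap]; exact ENNReal.mul_ne_top (expNeg_ne_top _) (expNeg_ne_top _)
      · exact Filter.Eventually.of_forall fun ω => mul_le_of_le_one_right' (expNeg_le_one _)
    have h2 : ∀ ω, w ω * (((n : ℝ≥0∞) + 1) * (1 - expNeg (ε * N ω))) =
        ((n : ℝ≥0∞) + 1) * (w ω - w ω * expNeg (ε * N ω)) := fun ω => by
      rw [mul_left_comm, ENNReal.mul_sub (fun _ _ => expNeg_ne_top _), mul_one]
    simp_rw [h2]
    have h3 : Measurable fun ω => w ω - w ω * expNeg (ε * N ω) := hwm.sub hm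
    rw [lintegral_const_mul _ h3, h1, mul_left_comm,
      ENNReal.mul_sub (fun _ _ => expNeg_ne_top _), mul_one]
  have hlimR : Filter.Tendsto (fun n : ℕ => L * (((n : ℝ≥0∞) + 1) *
      (1 - expNeg (c * (1 - expNeg (ENNReal.ofReal (1 / ((n : ℝ) + 1)))))))) Filter.atTop
      (nhds (L * c)) :=
    ENNReal.Tendsto.const_mul (tendsto_nat_mul_one_sub_expNeg_expNeg hctop)
      (Or.inr (expNeg_ne_top _))
  apply le_antisymm
  -- Upper bound: Fatou's lemma for the difference quotients.
  · have h1 : ∀ ω, w ω * N ω = Filter.liminf (fun n : ℕ => w ω * (((n : ℝ≥0∞) + 1) *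
        (1 - expNeg (ENNReal.ofReal (1 / ((n : ℝ) + 1)) * N ω)))) Filter.atTop := fun ω =>
      ((ENNReal.Tendsto.const_mul (tendsto_nat_mul_one_sub_expNeg (N ω))
        (Or.inr (expNeg_ne_top _))).liminf_eq).symm
    rw [show ∫⁻ ω, expNeg (∑' i, φ (e i ω)) * ∑' i, A.indicator 1 (e i ω) ∂P =
      ∫⁻ ω, w ω * N ω ∂P from rfl, lintegral_congr h1]
    refine (lintegral_liminf_le fun n => ?_).trans ?_
    · exact hwm.mul ((measurable_one_sub_expNeg (hNm.const_mul _)).const_mul _)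
    · rw [Filter.liminf_congr (Filter.Eventually.of_forall hstep)]
      exact hlimR.liminf_eq.le
  -- Lower bound: since 1 - e^{-x} ≤ x, every difference quotient is at most `w * N`.
  · refine le_of_tendsto hlimR (Filter.Eventually.of_forall fun n => ?_)
    rw [← hstep]
    refine lintegral_mono fun ω => mul_le_mul_right ?_ _
    refine (mul_le_mul_right (one_sub_expNeg_le _) _).trans ?_
    rw [← mul_assoc]
    refine mul_le_of_le_one_left' (le_of_eq ?_)
    rw [← ENNReal.ofReal_natCast, ← ENNReal.ofReal_one, ← ENNReal.ofReal_add (by positivity) zero_le_one,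
      ← ENNReal.ofReal_mul (by positivity)]
    congr 1; field_simp

/-- Both sides of the Campbell formula as measures. -/
theorem sum_map_withDensity [IsProbabilityMeasure P] [SigmaFinite Λ] (h : HasPoissonLaplace P e Λ)
    {φ : Z → ℝ≥0∞} (hφ : Measurable φ) :
    Measure.sum (fun i => (P.withDensity fun ω => expNeg (∑' i, φ (e i ω))).map (e i)) =
      expNeg (∫⁻ z, 1 - expNeg (φ z) ∂Λ) • Λ.withDensity fun z => expNeg (φ z) := by
  have hwm : Measurable fun ω => expNeg (∑' i, φ (e i ω)) :=
    measurable_expNeg.comp (h.measurable_tsum hφ)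
  have key : ∀ A, MeasurableSet A → Λ A ≠ ∞ →
      Measure.sum (fun i => (P.withDensity fun ω => expNeg (∑' i, φ (e i ω))).map (e i)) A =
      (expNeg (∫⁻ z, 1 - expNeg (φ z) ∂Λ) • Λ.withDensity fun z => expNeg (φ z)) A := by
    intro A hA hΛ
    rw [Measure.sum_apply _ hA, Measure.smul_apply, withDensity_apply _ hA, smul_eq_mul,
      ← h.lintegral_count_mul_expNeg hA hΛ hφ]
    simp_rw [← ENNReal.tsum_mul_left]
    have hm : ∀ i, Measurable fun ω =>
        expNeg (∑' i, φ (e i ω)) * A.indicator (1 : Z → ℝ≥0∞) (e i ω) := fun i =>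
      hwm.mul ((measurable_one.indicator hA).comp (h.measurable i))
    rw [lintegral_tsum fun i => (hm i).aemeasurable]
    refine tsum_congr fun i => ?_
    rw [Measure.map_apply (h.measurable i) hA, withDensity_apply _ (h.measurable i hA),
      ← lintegral_indicator (h.measurable i hA)]
    refine lintegral_congr fun ω => ?_
    by_cases hω : e i ω ∈ A
    · rw [indicator_of_mem (by exact hω), indicator_of_mem hω]; simp
    · rw [indicator_of_notMem (by exact hω), indicator_of_notMem hω]; simp
  refine (Measure.ext_iff_of_iUnion_eq_univ (iUnion_spanningSets Λ)).2 fun n => ?_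
  ext A hA
  rw [Measure.restrict_apply hA, Measure.restrict_apply hA]
  exact key _ (hA.inter (measurableSet_spanningSets Λ n))
    ((measure_mono inter_subset_right).trans_lt (measure_spanningSets_lt_top Λ n)).ne

/-- Integrating 1_A e^{φ} in `sum_map_withDensity` cancels the term of the point itself and leaves
the sum over the others. Finiteness of `φ` makes e^{-φ} invertible. -/
theorem palmSum_const_of_ne_top [IsProbabilityMeasure P] [SigmaFinite Λ]
    (h : HasPoissonLaplace P e Λ) {A : Set Z} (hA : MeasurableSet A)
    {φ : Z → ℝ≥0∞} (hφ : Measurable φ) (hφt : ∀ z, φ z ≠ ∞) :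
    palmSum P e A (fun _ => φ) = ∫⁻ _ in A, expNeg (∫⁻ z', 1 - expNeg (φ z') ∂Λ) ∂Λ := by
  have hwm : Measurable fun ω => expNeg (∑' i, φ (e i ω)) :=
    measurable_expNeg.comp (h.measurable_tsum hφ)
  have hφe : Measurable fun z => expNeg (φ z) := measurable_expNeg.comp hφ
  set g : Z → ℝ≥0∞ := A.indicator fun z => (expNeg (φ z))⁻¹ with hg
  have hgm : Measurable g := hφe.inv.indicator hA
  have hinv : ∀ z, expNeg (φ z) * (expNeg (φ z))⁻¹ = 1 := fun z =>
    ENNReal.mul_inv_cancel (fun h => hφt z (expNeg_eq_zero.1 h)) (expNeg_ne_top _)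
  have h1 := congrArg (fun ν => ∫⁻ z, g z ∂ν) (h.sum_map_withDensity hφ)
  simp only [lintegral_sum_measure, lintegral_smul_measure, smul_eq_mul] at h1
  rw [lintegral_withDensity_eq_lintegral_mul _ hφe hgm] at h1
  have h2 : ∀ z, ((fun z => expNeg (φ z)) * g) z = A.indicator 1 z := by
    intro z
    by_cases hz : z ∈ A
    · simp [hg, hz, hinv]
    · simp [hg, hz]
  simp_rw [h2] at h1
  rw [lintegral_indicator_one hA] at h1
  rw [lintegral_const, Measure.restrict_apply_univ, ← h1]
  refine tsum_congr fun i => ?_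
  have hge : Measurable fun ω => g (e i ω) := hgm.comp (h.measurable i)
  rw [lintegral_map hgm (h.measurable i), lintegral_withDensity_eq_lintegral_mul _ hwm hge]
  refine lintegral_congr fun ω => ?_
  simp only [Pi.mul_apply]
  rw [← reducedSum_add e φ i ω, expNeg_add]
  by_cases hz : e i ω ∈ A
  · simp only [hg, hz, indicator_of_mem, Pi.one_apply, one_mul]
    rw [mul_comm (expNeg (φ (e i ω))), mul_assoc, hinv, mul_one]
  · simp [hg, hz]

theorem tsum_measure_preimage [IsProbabilityMeasure P] [SigmaFinite Λ]
    (h : HasPoissonLaplace P e Λ) {A : Set Z} (hA : MeasurableSet A) :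
    ∑' i, P (e i ⁻¹' A) = Λ A := by
  have := h.palmSum_const_of_ne_top hA (φ := fun _ => 0) measurable_const (by simp)
  simp only [palmSum, reducedSum, ite_self, tsum_zero, expNeg_zero, mul_one, tsub_self,
    lintegral_const, zero_mul, Measure.restrict_apply_univ, one_mul] at this
  rw [← this]
  refine tsum_congr fun i => ?_
  rw [← lintegral_indicator_one (h.measurable i hA)]
  rfl

/-- The Palm formula is stable under increasing limits of the weight. The terms are dominated by
P(e_i ∈ A), whose sum Λ(A) is finite. -/
theorem palmSum_of_tendsto [IsProbabilityMeasure P] [SigmaFinite Λ]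
    (h : HasPoissonLaplace P e Λ) {A : Set Z} (hA : MeasurableSet A) (hΛ : Λ A ≠ ∞)
    {φ : ℕ → Z → Z → ℝ≥0∞} {ψ : Z → Z → ℝ≥0∞} (hφ : ∀ n, Measurable (Function.uncurry (φ n)))
    (hmono : ∀ z z', Monotone fun n => φ n z z')
    (hlim : ∀ z z', Filter.Tendsto (fun n => φ n z z') Filter.atTop (nhds (ψ z z')))
    (hM : ∀ n, palmSum P e A (φ n) = ∫⁻ z in A, expNeg (∫⁻ z', 1 - expNeg (φ n z z') ∂Λ) ∂Λ) :
    palmSum P e A ψ = ∫⁻ z in A, expNeg (∫⁻ z', 1 - expNeg (ψ z z') ∂Λ) ∂Λ := by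
  have h1A : ∀ i, Measurable fun ω => A.indicator (1 : Z → ℝ≥0∞) (e i ω) := fun i =>
    (measurable_one.indicator hA).comp (h.measurable i)
  have hL : Filter.Tendsto (fun n => palmSum P e A (φ n)) Filter.atTop
      (nhds (palmSum P e A ψ)) := by
    simp only [palmSum, ← lintegral_count]
    refine tendsto_lintegral_of_dominated_convergence (fun i => P (e i ⁻¹' A))
      (fun n => measurable_of_countable _) (fun n => ?_) ?_ ?_
    · refine Filter.Eventually.of_forall fun i => ?_
      simp only [← lintegral_indicator_one (h.measurable i hA)]
      exact lintegral_mono fun ω => mul_le_of_le_one_right' (expNeg_le_one _)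
    · rw [lintegral_count, h.tsum_measure_preimage hA]; exact hΛ
    · refine Filter.Eventually.of_forall fun i => ?_
      refine tendsto_lintegral_of_dominated_convergence (fun _ => 1) (fun n =>
        (h1A i).mul (measurable_expNeg.comp (h.measurable_reducedSum (hφ n) i))) (fun n => ?_)
        (by simp) ?_
      · refine Filter.Eventually.of_forall fun ω => ?_
        exact (mul_le_of_le_one_right' (expNeg_le_one _)).trans
          (indicator_le_self' (fun _ _ => zero_le) _)
      · refine Filter.Eventually.of_forall fun ω => ?_
        refine ENNReal.Tendsto.const_mul ((continuous_expNeg.tendsto _).comp ?_)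
          (Or.inr ?_)
        · refine tendsto_tsum_of_monotone (fun j => ?_) fun j => ?_
          · split_ifs
            · exact monotone_const
            · exact hmono _ _
          · split_ifs
            · exact tendsto_const_nhds
            · exact hlim _ _
        · by_cases hz : e i ω ∈ A <;> simp [hz]
  refine tendsto_nhds_unique hL (Filter.Tendsto.congr (fun n => (hM n).symm) ?_)
  have : IsFiniteMeasure (Λ.restrict A) := ⟨by simpa using hΛ.lt_top⟩
  refine tendsto_lintegral_expNeg (fun n => ?_) fun z =>
    tendsto_lintegral_one_sub_expNeg
      (fun n => (hφ n).comp (measurable_const.prodMk measurable_id)) (hmono z) (hlim z)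
  exact Measurable.lintegral_prod_right' (measurable_one_sub_expNeg (hφ n))

/-- Truncating the weight at n removes the finiteness assumption. Infinite weights are needed
because they express exclusion of points. -/
theorem palmSum_const [IsProbabilityMeasure P] [SigmaFinite Λ]
    (h : HasPoissonLaplace P e Λ) {A : Set Z} (hA : MeasurableSet A) (hΛ : Λ A ≠ ∞)
    {φ : Z → ℝ≥0∞} (hφ : Measurable φ) :
    palmSum P e A (fun _ => φ) = ∫⁻ _ in A, expNeg (∫⁻ z', 1 - expNeg (φ z') ∂Λ) ∂Λ := by
  refine h.palmSum_of_tendsto hA hΛ (φ := fun n _ z' => min (φ z') n) (fun n => ?_)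
    (fun z z' m n hmn => min_le_min_left _ (by exact_mod_cast hmn)) (fun z z' => ?_) fun n => ?_
  · exact (hφ.comp measurable_snd).min measurable_const
  · have : Filter.Tendsto (fun n : ℕ => min (φ z') (n : ℝ≥0∞)) Filter.atTop
        (nhds (min (φ z') ∞)) := tendsto_const_nhds.min ENNReal.tendsto_nat_nhds_top
    simpa using this
  · exact h.palmSum_const_of_ne_top hA (hφ.min measurable_const) fun z =>
      (min_lt_of_right_lt (ENNReal.natCast_lt_top n)).ne

/-- Cutting `A` along the level sets of the label reduces to a weight that does not depend on the
typical point. -/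
theorem palmSum_of_countable [IsProbabilityMeasure P] [SigmaFinite Λ]
    (h : HasPoissonLaplace P e Λ) {A : Set Z} (hA : MeasurableSet A) (hΛ : Λ A ≠ ∞)
    {k : Z → ℤ} (hk : Measurable k) {φ : ℤ → Z → ℝ≥0∞} (hφ : ∀ c, Measurable (φ c)) :
    palmSum P e A (fun z => φ (k z)) =
      ∫⁻ z in A, expNeg (∫⁻ z', 1 - expNeg (φ (k z) z') ∂Λ) ∂Λ := by
  have hkm : ∀ c, MeasurableSet (A ∩ k ⁻¹' {c}) := fun c => hA.inter (hk (measurableSet_singleton c))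
  have hdisj : Pairwise (Function.onFun Disjoint fun c => A ∩ k ⁻¹' {c}) := fun c d hcd =>
    (Disjoint.preimage k (disjoint_singleton.2 hcd)).mono inter_subset_right inter_subset_right
  have hU : A = ⋃ c, A ∩ k ⁻¹' {c} := by
    ext z; simp
  have h1 : palmSum P e A (fun z => φ (k z)) =
      ∑' c, palmSum P e (A ∩ k ⁻¹' {c}) (fun _ => φ c) := by
    have hm : ∀ c i, Measurable fun ω => (A ∩ k ⁻¹' {c}).indicator (1 : Z → ℝ≥0∞) (e i ω) *
        expNeg (reducedSum e (φ c) i ω) := fun c i =>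
      ((measurable_one.indicator (hkm c)).comp (h.measurable i)).mul
        (measurable_expNeg.comp (h.measurable_reducedSum (φ := fun _ => φ c)
          ((hφ c).comp measurable_snd) i))
    simp only [palmSum]
    rw [ENNReal.tsum_comm]
    refine tsum_congr fun i => ?_
    rw [← lintegral_tsum fun c => (hm c i).aemeasurable]
    refine lintegral_congr fun ω => ?_
    rw [tsum_eq_single (k (e i ω))]
    · by_cases hz : e i ω ∈ A <;> simp [hz]
    · intro c hc
      rw [indicator_of_notMem, zero_mul]
      rintro ⟨_, h2⟩
      exact hc h2.symm
  rw [h1]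
  conv_rhs => rw [hU, lintegral_iUnion hkm hdisj]
  refine tsum_congr fun c => ?_
  rw [h.palmSum_const (hkm c) ((measure_mono inter_subset_left).trans_lt hΛ.lt_top).ne (hφ c)]
  refine setLIntegral_congr_fun (hkm c) fun z hz => ?_
  have : k z = c := hz.2
  simp [this]

end HasPoissonLaplace

/-- The dyadic approximation of a real number from below. -/
noncomputable def dyadicFloor (n : ℕ) (r : ℝ) : ℝ := ⌊2 ^ n * r⌋ / 2 ^ n

theorem dyadicFloor_le (n : ℕ) (r : ℝ) : dyadicFloor n r ≤ r := by
  rw [dyadicFloor, div_le_iff₀ (by positivity), mul_comm r]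
  exact Int.floor_le _

theorem monotone_dyadicFloor (r : ℝ) : Monotone fun n => dyadicFloor n r := by
  refine monotone_nat_of_le_succ fun n => ?_
  rw [dyadicFloor, dyadicFloor, div_le_div_iff₀ (by positivity) (by positivity)]
  have h : (2 * ⌊(2 : ℝ) ^ n * r⌋ : ℤ) ≤ ⌊(2 : ℝ) ^ (n + 1) * r⌋ := by
    rw [Int.le_floor]
    push_cast
    rw [pow_succ]
    nlinarith [Int.floor_le ((2 : ℝ) ^ n * r)]
  have h' : (2 * (⌊(2 : ℝ) ^ n * r⌋ : ℝ)) ≤ ⌊(2 : ℝ) ^ (n + 1) * r⌋ := by exact_mod_cast h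
  calc (⌊(2 : ℝ) ^ n * r⌋ : ℝ) * 2 ^ (n + 1) = (2 * (⌊(2 : ℝ) ^ n * r⌋ : ℝ)) * 2 ^ n := by
        rw [pow_succ]; ring
    _ ≤ _ := mul_le_mul_of_nonneg_right h' (by positivity)

theorem lt_dyadicFloor_add (n : ℕ) (r : ℝ) : r < dyadicFloor n r + (1 / 2) ^ n := by
  have h := Int.lt_floor_add_one ((2 : ℝ) ^ n * r)
  have h2 : (0 : ℝ) < 2 ^ n := by positivity
  have : dyadicFloor n r + (1 / 2) ^ n = (⌊2 ^ n * r⌋ + 1) / 2 ^ n := by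
    rw [dyadicFloor, one_div, inv_pow]; field_simp
  rw [this, lt_div_iff₀ h2]
  linarith

theorem tendsto_dyadicFloor (r : ℝ) :
    Filter.Tendsto (fun n => dyadicFloor n r) Filter.atTop (nhds r) := by
  have h1 : Filter.Tendsto (fun n : ℕ => r - (1 / 2 : ℝ) ^ n) Filter.atTop (nhds r) := by
    simpa using tendsto_const_nhds.sub
      (tendsto_pow_atTop_nhds_zero_of_lt_one (r := (1 / 2 : ℝ)) (by norm_num) (by norm_num))
  refine tendsto_of_tendsto_of_tendsto_of_le_of_le h1 tendsto_const_nhds (fun n => ?_)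
    fun n => dyadicFloor_le n r
  linarith [lt_dyadicFloor_add n r]

namespace HasPoissonLaplace

variable {Ω Z : Type*} [MeasurableSpace Ω] [MeasurableSpace Z] {P : Measure Ω}
  {e : ℕ → Ω → Z} {Λ : Measure Z} [IsProbabilityMeasure P] [SigmaFinite Λ]

/-- The dyadic floors of the parameter take countably many values and increase to it, so the weights
increase too. Convergence is asked only along these floors, which a left-continuous weight such as ∞
· 1{x < r} satisfies. -/
theorem palmSum_of_monotone (h : HasPoissonLaplace P e Λ) {A : Set Z} (hA : MeasurableSet A)
    (hΛ : Λ A ≠ ∞) {ρ : Z → ℝ} (hρ : Measurable ρ) {φ : ℝ → Z → ℝ≥0∞}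
    (hφ : ∀ r, Measurable (φ r)) (hmono : ∀ z, Monotone fun r => φ r z)
    (hcont : ∀ r z, Filter.Tendsto (fun n => φ (dyadicFloor n r) z) Filter.atTop (nhds (φ r z))) :
    palmSum P e A (fun z => φ (ρ z)) =
      ∫⁻ z in A, expNeg (∫⁻ z', 1 - expNeg (φ (ρ z) z') ∂Λ) ∂Λ := by
  have hk : ∀ n : ℕ, Measurable fun z => ⌊(2 : ℝ) ^ n * ρ z⌋ := fun n =>
    Int.measurable_floor.comp (hρ.const_mul _)
  refine h.palmSum_of_tendsto hA hΛ (φ := fun n z => φ (dyadicFloor n (ρ z))) (fun n => ?_)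
    (fun z z' m n hmn => hmono z' (monotone_dyadicFloor _ hmn)) (fun z z' => hcont _ _) fun n => ?_
  · have : Measurable (Function.uncurry fun (c : ℤ) z' => φ (c / 2 ^ n) z') :=
      measurable_from_prod_countable_right fun c => hφ (c / 2 ^ n)
    exact this.comp (((hk n).comp measurable_fst).prodMk measurable_snd)
  · exact h.palmSum_of_countable hA hΛ (hk n) (φ := fun c z' => φ (c / 2 ^ n) z') fun c => hφ _

/-- The Campbell–Mecke formula for exponential functionals whose exponent depends on the typical
point through a real parameter only. -/
theorem tsum_lintegral_mul_expNeg (h : HasPoissonLaplace P e Λ) {g : Z → ℝ≥0∞} (hg : Measurable g)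
    {ρ : Z → ℝ} (hρ : Measurable ρ) {φ : ℝ → Z → ℝ≥0∞}
    (hφ : Measurable (Function.uncurry φ)) (hmono : ∀ z, Monotone fun r => φ r z)
    (hcont : ∀ r z, Filter.Tendsto (fun n => φ (dyadicFloor n r) z) Filter.atTop (nhds (φ r z))) :
    ∑' i, ∫⁻ ω, g (e i ω) * expNeg (reducedSum e (φ (ρ (e i ω))) i ω) ∂P =
      ∫⁻ z, g z * expNeg (∫⁻ z', 1 - expNeg (φ (ρ z) z') ∂Λ) ∂Λ := by
  have hφρ : Measurable (Function.uncurry fun z => φ (ρ z)) :=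
    hφ.comp ((hρ.comp measurable_fst).prodMk measurable_snd)
  have hwm : ∀ i, Measurable fun ω => expNeg (reducedSum e (φ (ρ (e i ω))) i ω) := fun i =>
    measurable_expNeg.comp (h.measurable_reducedSum hφρ i)
  have hLm : Measurable fun z => expNeg (∫⁻ z', 1 - expNeg (φ (ρ z) z') ∂Λ) :=
    measurable_expNeg.comp (Measurable.lintegral_prod_right' (measurable_one_sub_expNeg hφρ))
  -- The formula for sets of finite intensity amounts to an identity of measures on `Z`, against
  -- which `g` is then integrated.
  have hme : Measure.sum (fun i => (P.withDensity fun ω =>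
      expNeg (reducedSum e (φ (ρ (e i ω))) i ω)).map (e i)) =
      Λ.withDensity fun z => expNeg (∫⁻ z', 1 - expNeg (φ (ρ z) z') ∂Λ) := by
    refine (Measure.ext_iff_of_iUnion_eq_univ (iUnion_spanningSets Λ)).2 fun n => ?_
    ext A hA
    rw [Measure.restrict_apply hA, Measure.restrict_apply hA]
    have hA' := hA.inter (measurableSet_spanningSets Λ n)
    have hφr : ∀ r, Measurable (φ r) := fun r =>
      hφ.comp (measurable_const.prodMk measurable_id)
    rw [withDensity_apply _ hA', ← h.palmSum_of_monotone hA'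
      ((measure_mono inter_subset_right).trans_lt (measure_spanningSets_lt_top Λ n)).ne hρ
      hφr hmono hcont, Measure.sum_apply _ hA']
    refine tsum_congr fun i => ?_
    rw [Measure.map_apply (h.measurable i) hA', withDensity_apply _ (h.measurable i hA'),
      ← lintegral_indicator (h.measurable i hA')]
    refine lintegral_congr fun ω => ?_
    by_cases hω : e i ω ∈ A ∩ spanningSets Λ n
    · rw [indicator_of_mem (by exact hω), indicator_of_mem hω]; simp
    · rw [indicator_of_notMem (by exact hω), indicator_of_notMem hω]; simp
  have h1 := congrArg (fun ν => ∫⁻ z, g z ∂ν) hme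
  simp only [lintegral_sum_measure] at h1
  rw [lintegral_withDensity_eq_lintegral_mul _ hLm hg] at h1
  refine Eq.trans (tsum_congr fun i => ?_) (h1.trans (lintegral_congr fun z => mul_comm _ _))
  have hge : Measurable fun ω => g (e i ω) := hg.comp (h.measurable i)
  rw [lintegral_map hg (h.measurable i), lintegral_withDensity_eq_lintegral_mul _ (hwm i) hge]
  exact lintegral_congr fun ω => mul_comm _ _

theorem lintegral_tsum_mul_expNeg (h : HasPoissonLaplace P e Λ) {g : Z → ℝ≥0∞} (hg : Measurable g)
    {ρ : Z → ℝ} (hρ : Measurable ρ) {φ : ℝ → Z → ℝ≥0∞}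
    (hφ : Measurable (Function.uncurry φ)) (hmono : ∀ z, Monotone fun r => φ r z)
    (hcont : ∀ r z, Filter.Tendsto (fun n => φ (dyadicFloor n r) z) Filter.atTop (nhds (φ r z))) :
    ∫⁻ ω, ∑' i, g (e i ω) * expNeg (reducedSum e (φ (ρ (e i ω))) i ω) ∂P =
      ∫⁻ z, g z * expNeg (∫⁻ z', 1 - expNeg (φ (ρ z) z') ∂Λ) ∂Λ := by
  have hφρ : Measurable (Function.uncurry fun z => φ (ρ z)) :=
    hφ.comp ((hρ.comp measurable_fst).prodMk measurable_snd)
  have hm : ∀ i, Measurable fun ω => g (e i ω) * expNeg (reducedSum e (φ (ρ (e i ω))) i ω) :=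
    fun i => (hg.comp (h.measurable i)).mul
      (measurable_expNeg.comp (h.measurable_reducedSum hφρ i))
  rw [← h.tsum_lintegral_mul_expNeg hg hρ hφ hmono hcont, lintegral_tsum fun i => (hm i).aemeasurable]

/-- A diffuse parameter takes different values at different points. -/
theorem ae_param_ne (h : HasPoissonLaplace P e Λ) {ρ : Z → ℝ} (hρ : Measurable ρ)
    (hfin : ∀ c, Λ (ρ ⁻¹' Iic c) ≠ ∞) (hdiff : ∀ c, Λ (ρ ⁻¹' {c}) = 0) :
    ∀ᵐ ω ∂P, ∀ i j, j ≠ i → ρ (e j ω) ≠ ρ (e i ω) := by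
  have hρe : ∀ i, Measurable fun ω => ρ (e i ω) := fun i => hρ.comp (h.measurable i)
  let U : ℕ → Set Ω := fun i => {ω | ∀ j, j ≠ i → ρ (e j ω) ≠ ρ (e i ω)}
  have hU : ∀ i, MeasurableSet (U i) := by
    intro i
    have : U i = ⋂ j, ⋂ (_ : j ≠ i), {ω | ρ (e j ω) = ρ (e i ω)}ᶜ := by ext ω; simp [U]
    rw [this]
    exact MeasurableSet.iInter fun j => MeasurableSet.iInter fun _ =>
      (measurableSet_eq_fun (hρe j) (hρe i)).compl
  rw [ae_all_iff]
  intro i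
  suffices hK : ∀ K : ℕ, P (e i ⁻¹' (ρ ⁻¹' Iic (K : ℝ)) \ U i) = 0 by
    have h0 : P (⋃ K : ℕ, e i ⁻¹' (ρ ⁻¹' Iic (K : ℝ)) \ U i) = 0 := measure_iUnion_null hK
    refine measure_mono_null (fun ω hω => ?_) h0
    obtain ⟨K, hKω⟩ := exists_nat_ge (ρ (e i ω))
    exact mem_iUnion.2 ⟨K, hKω, hω⟩
  intro K
  set A : Set Z := ρ ⁻¹' Iic (K : ℝ) with hAdef
  have hA : MeasurableSet A := hρ measurableSet_Iic
  have hΛ : Λ A ≠ ∞ := hfin K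
  let k : ℕ → Z → ℤ := fun n z => ⌊(2 : ℝ) ^ n * ρ z⌋
  have hk : ∀ n, Measurable (k n) := fun n => Int.measurable_floor.comp (hρ.const_mul _)
  have hcell : ∀ n z, MeasurableSet {z' | k n z' = k n z} := fun n z =>
    hk n (measurableSet_singleton _)
  classical
  -- With infinite weight on the other points of the same dyadic cell, the Palm sum is the expected
  -- number of points of `A` alone in their cell.
  let φ : ℕ → ℤ → Z → ℝ≥0∞ := fun n c z' => if k n z' = c then ∞ else 0
  have hφ : ∀ n c, Measurable (φ n c) := fun n c =>
    Measurable.ite (hk n (measurableSet_singleton c)) measurable_const measurable_const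
  have hpalm : ∀ n, palmSum P e A (fun z => φ n (k n z)) =
      ∫⁻ z in A, expNeg (Λ {z' | k n z' = k n z}) ∂Λ := by
    intro n
    rw [h.palmSum_of_countable hA hΛ (hk n) (hφ n)]
    refine lintegral_congr fun z => ?_
    rw [← lintegral_indicator_one (hcell n z)]
    congr 1
    refine lintegral_congr fun z' => ?_
    by_cases hz : k n z' = k n z <;> simp [φ, indicator, hz]
  -- The cells shrink to a level set of `ρ`, which is null, so their intensity tends to 0.
  have hlim : Filter.Tendsto (fun n => ∫⁻ z in A, expNeg (Λ {z' | k n z' = k n z}) ∂Λ)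
      Filter.atTop (nhds (Λ A)) := by
    have : IsFiniteMeasure (Λ.restrict A) := ⟨by simpa using hΛ.lt_top⟩
    have h1 := tendsto_lintegral_expNeg (P := Λ.restrict A)
      (X := fun n z => Λ {z' | k n z' = k n z}) (Y := fun _ => 0) (fun n => ?_) (fun z => ?_)
    · simpa using h1
    · have : Measurable fun c : ℤ => Λ {z' | k n z' = c} := measurable_of_countable _
      exact this.comp (hk n)
    · have hanti : Antitone fun n => {z' | k n z' = k n z} := by
        refine antitone_nat_of_succ_le fun n z' hz' => ?_
        simp only [mem_ofPred_eq, k] at hz' ⊢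
        have hdiv : ∀ y : ℝ, ⌊(2 : ℝ) ^ n * y⌋ = ⌊(2 : ℝ) ^ (n + 1) * y⌋ / 2 := by
          intro y
          have := Int.floor_div_natCast ((2 : ℝ) ^ (n + 1) * y) 2
          rw [show (2 : ℤ) = ((2 : ℕ) : ℤ) from rfl, ← this]
          congr 1
          rw [pow_succ]; push_cast; ring
        rw [hdiv, hdiv, hz']
      have hInter : ⋂ n, {z' | k n z' = k n z} = ρ ⁻¹' {ρ z} := by
        ext z'
        simp only [mem_iInter, mem_ofPred_eq, mem_preimage, mem_singleton_iff, k]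
        refine ⟨fun hz' => ?_, fun hz' n => by rw [hz']⟩
        refine tendsto_nhds_unique (tendsto_dyadicFloor (ρ z'))
          ((tendsto_dyadicFloor (ρ z)).congr fun n => ?_)
        rw [dyadicFloor, dyadicFloor, hz' n]
      have h2 := tendsto_measure_iInter_atTop (μ := Λ)
        (fun n => (hcell n z).nullMeasurableSet) hanti ⟨0, ?_⟩
      · rwa [hInter, hdiff] at h2
      -- Continuity from above needs one cell of finite intensity: on the cell for `n = 0`, `ρ`
      -- stays below `ρ z + 1`.
      · refine ((measure_mono fun z' hz' => ?_).trans_lt (hfin (ρ z + 1)).lt_top).ne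
        simp only [mem_ofPred_eq, k, pow_zero, one_mul] at hz'
        have h3 := Int.lt_floor_add_one (ρ z')
        have h4 := Int.floor_le (ρ z)
        rw [hz'] at h3
        exact mem_preimage.2 (mem_Iic.2 (by linarith))
  -- A point alone in its cell shares its parameter with no other point. Points with a unique
  -- parameter thus already account for the whole mean number Λ(A).
  have hle : Λ A ≤ ∑' i, P (e i ⁻¹' A ∩ U i) := by
    refine le_of_tendsto hlim (Filter.Eventually.of_forall fun n => ?_)
    rw [← hpalm]
    refine ENNReal.tsum_le_tsum fun i => ?_
    rw [← lintegral_indicator_one ((h.measurable i hA).inter (hU i))]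
    refine lintegral_mono fun ω => ?_
    by_cases hω : e i ω ∈ A
    · by_cases hωU : ω ∈ U i
      · rw [indicator_of_mem (show ω ∈ e i ⁻¹' A ∩ U i from ⟨hω, hωU⟩)]
        exact (mul_le_of_le_one_right' (expNeg_le_one _)).trans
          (indicator_le_self' (fun _ _ => zero_le) _)
      · obtain ⟨j, hji, hj⟩ : ∃ j, j ≠ i ∧ ρ (e j ω) = ρ (e i ω) := by
          simpa [U] using hωU
        have : reducedSum e (φ n (k n (e i ω))) i ω = ∞ := by
          refine ENNReal.tsum_eq_top_of_eq_top ⟨j, ?_⟩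
          simp [hji, φ, k, hj]
        simp [this]
    · simp [hω]
  have hsum : ∑' i, P (e i ⁻¹' A ∩ U i) + ∑' i, P (e i ⁻¹' A \ U i) = Λ A := by
    rw [← ENNReal.tsum_add, ← h.tsum_measure_preimage hA]
    exact tsum_congr fun i => measure_inter_add_sdiff _ (hU i)
  have hT : ∑' i, P (e i ⁻¹' A ∩ U i) ≠ ∞ :=
    ((le_self_add.trans_eq hsum).trans_lt hΛ.lt_top).ne
  have h0 : ∑' i, P (e i ⁻¹' A \ U i) = 0 := by
    have : ∑' i, P (e i ⁻¹' A ∩ U i) + ∑' i, P (e i ⁻¹' A \ U i) ≤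
        ∑' i, P (e i ⁻¹' A ∩ U i) + 0 := by rw [hsum, add_zero]; exact hle
    exact le_antisymm ((ENNReal.add_le_add_iff_left hT).1 this) zero_le
  exact ENNReal.tsum_eq_zero.1 h0 i

end HasPoissonLaplace

/-! ### Radial integrals -/

/-- Polar coordinates; 2π is the mass of the unit circle, obtained as the dimension times the area
of the unit disc. -/
theorem lintegral_norm_plane {g : ℝ → ℝ≥0∞} (hg : Measurable g) :
    ∫⁻ v : Plane, g ‖v‖ = ∫⁻ r in Ioi (0 : ℝ), g r * ENNReal.ofReal (2 * Real.pi * r) := by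
  have hdim : Module.finrank ℝ Plane = 2 := by simp
  have h1 : ∫⁻ v : Plane, g ‖v‖ = ∫⁻ v : ({(0)}ᶜ : Set Plane), g ‖v.1‖ ∂(volume.comap Subtype.val) := by
    rw [lintegral_subtype_comap (measurableSet_singleton _).compl fun v : Plane => g ‖v‖,
      restrict_compl_singleton]
  have h2 := (volume : Measure Plane).measurePreserving_homeomorphUnitSphereProd.lintegral_comp_emb
    (Homeomorph.measurableEmbedding _) (g ∘ Subtype.val ∘ Prod.snd)
  have hgs : Measurable fun r : Ioi (0 : ℝ) => g r := hg.comp measurable_subtype_coe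
  have hden : Measurable fun r : Ioi (0 : ℝ) => ENNReal.ofReal ((r : ℝ) ^ 1) := by fun_prop
  have hball : (volume : Measure Plane).toSphere univ = ENNReal.ofReal (2 * Real.pi) := by
    rw [Measure.toSphere_apply_univ, hdim, EuclideanSpace.volume_ball_fin_two]
    rw [ENNReal.ofReal_mul zero_le_two]
    simp [ENNReal.ofReal]
  rw [h1]
  have h3 : ∫⁻ v : ({(0)}ᶜ : Set Plane), g ‖v.1‖ ∂(volume.comap Subtype.val) =
      ∫⁻ p, (g ∘ Subtype.val ∘ Prod.snd) p
        ∂((volume : Measure Plane).toSphere.prod (.volumeIoiPow (Module.finrank ℝ Plane - 1))) := by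
    rw [← h2]
    simp
  rw [h3, hdim]
  simp only [Function.comp_def]
  rw [lintegral_prod _ (by fun_prop)]
  simp only [lintegral_const, hball]
  rw [Measure.volumeIoiPow, lintegral_withDensity_eq_lintegral_mul _ hden hgs]
  simp only [Pi.mul_apply]
  rw [lintegral_subtype_comap measurableSet_Ioi (fun r => ENNReal.ofReal (r ^ 1) * g r),
    ← lintegral_mul_const _ (by fun_prop)]
  refine setLIntegral_congr_fun measurableSet_Ioi fun r hr => ?_
  simp only [pow_one]
  rw [mul_comm (2 * Real.pi) r, ENNReal.ofReal_mul (le_of_lt hr)]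
  ring

theorem lintegral_Ioi_scale {c : ℝ} (hc : 0 < c) (g : ℝ → ℝ≥0∞) :
    ∫⁻ r in Ioi (0 : ℝ), g r * ENNReal.ofReal (2 * Real.pi * r) =
      ENNReal.ofReal (c ^ 2) *
        ∫⁻ z in Ioi (0 : ℝ), g (c * z) * ENNReal.ofReal (2 * Real.pi * z) := by
  have himg : (fun z : ℝ => c * z) '' Ioi 0 = Ioi 0 := by
    rw [image_mul_left_Ioi hc, mul_zero]
  have h := lintegral_image_eq_lintegral_abs_deriv_mul (s := Ioi (0 : ℝ)) (f := fun z => c * z)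
    (f' := fun _ => c) measurableSet_Ioi
    (fun z _ => by simpa using ((hasDerivAt_id z).const_mul c).hasDerivWithinAt)
    (mul_right_injective₀ hc.ne').injOn (fun r => g r * ENNReal.ofReal (2 * Real.pi * r))
  rw [himg] at h
  rw [h, ← lintegral_const_mul' _ _ ENNReal.ofReal_ne_top]
  refine setLIntegral_congr_fun measurableSet_Ioi fun z hz => ?_
  have hz' : 0 < z := hz
  rw [abs_of_pos hc, mul_left_comm, mul_left_comm (ENNReal.ofReal (c ^ 2)),
    ← ENNReal.ofReal_mul hc.le, ← ENNReal.ofReal_mul (by positivity)]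
  congr 2
  ring

/-! ### The mark laws -/

instance isProbabilityMeasure_fadingLaw : IsProbabilityMeasure fadingLaw :=
  isProbabilityMeasure_expMeasure one_pos

instance isProbabilityMeasure_angleLaw : IsProbabilityMeasure angleLaw := by
  refine cond_isProbabilityMeasure_of_finite ?_ ?_
  · rw [Real.volume_Icc]
    simp [Real.pi_pos]
  · rw [Real.volume_Icc]
    exact ENNReal.ofReal_ne_top

/-- Allowing y = ∞ covers the infinite thresholds that encode exclusion. -/
theorem fadingLaw_tail (y : ℝ≥0∞) : fadingLaw {f | y < ENNReal.ofReal f} = expNeg y := by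
  induction y with
  | top => simp
  | coe y =>
    have h1 : {f : ℝ | (y : ℝ≥0∞) < ENNReal.ofReal f} = (Iic (y : ℝ))ᶜ := by
      ext f
      rw [← ENNReal.ofReal_coe_nnreal]
      simp only [mem_ofPred_eq, mem_compl_iff, mem_Iic, not_le]
      rw [ENNReal.ofReal_lt_ofReal_iff_of_nonneg y.coe_nonneg]
    rw [h1, prob_compl_eq_one_sub measurableSet_Iic]
    have h2 := cdf_expMeasure_eq one_pos (y : ℝ)
    have : IsProbabilityMeasure (expMeasure 1) := isProbabilityMeasure_expMeasure one_pos
    have h3 : fadingLaw (Iic (y : ℝ)) = ENNReal.ofReal (1 - Real.exp (-(y : ℝ))) := by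
      rw [fadingLaw, ← ofReal_cdf, h2]
      simp
    rw [h3, expNeg_coe, ← ENNReal.ofReal_one, ← ENNReal.ofReal_sub _ (by
      rw [sub_nonneg, Real.exp_le_one_iff]; simp)]
    congr 1; ring

theorem lintegral_one_sub_expNeg_fadingLaw {c : ℝ} (hc : 0 ≤ c) :
    ∫⁻ f, 1 - expNeg (ENNReal.ofReal (c * f)) ∂fadingLaw = ENNReal.ofReal (c / (1 + c)) := by
  have hm : Measurable fun f : ℝ => expNeg (ENNReal.ofReal (c * f)) := by fun_prop
  have h1 : ∫⁻ f, expNeg (ENNReal.ofReal (c * f)) ∂fadingLaw = ENNReal.ofReal (1 / (1 + c)) := by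
    have hpdf : Measurable (exponentialPDF 1) := (measurable_exponentialPDFReal 1).ennreal_ofReal
    have : fadingLaw = volume.withDensity (exponentialPDF 1) := rfl
    rw [this, lintegral_withDensity_eq_lintegral_mul _ hpdf hm]
    -- Exponential tilting: e^{-cf} times the density of rate 1 is 1/(1+c) times the density of rate
    -- 1+c.
    have h2 : ∀ f, (exponentialPDF 1 * fun f => expNeg (ENNReal.ofReal (c * f))) f =
        ENNReal.ofReal (1 / (1 + c)) * exponentialPDF (1 + c) f := by
      intro f
      simp only [Pi.mul_apply]
      rcases lt_or_ge f 0 with hf | hf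
      · rw [exponentialPDF_of_neg hf, exponentialPDF_of_neg hf, zero_mul, mul_zero]
      · rw [exponentialPDF_of_nonneg hf, exponentialPDF_of_nonneg hf,
          expNeg_ofReal (mul_nonneg hc hf), ← ENNReal.ofReal_mul (by positivity),
          ← ENNReal.ofReal_mul (by positivity)]
        have : Real.exp (-(1 * f)) * Real.exp (-(c * f)) = Real.exp (-((1 + c) * f)) := by
          rw [← Real.exp_add]
          congr 1
          ring
        rw [mul_assoc, this]
        congr 1
        field_simp
    simp_rw [h2]
    have hpdf' : Measurable (exponentialPDF (1 + c)) :=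
      (measurable_exponentialPDFReal _).ennreal_ofReal
    rw [lintegral_const_mul _ hpdf', lintegral_exponentialPDF_eq_one (by positivity), mul_one]
  rw [lintegral_sub hm (by rw [h1]; exact ENNReal.ofReal_ne_top)
    (Filter.Eventually.of_forall fun _ => expNeg_le_one _), h1]
  simp only [lintegral_const, measure_univ, mul_one]
  rw [← ENNReal.ofReal_one, ← ENNReal.ofReal_sub _ (by positivity)]
  congr 1
  field_simp
  ring

theorem Antenna.measurable_gain (a : Antenna) : Measurable a.gain := by
  classical
  unfold Antenna.gain
  refine Measurable.ite ?_ measurable_const measurable_const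
  exact measurableSet_le (by fun_prop) measurable_const

theorem Antenna.Valid.gain_pos {a : Antenna} (ha : a.Valid) (θ : ℝ) : 0 < a.gain θ := by
  unfold Antenna.gain
  split_ifs
  exacts [ha.mainGain_pos, ha.sideGain_pos]

theorem Antenna.Valid.lobe_pos {a : Antenna} (ha : a.Valid) (k : Fin 2) : 0 < a.lobe k := by
  fin_cases k
  exacts [ha.mainGain_pos, ha.sideGain_pos]

theorem Antenna.Valid.lintegral_gain {a : Antenna} (ha : a.Valid) (g : ℝ → ℝ≥0∞) :
    ∫⁻ θ, g (a.gain θ) ∂angleLaw = ∑ k : Fin 2, ENNReal.ofReal (a.lobeProb k) * g (a.lobe k) := by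
  have hpi := Real.pi_pos
  have hw := ha.beamwidth_nonneg
  have hw2 := ha.beamwidth_le
  let S : Set ℝ := {θ | |θ| ≤ a.beamwidth / 2}
  have hS : MeasurableSet S := measurableSet_le (by fun_prop) measurable_const
  have hvol : angleLaw S = ENNReal.ofReal (a.beamwidth / (2 * Real.pi)) := by
    rw [angleLaw, cond_apply measurableSet_Icc]
    have h1 : Icc (-Real.pi) Real.pi ∩ S = Icc (-(a.beamwidth / 2)) (a.beamwidth / 2) := by
      ext θ
      simp only [S, mem_inter_iff, mem_ofPred_eq, abs_le, mem_Icc]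
      constructor
      · rintro ⟨_, h⟩; exact h
      · rintro ⟨h1, h2⟩; exact ⟨⟨by linarith, by linarith⟩, h1, h2⟩
    rw [h1, Real.volume_Icc, Real.volume_Icc, ← ENNReal.ofReal_inv_of_pos (by linarith),
      ← ENNReal.ofReal_mul (by rw [inv_nonneg]; linarith)]
    congr 1
    field_simp
  have hvol' : angleLaw Sᶜ = ENNReal.ofReal (1 - a.beamwidth / (2 * Real.pi)) := by
    rw [prob_compl_eq_one_sub hS, hvol, ← ENNReal.ofReal_one, ← ENNReal.ofReal_sub _ (by positivity)]
  rw [← lintegral_add_compl _ hS, Fin.sum_univ_two]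
  congr 1
  · rw [setLIntegral_congr_fun hS (g := fun _ => g a.mainGain) (fun θ hθ => by
      have : |θ| ≤ a.beamwidth / 2 := hθ
      simp [Antenna.gain, this])]
    simp [hvol, Antenna.lobe, Antenna.lobeProb, mul_comm]
  · rw [setLIntegral_congr_fun hS.compl (g := fun _ => g a.sideGain) (fun θ hθ => by
      have : ¬ |θ| ≤ a.beamwidth / 2 := hθ
      simp [Antenna.gain, this])]
    simp [hvol', Antenna.lobe, Antenna.lobeProb, mul_comm]

theorem LinkType.sum_univ {α : Type*} [AddCommMonoid α] (g : LinkType → α) :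
    ∑ t, g t = g LinkType.los + g LinkType.nlos := by
  have : (Finset.univ : Finset LinkType) = {LinkType.los, LinkType.nlos} := rfl
  rw [this, Finset.sum_pair (by decide)]

instance : DiscreteMeasurableSpace LinkType := ⟨fun _ => trivial⟩

instance : Countable LinkType := Finite.to_countable

theorem measurable_linkType_prod {β γ : Type*} [MeasurableSpace β] [MeasurableSpace γ]
    {g : LinkType × β → γ} (hg : ∀ t, Measurable fun b => g (t, b)) : Measurable g :=
  measurable_from_prod_countable_right hg

/-! ### Link types as random marks -/

namespace Params

variable (q : Params)

theorem lintegral_linkLaw (r : ℝ) (g : LinkType → ℝ≥0∞) :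
    ∫⁻ t, g t ∂(q.linkLaw r) = ∑ t, ENNReal.ofReal (q.p t r) * g t := by
  rw [linkLaw, lintegral_add_measure, lintegral_smul_measure, lintegral_smul_measure,
    lintegral_dirac, lintegral_dirac, LinkType.sum_univ]
  rfl

variable {q}

theorem Valid.measurable_p (hq : q.Valid) (t : LinkType) : Measurable (q.p t) := by
  cases t
  · exact hq.pLos_measurable
  · exact measurable_const.sub hq.pLos_measurable

theorem Valid.p_nonneg (hq : q.Valid) (t : LinkType) {r : ℝ} (hr : 0 ≤ r) : 0 ≤ q.p t r := by
  cases t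
  · exact hq.pLos_nonneg r hr
  · exact sub_nonneg.2 (hq.pLos_le_one r hr)

theorem Valid.p_le_one (hq : q.Valid) (t : LinkType) {r : ℝ} (hr : 0 ≤ r) : q.p t r ≤ 1 := by
  cases t
  · exact hq.pLos_le_one r hr
  · exact sub_le_self _ (hq.pLos_nonneg r hr)

theorem Valid.isProbabilityMeasure_linkLaw (hq : q.Valid) {r : ℝ} (hr : 0 ≤ r) :
    IsProbabilityMeasure (q.linkLaw r) := by
  refine ⟨?_⟩
  have := q.lintegral_linkLaw r (fun _ => 1)
  rw [lintegral_one] at this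
  rw [this, LinkType.sum_univ, mul_one, mul_one,
    ← ENNReal.ofReal_add (hq.p_nonneg _ hr) (hq.p_nonneg _ hr)]
  simp [p]

/-- The law of the type of the link between a point of the plane and the origin. -/
noncomputable def linkKernel (hq : q.Valid) : Kernel Plane LinkType where
  toFun v := q.linkLaw ‖v‖
  measurable' := by
    refine Measure.measurable_of_measurable_coe _ fun S hS => ?_
    have : (fun v : Plane => q.linkLaw ‖v‖ S) = fun v : Plane =>
        ∑ t, ENNReal.ofReal (q.p t ‖v‖) * S.indicator 1 t := by
      funext v
      rw [← lintegral_indicator_one hS, lintegral_linkLaw]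
    rw [this]
    exact Finset.measurable_sum _ fun t _ =>
      (((hq.measurable_p t).comp measurable_norm).ennreal_ofReal).mul_const _

@[simp] theorem linkKernel_apply (hq : q.Valid) (v : Plane) : linkKernel hq v = q.linkLaw ‖v‖ := rfl

instance isMarkovKernel_linkKernel (hq : q.Valid) : IsMarkovKernel (linkKernel hq) :=
  ⟨fun v => hq.isProbabilityMeasure_linkLaw (norm_nonneg v)⟩

end Params

theorem sigmaFinite_compProd {E M : Type*} [MeasurableSpace E] [MeasurableSpace M] (μ : Measure E)
    [SigmaFinite μ] (κ : Kernel E M) [IsMarkovKernel κ] : SigmaFinite (μ ⊗ₘ κ) := by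
  refine ⟨⟨⟨fun n => spanningSets μ n ×ˢ univ, fun _ => trivial, fun n => ?_, ?_⟩⟩⟩
  · rw [Measure.compProd_apply_prod (measurableSet_spanningSets μ n) MeasurableSet.univ]
    simpa using measure_spanningSets_lt_top μ n
  · rw [← iUnion_prod_const, iUnion_spanningSets, univ_prod_univ]

instance sigmaFinite_ofReal_smul {E : Type*} [MeasurableSpace E] (μ : Measure E) [SigmaFinite μ]
    (c : ℝ) : SigmaFinite (ENNReal.ofReal c • μ) :=
  inferInstanceAs (SigmaFinite (c.toNNReal • μ))

/-! ### Reduction of marked plane integrals to radial integrals -/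

namespace Params

variable {q : Params}

theorem lintegral_linked (hq : q.Valid) (c : ℝ) {g : LinkType → ℝ → ℝ≥0∞}
    (hg : ∀ t, Measurable (g t)) :
    ∫⁻ z, g z.2 ‖z.1‖ ∂((ENNReal.ofReal c • (volume : Measure Plane)) ⊗ₘ linkKernel hq) =
      ENNReal.ofReal c * ∑ t, ∫⁻ r in Ioi (0 : ℝ),
        ENNReal.ofReal (q.p t r) * g t r * ENNReal.ofReal (2 * Real.pi * r) := by
  have hm : Measurable fun z : Plane × LinkType => g z.2 ‖z.1‖ :=
    measurable_from_prod_countable_left fun t => (hg t).comp measurable_norm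
  have hpg : ∀ t, Measurable fun r => ENNReal.ofReal (q.p t r) * g t r := fun t =>
    (hq.measurable_p t).ennreal_ofReal.mul (hg t)
  rw [Measure.lintegral_compProd hm, lintegral_smul_measure, smul_eq_mul]
  congr 1
  simp only [linkKernel_apply, lintegral_linkLaw]
  have hpn : ∀ t, Measurable fun v : Plane => ENNReal.ofReal (q.p t ‖v‖) * g t ‖v‖ := fun t =>
    (hpg t).comp measurable_norm
  rw [lintegral_finsetSum _ fun t _ => hpn t]
  exact Finset.sum_congr rfl fun t _ => lintegral_norm_plane (hpg t)

theorem lintegral_linked_prod (hq : q.Valid) (c : ℝ) {M : Type*} [MeasurableSpace M]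
    (η : Measure M) [IsProbabilityMeasure η] {g : LinkType → ℝ → M → ℝ≥0∞}
    (hg : ∀ t, Measurable (Function.uncurry (g t))) :
    ∫⁻ z, g z.2.1 ‖z.1‖ z.2.2
      ∂((ENNReal.ofReal c • (volume : Measure Plane)) ⊗ₘ (linkKernel hq ×ₖ Kernel.const _ η)) =
      ENNReal.ofReal c * ∑ t, ∫⁻ r in Ioi (0 : ℝ),
        ENNReal.ofReal (q.p t r) * (∫⁻ m, g t r m ∂η) * ENNReal.ofReal (2 * Real.pi * r) := by
  have hm' : Measurable fun y : LinkType × (Plane × M) => g y.1 ‖y.2.1‖ y.2.2 :=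
    measurable_linkType_prod fun t =>
      (hg t).comp ((measurable_norm.comp measurable_fst).prodMk measurable_snd)
  have hm : Measurable fun z : Plane × (LinkType × M) => g z.2.1 ‖z.1‖ z.2.2 :=
    hm'.comp (g := fun y : LinkType × (Plane × M) => g y.1 ‖y.2.1‖ y.2.2)
      (f := fun z : Plane × (LinkType × M) => (z.2.1, (z.1, z.2.2))) (by fun_prop)
  rw [← lintegral_linked hq c (g := fun t r => ∫⁻ m, g t r m ∂η) fun t =>
    (hg t).lintegral_prod_right', Measure.lintegral_compProd hm, Measure.lintegral_compProd]
  · refine lintegral_congr fun v => ?_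
    rw [Kernel.prod_apply, Kernel.const_apply, lintegral_prod]
    exact (hm.comp (measurable_const.prodMk measurable_id)).aemeasurable
  · exact measurable_from_prod_countable_left fun t =>
      (hg t).lintegral_prod_right'.comp measurable_norm

end Params

theorem HasPoissonLaplace.ae_notMem {Ω Z : Type*} [MeasurableSpace Ω] [MeasurableSpace Z]
    {P : Measure Ω} [IsProbabilityMeasure P] {e : ℕ → Ω → Z} {Λ : Measure Z} [SigmaFinite Λ]
    (h : HasPoissonLaplace P e Λ) {A : Set Z} (hA : MeasurableSet A) (h0 : Λ A = 0) :
    ∀ᵐ ω ∂P, ∀ i, e i ω ∉ A := by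
  rw [ae_all_iff]
  intro i
  have := h.tsum_measure_preimage hA
  rw [h0, ENNReal.tsum_eq_zero] at this
  exact measure_eq_zero_iff_ae_notMem.1 (this i)

theorem tendsto_ite_lt_dyadicFloor (x r : ℝ) :
    Filter.Tendsto (fun n => if x < dyadicFloor n r then ∞ else (0 : ℝ≥0∞)) Filter.atTop
      (nhds (if x < r then ∞ else 0)) := by
  by_cases hx : x < r
  · refine tendsto_const_nhds.congr' ?_
    filter_upwards [(tendsto_dyadicFloor r).eventually (lt_mem_nhds hx)] with n hn
    simp [hx, hn]
  · refine tendsto_const_nhds.congr fun n => ?_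
    have : ¬ x < dyadicFloor n r := fun h => hx (h.trans_le (dyadicFloor_le n r))
    simp [hx, this]

theorem monotone_ite_lt (x : ℝ) : Monotone fun r => if x < r then ∞ else (0 : ℝ≥0∞) := by
  intro r s hrs
  by_cases hx : x < r
  · simp [hx, hx.trans_le hrs]
  · simp [hx]

/-! ### Radial distance and the intensity of linked points -/

namespace Params

variable {q : Params}

/-- The reciprocal path loss, which orders links by radio distance. -/
noncomputable def radial (q : Params) (t : LinkType) (r : ℝ) : ℝ := r ^ q.al t / q.C t

theorem measurable_radial (t : LinkType) : Measurable (q.radial t) := by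
  unfold radial
  fun_prop

theorem pathLoss_eq_inv_radial (t : LinkType) {r : ℝ} (hr : 0 ≤ r) :
    q.pathLoss t r = (q.radial t r)⁻¹ := by
  rw [pathLoss, radial, Real.rpow_neg hr, inv_div, div_eq_mul_inv]

theorem Valid.radial_pos (hq : q.Valid) (t : LinkType) {r : ℝ} (hr : 0 < r) : 0 < q.radial t r :=
  div_pos (Real.rpow_pos_of_pos hr _) (hq.C_pos t)

theorem Valid.pathLoss_le_iff (hq : q.Valid) {t t' : LinkType} {r r' : ℝ} (hr : 0 < r)
    (hr' : 0 < r') : q.pathLoss t r ≤ q.pathLoss t' r' ↔ q.radial t' r' ≤ q.radial t r := by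
  rw [pathLoss_eq_inv_radial t hr.le, pathLoss_eq_inv_radial t' hr'.le,
    inv_le_inv₀ (hq.radial_pos t hr) (hq.radial_pos t' hr')]

theorem Valid.radial_le_iff (hq : q.Valid) (t : LinkType) {r c : ℝ} (hr : 0 < r) (hc : 0 ≤ c) :
    q.radial t r ≤ c ↔ r ≤ (c * q.C t) ^ (1 / q.al t) := by
  rw [radial, div_le_iff₀ (hq.C_pos t), one_div,
    Real.le_rpow_inv_iff_of_pos hr.le (mul_nonneg hc (hq.C_pos t).le) (hq.al_pos t)]

theorem Valid.radial_lt_iff (hq : q.Valid) (t : LinkType) {r c : ℝ} (hr : 0 < r) (hc : 0 ≤ c) :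
    q.radial t r < c ↔ r < (c * q.C t) ^ (1 / q.al t) := by
  rw [radial, div_lt_iff₀ (hq.C_pos t), one_div,
    Real.lt_rpow_inv_iff_of_pos hr.le (mul_nonneg hc (hq.C_pos t).le) (hq.al_pos t)]

theorem Valid.radial_eq_iff (hq : q.Valid) (t : LinkType) {r c : ℝ} (hr : 0 < r) (hc : 0 ≤ c) :
    q.radial t r = c ↔ r = (c * q.C t) ^ (1 / q.al t) := by
  have h1 := hq.radial_le_iff t hr hc
  have h2 := hq.radial_lt_iff t hr hc
  constructor
  · intro h
    exact le_antisymm (h1.1 h.le) (not_lt.1 fun h3 => (h2.2 h3).ne h)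
  · intro h
    exact le_antisymm (h1.2 h.le) (not_lt.1 fun h3 => (h2.1 h3).ne h)

/-- The intensity measure of the points together with their link types. -/
noncomputable def linkedIntensity (hq : q.Valid) (c : ℝ) : Measure (Plane × LinkType) :=
  (ENNReal.ofReal c • volume) ⊗ₘ linkKernel hq

instance (hq : q.Valid) (c : ℝ) : SigmaFinite (linkedIntensity hq c) := sigmaFinite_compProd _ _

theorem measurable_radial_norm :
    Measurable fun z : Plane × LinkType => q.radial z.2 ‖z.1‖ :=
  measurable_from_prod_countable_left fun t => (measurable_radial t).comp measurable_norm

theorem linkedIntensity_preimage (hq : q.Valid) (c : ℝ) {S : Set ℝ} (hS : MeasurableSet S) :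
    linkedIntensity hq c ((fun z => q.radial z.2 ‖z.1‖) ⁻¹' S) =
      ENNReal.ofReal c * ∑ t, ∫⁻ r in Ioi (0 : ℝ), ENNReal.ofReal (q.p t r) *
        S.indicator 1 (q.radial t r) * ENNReal.ofReal (2 * Real.pi * r) := by
  rw [← lintegral_linked hq c (g := fun t r => S.indicator 1 (q.radial t r)) fun t =>
    (measurable_one.indicator hS).comp (measurable_radial t),
    ← lintegral_indicator_one (measurable_radial_norm hS)]
  rfl

/-- For each type only one positive length has a given radial distance, and a single length is
Lebesgue null. This excludes ties. -/
theorem linkedIntensity_radial_eq (hq : q.Valid) (c x : ℝ) :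
    linkedIntensity hq c ((fun z => q.radial z.2 ‖z.1‖) ⁻¹' {x}) = 0 := by
  rw [linkedIntensity_preimage hq c (measurableSet_singleton x)]
  refine mul_eq_zero.2 (Or.inr (Finset.sum_eq_zero fun t _ => ?_))
  rw [lintegral_eq_zero_iff']
  · rw [Filter.EventuallyEq, ae_restrict_iff' measurableSet_Ioi]
    filter_upwards [Measure.ae_ne volume ((x * q.C t) ^ (1 / q.al t))] with r hr hr0
    have : q.radial t r ∉ ({x} : Set ℝ) := by
      intro h
      have h' : q.radial t r = x := h
      have hx : 0 ≤ x := h' ▸ (hq.radial_pos t hr0).le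
      exact hr ((hq.radial_eq_iff t hr0 hx).1 h')
    rw [indicator_of_notMem this]
    simp
  · have h1 : Measurable fun r => ({x} : Set ℝ).indicator (1 : ℝ → ℝ≥0∞) (q.radial t r) :=
      (measurable_one.indicator (measurableSet_singleton x)).comp (measurable_radial t)
    have h2 : Measurable fun r => ENNReal.ofReal (q.p t r) := (hq.measurable_p t).ennreal_ofReal
    exact ((h2.mul h1).mul (by fun_prop)).aemeasurable

theorem linkedIntensity_radial_le (hq : q.Valid) (c x : ℝ) :
    linkedIntensity hq c ((fun z => q.radial z.2 ‖z.1‖) ⁻¹' Iic x) ≠ ∞ := by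
  rw [linkedIntensity_preimage hq c measurableSet_Iic]
  refine ENNReal.mul_ne_top ENNReal.ofReal_ne_top (ENNReal.sum_ne_top.2 fun t _ => ?_)
  set b := (x * q.C t) ^ (1 / q.al t) with hb
  have h1 : ∫⁻ r in Ioi (0 : ℝ), ENNReal.ofReal (q.p t r) *
        (Iic x).indicator 1 (q.radial t r) * ENNReal.ofReal (2 * Real.pi * r) ≤
      ∫⁻ r in Ioi (0 : ℝ), (Iic b).indicator (fun _ => ENNReal.ofReal (2 * Real.pi * b)) r := by
    refine setLIntegral_mono' measurableSet_Ioi fun r (hr : 0 < r) => ?_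
    by_cases hx : q.radial t r ≤ x
    · have hx0 : 0 ≤ x := (hq.radial_pos t hr).le.trans hx
      have hrb : r ≤ b := (hq.radial_le_iff t hr hx0).1 hx
      rw [indicator_of_mem (show q.radial t r ∈ Iic x from hx),
        indicator_of_mem (show r ∈ Iic b from hrb), Pi.one_apply, mul_one]
      refine (mul_le_of_le_one_left' ?_).trans (ENNReal.ofReal_le_ofReal ?_)
      · exact ENNReal.ofReal_le_one.2 (hq.p_le_one t hr.le)
      · exact mul_le_mul_of_nonneg_left hrb (by positivity)
    · rw [indicator_of_notMem (show q.radial t r ∉ Iic x from hx)]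
      simp
  refine (h1.trans_lt ?_).ne
  rw [lintegral_indicator measurableSet_Iic, Measure.restrict_restrict measurableSet_Iic,
    lintegral_const, Measure.restrict_apply_univ]
  refine ENNReal.mul_lt_top ENNReal.ofReal_lt_top ?_
  have : Iic b ∩ Ioi 0 = Ioc 0 b := by ext; simp [and_comm]
  rw [this, Real.volume_Ioc]
  exact ENNReal.ofReal_lt_top

theorem linkedIntensity_zero (hq : q.Valid) (c : ℝ) :
    linkedIntensity hq c (({0} : Set Plane) ×ˢ univ) = 0 := by
  rw [linkedIntensity, Measure.compProd_apply_prod (measurableSet_singleton _) MeasurableSet.univ]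
  simp

theorem ofReal_V (hq : q.Valid) (t : LinkType) {x : ℝ} (hx : 0 ≤ x) :
    ENNReal.ofReal (q.V t x) = ∫⁻ r in Ioi (0 : ℝ), ENNReal.ofReal (q.p t r) *
      (Iio x).indicator 1 r * ENNReal.ofReal (2 * Real.pi * r) := by
  have hint : IntegrableOn (fun s => 2 * Real.pi * (q.p t s * s)) (Ioc 0 x) := by
    refine Measure.integrableOn_of_bounded (M := 2 * Real.pi * x)
      (by rw [Real.volume_Ioc]; exact ENNReal.ofReal_ne_top) ?_ ?_
    · exact (((hq.measurable_p t).mul measurable_id).const_mul _).aestronglyMeasurable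
    · rw [ae_restrict_iff' measurableSet_Ioc]
      refine Filter.Eventually.of_forall fun s hs => ?_
      have h1 := hq.p_nonneg t hs.1.le
      have h2 := hq.p_le_one t hs.1.le
      have h3 := hs.1
      have h4 := hs.2
      rw [Real.norm_of_nonneg (by positivity)]
      refine mul_le_mul_of_nonneg_left ?_ (by positivity)
      nlinarith
  rw [V, ← intervalIntegral.integral_const_mul, intervalIntegral.integral_of_le hx,
    ofReal_integral_eq_lintegral_ofReal hint]
  · have h1 : ∀ r, ENNReal.ofReal (q.p t r) * (Iio x).indicator 1 r *
        ENNReal.ofReal (2 * Real.pi * r) = (Iio x).indicator (fun r =>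
          ENNReal.ofReal (q.p t r) * ENNReal.ofReal (2 * Real.pi * r)) r := by
      intro r
      by_cases hr : r ∈ Iio x <;> simp [hr]
    simp_rw [h1]
    rw [lintegral_indicator measurableSet_Iio, Measure.restrict_restrict measurableSet_Iio]
    have : Iio x ∩ Ioi 0 = Ioo 0 x := by ext; simp [and_comm]
    rw [this, Measure.restrict_congr_set Ioo_ae_eq_Ioc]
    refine setLIntegral_congr_fun measurableSet_Ioc fun r hr => ?_
    rw [← ENNReal.ofReal_mul (hq.p_nonneg t hr.1.le)]
    congr 1
    ring
  · rw [Filter.EventuallyLE, ae_restrict_iff' measurableSet_Ioc]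
    refine Filter.Eventually.of_forall fun s hs => ?_
    have h1 := hq.p_nonneg t hs.1.le
    have h3 := hs.1
    simp only [Pi.zero_apply]
    positivity

theorem V_nonneg (hq : q.Valid) (t : LinkType) {x : ℝ} (hx : 0 ≤ x) : 0 ≤ q.V t x := by
  refine mul_nonneg (by positivity) (intervalIntegral.integral_nonneg hx fun s hs => ?_)
  exact mul_nonneg (hq.p_nonneg t hs.1) hs.1

theorem exclusion_nonneg (hq : q.Valid) (T t : LinkType) {r : ℝ} (hr : 0 ≤ r) :
    0 ≤ q.exclusion T t r :=
  mul_nonneg (Real.rpow_nonneg (div_nonneg (hq.C_pos _).le (hq.C_pos _).le) _)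
    (Real.rpow_nonneg hr _)

theorem exclusion_eq (hq : q.Valid) (T t : LinkType) {r : ℝ} (hr : 0 ≤ r) :
    q.exclusion T t r = (q.radial T r * q.C t) ^ (1 / q.al t) := by
  have h1 := (hq.C_pos T).le
  have h2 := (hq.C_pos t).le
  have h3 : r ^ (q.al T / q.al t) = (r ^ q.al T) ^ (1 / q.al t) := by
    rw [← Real.rpow_mul hr, mul_one_div]
  rw [exclusion, h3, ← Real.mul_rpow (div_nonneg h2 h1) (Real.rpow_nonneg hr _), radial]
  congr 1
  ring

/-- A type-t link of length s is radially shorter than a type-T link of length r exactly when s <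
D^T_t(r), so each type contributes the V_t of its exclusion disc. -/
theorem linkedIntensity_radial_lt (hq : q.Valid) {c : ℝ} (hc : 0 ≤ c) (T : LinkType) {r : ℝ}
    (hr : 0 < r) :
    linkedIntensity hq c ((fun z => q.radial z.2 ‖z.1‖) ⁻¹' Iio (q.radial T r)) =
      ENNReal.ofReal (c * (q.V LinkType.los (q.exclusion T LinkType.los r) +
        q.V LinkType.nlos (q.exclusion T LinkType.nlos r))) := by
  have hV := fun t => V_nonneg hq t (exclusion_nonneg hq T t hr.le)
  rw [linkedIntensity_preimage hq c measurableSet_Iio, ENNReal.ofReal_mul hc,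
    ENNReal.ofReal_add (hV _) (hV _), ← LinkType.sum_univ
      (fun t => ENNReal.ofReal (q.V t (q.exclusion T t r)))]
  congr 1
  refine Finset.sum_congr rfl fun t _ => ?_
  rw [ofReal_V hq t (exclusion_nonneg hq T t hr.le)]
  refine setLIntegral_congr_fun measurableSet_Ioi fun s (hs : 0 < s) => ?_
  congr 2
  have := hq.radial_lt_iff t hs (hq.radial_pos T hr).le
  rw [← exclusion_eq hq T t hr.le] at this
  by_cases h : s < q.exclusion T t r
  · rw [indicator_of_mem (show q.radial t s ∈ Iio _ from this.2 h),
      indicator_of_mem (show s ∈ Iio _ from h)]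
    rfl
  · rw [indicator_of_notMem (show q.radial t s ∉ Iio _ from fun h' => h (this.1 h')),
      indicator_of_notMem (show s ∉ Iio _ from h)]

end Params

/-! ### The law of the home link -/

namespace Params

variable {q : Params}

/-- The exponential in the density is the probability that the radially closer region is empty, the
form in which the Campbell–Mecke formula delivers it. -/
theorem ofReal_homeDensity (hq : q.Valid) (T : LinkType) {r : ℝ} (hr : 0 < r) :
    ENNReal.ofReal (q.homeDensity T r) = ENNReal.ofReal q.lamU * (ENNReal.ofReal (q.p T r) *
      expNeg (linkedIntensity hq q.lamU ((fun z => q.radial z.2 ‖z.1‖) ⁻¹' Iio (q.radial T r))) *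
      ENNReal.ofReal (2 * Real.pi * r)) := by
  have hp := hq.p_nonneg T hr.le
  have hU := hq.lamU_pos.le
  have hV := fun t' => V_nonneg hq t' (exclusion_nonneg hq T t' hr.le)
  rw [linkedIntensity_radial_lt hq hU T hr, expNeg_ofReal (mul_nonneg hU (add_nonneg (hV _) (hV _))),
    homeDensity, ← ENNReal.ofReal_mul (by positivity), ← ENNReal.ofReal_mul (by positivity),
    ← ENNReal.ofReal_mul (by positivity)]
  congr 1
  ring

theorem measurable_linkedIntensity_radial_lt (hq : q.Valid) (c : ℝ) : Measurable fun x =>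
    linkedIntensity hq c ((fun z => q.radial z.2 ‖z.1‖) ⁻¹' Iio x) :=
  Monotone.measurable fun _ _ hxy => measure_mono (preimage_mono (Iio_subset_Iio hxy))

/-- Only positive lengths matter. For these the void probability form is measurable, since the
intensity of the closer region is monotone in the radial distance. -/
theorem exists_measurable_homeDensity (hq : q.Valid) (T : LinkType) :
    ∃ d : ℝ → ℝ≥0∞, Measurable d ∧ ∀ r, 0 < r → ENNReal.ofReal (q.homeDensity T r) = d r := by
  refine ⟨_, ?_, fun r hr => ofReal_homeDensity hq T hr⟩
  have h1 := measurable_expNeg.comp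
    ((measurable_linkedIntensity_radial_lt hq q.lamU).comp (measurable_radial (q := q) T))
  have h2 := (hq.measurable_p T).ennreal_ofReal
  exact ((h2.mul h1).mul (by fun_prop)).const_mul _

theorem homeDensity_nonneg (hq : q.Valid) (T : LinkType) {r : ℝ} (hr : 0 < r) :
    0 ≤ q.homeDensity T r := by
  have hp := hq.p_nonneg T hr.le
  have hU := hq.lamU_pos.le
  unfold homeDensity
  positivity

end Params

/-- The joint law of the distance and the link type to the radio-closest point of a Poisson
process. -/
theorem IsRadioClosest.lintegral_eq {Ω : Type*} [MeasurableSpace Ω] {P : Measure Ω}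
    [IsProbabilityMeasure P] {q : Params} (hq : q.Valid) {z : ℕ → Ω → Plane}
    {w : ℕ → Ω → LinkType} {D : Ω → ℝ} {L : Ω → LinkType} (h : IsRadioClosest q P z w D L)
    {g : LinkType → ℝ → ℝ≥0∞} (hg : ∀ t, Measurable (g t)) :
    ∫⁻ ω, g (L ω) (D ω) ∂P =
      ∑ T, ∫⁻ r in Ioi (0 : ℝ), g T r * ENNReal.ofReal (q.homeDensity T r) := by
  let e : ℕ → Ω → Plane × LinkType := fun i ω => (z i ω, w i ω)
  let ρ : Plane × LinkType → ℝ := fun z => q.radial z.2 ‖z.1‖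
  have hρ : Measurable ρ := Params.measurable_radial_norm
  let Λ := Params.linkedIntensity hq q.lamU
  have hmark : IsIndependentMarking P z w (Params.linkKernel hq) := h.marking
  have he : HasPoissonLaplace P e Λ := hmark.hasPoissonLaplace h.poisson.hasPoissonLaplace
  let G : Plane × LinkType → ℝ≥0∞ := fun z => g z.2 ‖z.1‖
  have hG : Measurable G :=
    measurable_from_prod_countable_left fun t => (hg t).comp measurable_norm
  -- Infinite weight on radially closer points makes e^{-∑ φ} the indicator that no other point is
  -- closer.
  let φ : ℝ → Plane × LinkType → ℝ≥0∞ := fun r z => if ρ z < r then ∞ else 0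
  have hφ : Measurable (Function.uncurry φ) :=
    Measurable.ite (measurableSet_lt (hρ.comp measurable_snd) measurable_fst)
      measurable_const measurable_const
  have hmecke := he.lintegral_tsum_mul_expNeg hG hρ hφ (fun z => monotone_ite_lt _)
    (fun r z => tendsto_ite_lt_dyadicFloor _ _)
  -- Without ties exactly one term survives, that of the strongest user.
  have hpt : ∀ᵐ ω ∂P, ∑' i, G (e i ω) * expNeg (reducedSum e (φ (ρ (e i ω))) i ω) =
      g (L ω) (D ω) := by
    filter_upwards [h.strongest, he.ae_notMem ((measurableSet_singleton _).prod MeasurableSet.univ)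
      (Params.linkedIntensity_zero hq q.lamU), he.ae_param_ne hρ
      (Params.linkedIntensity_radial_le hq q.lamU) (Params.linkedIntensity_radial_eq hq q.lamU)]
      with ω ⟨k, hDk, hLk, hk⟩ hne htie
    have hpos : ∀ j, 0 < ‖z j ω‖ := fun j => norm_pos_iff.2 fun h0 => hne j (by simp [e, h0])
    have hle : ∀ j, ρ (e k ω) ≤ ρ (e j ω) := fun j =>
      (hq.pathLoss_le_iff (hpos j) (hpos k)).1 (hk j)
    rw [tsum_eq_single k]
    · have : reducedSum e (φ (ρ (e k ω))) k ω = 0 := by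
        rw [reducedSum, ENNReal.tsum_eq_zero]
        intro j
        simp [φ, not_lt.2 (hle j)]
      rw [this, expNeg_zero, mul_one, hDk, hLk]
    · intro i hi
      have : reducedSum e (φ (ρ (e i ω))) i ω = ∞ := by
        refine ENNReal.tsum_eq_top_of_eq_top ⟨k, ?_⟩
        have h1 : ρ (e k ω) < ρ (e i ω) := lt_of_le_of_ne (hle i) (htie i k hi.symm)
        simp [hi.symm, φ, h1]
      rw [this, expNeg_top, mul_zero]
  rw [← lintegral_congr_ae hpt, hmecke]
  have hexp : ∀ zz : Plane × LinkType, ∫⁻ z', 1 - expNeg (φ (ρ zz) z') ∂Λ =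
      Λ (ρ ⁻¹' Iio (ρ zz)) := by
    intro zz
    rw [← lintegral_indicator_one (hρ measurableSet_Iio)]
    refine lintegral_congr fun z' => ?_
    by_cases hz : ρ z' < ρ zz
    · simp [φ, hz]
    · simp [φ, hz]
  simp_rw [hexp]
  have hfun : ∀ t, Measurable fun r => g t r * expNeg (Λ (ρ ⁻¹' Iio (q.radial t r))) := fun t =>
    (hg t).mul (measurable_expNeg.comp ((Params.measurable_linkedIntensity_radial_lt hq q.lamU).comp
      (Params.measurable_radial t)))
  rw [show ∫⁻ zz, G zz * expNeg (Λ (ρ ⁻¹' Iio (ρ zz))) ∂Λ = _ from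
    Params.lintegral_linked hq q.lamU hfun, Finset.mul_sum]
  refine Finset.sum_congr rfl fun t _ => ?_
  rw [← lintegral_const_mul' _ _ ENNReal.ofReal_ne_top]
  refine setLIntegral_congr_fun measurableSet_Ioi fun r (hr : 0 < r) => ?_
  simp only [Params.ofReal_homeDensity hq t hr]
  rw [mul_left_comm (ENNReal.ofReal (q.p t r)), mul_assoc, mul_left_comm (ENNReal.ofReal q.lamU)]

/-! ### Normalised distances and the secondary Laplace exponent -/

namespace Params

variable {q : Params}

theorem rpow_two_div {b : ℝ} (hb : 0 ≤ b) (a : ℝ) : (b ^ (1 / a)) ^ 2 = b ^ (2 / a) := by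
  rw [← Real.rpow_natCast, ← Real.rpow_mul hb]
  congr 1
  push_cast
  ring

/-- Averaging over the distance to the home user, in normalised radial coordinates. -/
theorem lintegral_home_rescale (hq : q.Valid) (t T : LinkType) {h : ℝ → ℝ≥0∞} (hh : Measurable h) :
    ∫⁻ r in Ioi (0 : ℝ), ENNReal.ofReal (q.p t r) *
        (∫⁻ R in Ioi (0 : ℝ), h (r / ((R ^ q.al T / q.C T) ^ (1 / q.al t) * q.C t ^ (1 / q.al t))) *
          ENNReal.ofReal (q.homeDensity T R)) * ENNReal.ofReal (2 * Real.pi * r) =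
      ∫⁻ x in Ioi (0 : ℝ), (∫⁻ R in Ioi (0 : ℝ), ENNReal.ofReal
        (q.p t (x * (R ^ q.al T / q.C T) ^ (1 / q.al t) * q.C t ^ (1 / q.al t)) *
          (R ^ q.al T / q.C T) ^ (2 / q.al t) * q.homeDensity T R)) *
        ENNReal.ofReal (q.C t ^ (2 / q.al t)) * h x * ENNReal.ofReal (2 * Real.pi * x) := by
  obtain ⟨d, hd, hdens⟩ := exists_measurable_homeDensity hq T
  have hp := hq.measurable_p t
  -- The length at which a type-`t` link has the path loss of the home link (R, T). The substitution
  -- r = ℓ x produces the factor ℓ², the source of the powers 2/α_t in `K`.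
  set ℓ : ℝ → ℝ := fun R => (R ^ q.al T / q.C T) ^ (1 / q.al t) * q.C t ^ (1 / q.al t) with hℓ
  have hℓm : Measurable ℓ := by fun_prop
  have hℓpos : ∀ R, 0 < R → 0 < ℓ R := fun R hR =>
    mul_pos (Real.rpow_pos_of_pos (hq.radial_pos T hR) _) (Real.rpow_pos_of_pos (hq.C_pos t) _)
  have hℓsq : ∀ R, 0 < R → ENNReal.ofReal (ℓ R ^ 2) =
      ENNReal.ofReal ((R ^ q.al T / q.C T) ^ (2 / q.al t)) * ENNReal.ofReal (q.C t ^ (2 / q.al t)) := by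
    intro R hR
    have hrad : 0 ≤ R ^ q.al T / q.C T := (hq.radial_pos T hR).le
    rw [← ENNReal.ofReal_mul (Real.rpow_nonneg hrad _), hℓ, mul_pow,
      rpow_two_div hrad, rpow_two_div (hq.C_pos t).le]
  have hL : ∀ r ∈ Ioi (0 : ℝ), ENNReal.ofReal (q.p t r) *
      (∫⁻ R in Ioi (0 : ℝ), h (r / ℓ R) * ENNReal.ofReal (q.homeDensity T R)) *
        ENNReal.ofReal (2 * Real.pi * r) =
      ∫⁻ R in Ioi (0 : ℝ), d R * (ENNReal.ofReal (q.p t r) * h (r / ℓ R) *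
        ENNReal.ofReal (2 * Real.pi * r)) := by
    intro r _
    have hm : Measurable fun R => h (r / ℓ R) * d R := (hh.comp (hℓm.const_div r)).mul hd
    rw [setLIntegral_congr_fun (g := fun R => h (r / ℓ R) * d R) measurableSet_Ioi
      fun R hR => by simp only [hdens R hR],
      ← lintegral_const_mul _ hm, ← lintegral_mul_const _ (hm.const_mul _)]
    exact lintegral_congr fun R => by ring
  have hR : ∀ x ∈ Ioi (0 : ℝ), (∫⁻ R in Ioi (0 : ℝ), ENNReal.ofReal
        (q.p t (x * (R ^ q.al T / q.C T) ^ (1 / q.al t) * q.C t ^ (1 / q.al t)) *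
          (R ^ q.al T / q.C T) ^ (2 / q.al t) * q.homeDensity T R)) *
        ENNReal.ofReal (q.C t ^ (2 / q.al t)) * h x * ENNReal.ofReal (2 * Real.pi * x) =
      ∫⁻ R in Ioi (0 : ℝ), d R * (ENNReal.ofReal (ℓ R ^ 2) *
        (ENNReal.ofReal (q.p t (ℓ R * x)) * h x * ENNReal.ofReal (2 * Real.pi * x))) := by
    intro x (hx : 0 < x)
    have hpos : ∀ R, 0 < R → 0 ≤ (R ^ q.al T / q.C T) ^ (2 / q.al t) := fun R hR =>
      Real.rpow_nonneg (hq.radial_pos T hR).le _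
    have hm : Measurable fun R => ENNReal.ofReal (q.p t (ℓ R * x)) *
        ENNReal.ofReal ((R ^ q.al T / q.C T) ^ (2 / q.al t)) * d R :=
      ((hp.comp (hℓm.mul_const x)).ennreal_ofReal.mul (by fun_prop)).mul hd
    rw [setLIntegral_congr_fun (g := fun R => ENNReal.ofReal (q.p t (ℓ R * x)) *
        ENNReal.ofReal ((R ^ q.al T / q.C T) ^ (2 / q.al t)) * d R) measurableSet_Ioi
      fun R hR => ?_, mul_assoc, mul_assoc, ← lintegral_mul_const _ hm]
    · refine setLIntegral_congr_fun measurableSet_Ioi fun R hR => ?_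
      simp only [hℓsq R hR]
      ring
    · have h1 : x * (R ^ q.al T / q.C T) ^ (1 / q.al t) * q.C t ^ (1 / q.al t) = ℓ R * x := by
        rw [hℓ]; ring
      have h2 := hq.p_nonneg t (mul_nonneg (hℓpos R hR).le hx.le)
      simp only
      rw [h1, ENNReal.ofReal_mul (mul_nonneg h2 (hpos R hR)), ENNReal.ofReal_mul h2, hdens R hR]
  rw [setLIntegral_congr_fun measurableSet_Ioi hL, setLIntegral_congr_fun measurableSet_Ioi hR]
  have hm1 : Measurable fun y : ℝ × ℝ => d y.2 * (ENNReal.ofReal (q.p t y.1) * h (y.1 / ℓ y.2) *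
        ENNReal.ofReal (2 * Real.pi * y.1)) := by
    have h1 : Measurable fun y : ℝ × ℝ => h (y.1 / ℓ y.2) :=
      hh.comp (measurable_fst.div (hℓm.comp measurable_snd))
    have h2 : Measurable fun y : ℝ × ℝ => ENNReal.ofReal (q.p t y.1) :=
      (hp.comp measurable_fst).ennreal_ofReal
    exact (hd.comp measurable_snd).mul ((h2.mul h1).mul (by fun_prop))
  have hm2 : Measurable fun y : ℝ × ℝ => d y.2 * (ENNReal.ofReal (ℓ y.2 ^ 2) *
        (ENNReal.ofReal (q.p t (ℓ y.2 * y.1)) * h y.1 * ENNReal.ofReal (2 * Real.pi * y.1))) := by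
    have h1 : Measurable fun y : ℝ × ℝ => h y.1 := hh.comp measurable_fst
    have h2 : Measurable fun y : ℝ × ℝ => ENNReal.ofReal (q.p t (ℓ y.2 * y.1)) :=
      (hp.comp ((hℓm.comp measurable_snd).mul measurable_fst)).ennreal_ofReal
    have h3 : Measurable fun y : ℝ × ℝ => ENNReal.ofReal (ℓ y.2 ^ 2) :=
      ((hℓm.comp measurable_snd).pow_const 2).ennreal_ofReal
    exact (hd.comp measurable_snd).mul (h3.mul ((h2.mul h1).mul (by fun_prop)))
  -- The scale ℓ depends on R, so R must become the outer variable before the substitution.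
  rw [lintegral_lintegral_swap (f := fun r R => d R * (ENNReal.ofReal (q.p t r) * h (r / ℓ R) *
        ENNReal.ofReal (2 * Real.pi * r))) hm1.aemeasurable,
    lintegral_lintegral_swap (f := fun x R => d R * (ENNReal.ofReal (ℓ R ^ 2) *
        (ENNReal.ofReal (q.p t (ℓ R * x)) * h x * ENNReal.ofReal (2 * Real.pi * x))))
        hm2.aemeasurable]
  refine setLIntegral_congr_fun measurableSet_Ioi fun R (hR : 0 < R) => ?_
  have hm3 : Measurable fun r => ENNReal.ofReal (q.p t r) * h (r / ℓ R) *
      ENNReal.ofReal (2 * Real.pi * r) :=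
    (hp.ennreal_ofReal.mul (hh.comp (measurable_id.div_const _))).mul (by fun_prop)
  have hm4 : Measurable fun x => ENNReal.ofReal (q.p t (ℓ R * x)) * h x *
      ENNReal.ofReal (2 * Real.pi * x) :=
    ((hp.comp (measurable_const_mul _)).ennreal_ofReal.mul hh).mul (by fun_prop)
  rw [lintegral_const_mul _ hm3, lintegral_const_mul _ (hm4.const_mul _), lintegral_const_mul _ hm4,
    lintegral_Ioi_scale (hℓpos R hR) (fun r => ENNReal.ofReal (q.p t r) * h (r / ℓ R))]
  simp only [mul_div_cancel_left₀ _ (hℓpos R hR).ne']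

theorem measurable_home_average (hq : q.Valid) (t T : LinkType) {h : ℝ → ℝ≥0∞}
    (hh : Measurable h) :
    Measurable fun r => ∫⁻ R in Ioi (0 : ℝ),
      h (r / ((R ^ q.al T / q.C T) ^ (1 / q.al t) * q.C t ^ (1 / q.al t))) *
        ENNReal.ofReal (q.homeDensity T R) := by
  obtain ⟨d, hd, hdens⟩ := exists_measurable_homeDensity hq T
  have h1 : ∀ r, ∫⁻ R in Ioi (0 : ℝ),
      h (r / ((R ^ q.al T / q.C T) ^ (1 / q.al t) * q.C t ^ (1 / q.al t))) *
        ENNReal.ofReal (q.homeDensity T R) = ∫⁻ R in Ioi (0 : ℝ),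
      h (r / ((R ^ q.al T / q.C T) ^ (1 / q.al t) * q.C t ^ (1 / q.al t))) * d R := fun r =>
    setLIntegral_congr_fun measurableSet_Ioi fun R hR => by simp only [hdens R hR]
  simp_rw [h1]
  refine Measurable.lintegral_prod_right' (f := fun y : ℝ × ℝ =>
    h (y.1 / ((y.2 ^ q.al T / q.C T) ^ (1 / q.al t) * q.C t ^ (1 / q.al t))) * d y.2) ?_
  exact (hh.comp (by fun_prop)).mul (hd.comp measurable_snd)

theorem measurable_K_summand (hq : q.Valid) (t T : LinkType) :
    Measurable fun x : ℝ => ∫⁻ R in Ioi (0 : ℝ), ENNReal.ofReal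
        (q.p t (x * (R ^ q.al T / q.C T) ^ (1 / q.al t) * q.C t ^ (1 / q.al t)) *
          (R ^ q.al T / q.C T) ^ (2 / q.al t) * q.homeDensity T R) := by
  obtain ⟨d, hd, hdens⟩ := exists_measurable_homeDensity hq T
  have hp := hq.measurable_p t
  have h1 : ∀ x, ∫⁻ R in Ioi (0 : ℝ), ENNReal.ofReal
        (q.p t (x * (R ^ q.al T / q.C T) ^ (1 / q.al t) * q.C t ^ (1 / q.al t)) *
          (R ^ q.al T / q.C T) ^ (2 / q.al t) * q.homeDensity T R) =
      ∫⁻ R in Ioi (0 : ℝ), ENNReal.ofReal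
        (q.p t (x * (R ^ q.al T / q.C T) ^ (1 / q.al t) * q.C t ^ (1 / q.al t)) *
          (R ^ q.al T / q.C T) ^ (2 / q.al t)) * d R := fun x =>
    setLIntegral_congr_fun measurableSet_Ioi fun R hR => by
      rw [ENNReal.ofReal_mul' (homeDensity_nonneg hq T hR), hdens R hR]
  simp_rw [h1]
  refine Measurable.lintegral_prod_right' (f := fun y : ℝ × ℝ => ENNReal.ofReal
        (q.p t (y.1 * (y.2 ^ q.al T / q.C T) ^ (1 / q.al t) * q.C t ^ (1 / q.al t)) *
          (y.2 ^ q.al T / q.C T) ^ (2 / q.al t)) * d y.2) ?_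
  exact ((hp.comp (by fun_prop)).mul (by fun_prop)).ennreal_ofReal.mul (hd.comp measurable_snd)

theorem measurable_K (hq : q.Valid) (t : LinkType) : Measurable (q.K t) :=
  (Finset.measurable_sum _ fun T _ => measurable_K_summand hq t T).mul_const _

/-- The law of the marks of a secondary base station other than its link type: fading, angle, and
the link to the closest one of the other users. -/
noncomputable def secondaryMarkLaw (ν : Measure (ℝ × LinkType)) : Measure (ℝ × ℝ × (ℝ × LinkType)) :=
  fadingLaw.prod (angleLaw.prod ν)

instance (ν : Measure (ℝ × LinkType)) [IsProbabilityMeasure ν] :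
    IsProbabilityMeasure (secondaryMarkLaw ν) := by unfold secondaryMarkLaw; infer_instance

/-- The law `ν` of the pair `(R, T)` has density `homeDensity`. -/
def HasHomeDensity (q : Params) (ν : Measure (ℝ × LinkType)) : Prop :=
  ∀ g : LinkType → ℝ → ℝ≥0∞, (∀ t, Measurable (g t)) → ∫⁻ y, g y.2 y.1 ∂ν =
    ∑ T, ∫⁻ R in Ioi (0 : ℝ), g T R * ENNReal.ofReal (q.homeDensity T R)

/-- Fading is integrated first and gives y/(1+y), then the angle gives the two lobes, and last the
home link enters through its density. `Φ` is prescribed only for R > 0, which is all that the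
density sees. -/
theorem lintegral_secondaryMarkLaw (hq : q.Valid) {ν : Measure (ℝ × LinkType)}
    [IsProbabilityMeasure ν] (hν : HasHomeDensity q ν) {c : LinkType → ℝ → ℝ}
    {Φ : ℝ × ℝ × (ℝ × LinkType) → ℝ≥0∞} (hΦ : Measurable Φ)
    (hc : ∀ T R, 0 < R → 0 ≤ c T R)
    (hΦc : ∀ F θ R T, 0 < R → Φ (F, θ, (R, T)) = ENNReal.ofReal (q.antS.gain θ * c T R * F)) :
    ∫⁻ m, 1 - expNeg (Φ m) ∂(secondaryMarkLaw ν) =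
      ∑ T, ∫⁻ R in Ioi (0 : ℝ), (∑ k : Fin 2, ENNReal.ofReal (q.antS.lobeProb k) *
        ENNReal.ofReal (q.antS.lobe k * c T R / (1 + q.antS.lobe k * c T R))) *
        ENNReal.ofReal (q.homeDensity T R) := by
  have hm := measurable_one_sub_expNeg hΦ
  have hm1 : Measurable fun y : ℝ × (ℝ × LinkType) => ∫⁻ F, 1 - expNeg (Φ (F, y)) ∂fadingLaw :=
    hm.lintegral_prod_left'
  have hm2 : Measurable fun y : ℝ × LinkType =>
      ∫⁻ θ, ∫⁻ F, 1 - expNeg (Φ (F, θ, y)) ∂fadingLaw ∂angleLaw := hm1.lintegral_prod_left'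
  rw [secondaryMarkLaw, lintegral_prod_symm _ hm.aemeasurable, lintegral_prod_symm _ hm1.aemeasurable,
    hν (fun T R => ∫⁻ θ, ∫⁻ F, 1 - expNeg (Φ (F, θ, (R, T))) ∂fadingLaw ∂angleLaw)
      fun T => hm2.comp (measurable_id.prodMk measurable_const)]
  refine Finset.sum_congr rfl fun T _ => setLIntegral_congr_fun measurableSet_Ioi fun R hR => ?_
  have hR' : 0 < R := hR
  simp only [hΦc _ _ R T hR']
  congr 1
  rw [← hq.antS_valid.lintegral_gain
    (fun G => ENNReal.ofReal (G * c T R / (1 + G * c T R)))]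
  exact lintegral_congr fun θ => lintegral_one_sub_expNeg_fadingLaw
    (mul_nonneg (hq.antS_valid.gain_pos θ).le (hc T R hR'))

/-- The exponent of the Laplace functional of an interference field of the secondary network that
depends on the normalised distances to the typical user through `ψ`. -/
theorem lintegral_one_sub_expNeg_secondary (hq : q.Valid) {ν : Measure (ℝ × LinkType)}
    [IsProbabilityMeasure ν] (hν : HasHomeDensity q ν) {ψ : LinkType → ℝ → ℝ}
    (hψ : ∀ t, Measurable (ψ t)) (hψ0 : ∀ t x, 0 < x → 0 ≤ ψ t x)
    {Φ : LinkType → ℝ → ℝ × ℝ × (ℝ × LinkType) → ℝ≥0∞}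
    (hΦ : ∀ t, Measurable (Function.uncurry (Φ t)))
    (hΦψ : ∀ t r F θ R T, 0 < r → 0 < R → Φ t r (F, θ, (R, T)) =
      ENNReal.ofReal (q.antS.gain θ *
        ψ t (r / ((R ^ q.al T / q.C T) ^ (1 / q.al t) * q.C t ^ (1 / q.al t))) * F))
    {s : ℝ} (hs : 0 < s) :
    ∫⁻ z, 1 - expNeg (ENNReal.ofReal s * Φ z.2.1 ‖z.1‖ z.2.2)
      ∂((ENNReal.ofReal q.lamS • (volume : Measure Plane)) ⊗ₘ
        (linkKernel hq ×ₖ Kernel.const _ (secondaryMarkLaw ν))) =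
      ENNReal.ofReal q.lamS * ∑ k : Fin 2, ENNReal.ofReal (q.antS.lobeProb k) *
        ∑ t, ∫⁻ x in Ioi (0 : ℝ), q.K t x * ENNReal.ofReal
          (s * q.antS.lobe k * ψ t x / (1 + s * q.antS.lobe k * ψ t x)) *
          ENNReal.ofReal (2 * Real.pi * x) := by
  let ℓ : LinkType → LinkType → ℝ → ℝ := fun t T R =>
    (R ^ q.al T / q.C T) ^ (1 / q.al t) * q.C t ^ (1 / q.al t)
  have hℓpos : ∀ t T R, 0 < R → 0 < ℓ t T R := fun t T R hR =>
    mul_pos (Real.rpow_pos_of_pos (hq.radial_pos T hR) _) (Real.rpow_pos_of_pos (hq.C_pos t) _)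
  let hk : LinkType → Fin 2 → ℝ → ℝ≥0∞ := fun t k x =>
    ENNReal.ofReal (s * q.antS.lobe k * ψ t x / (1 + s * q.antS.lobe k * ψ t x))
  have hkm : ∀ t k, Measurable (hk t k) := fun t k =>
    (((hψ t).const_mul _).div (((hψ t).const_mul _).const_add _)).ennreal_ofReal
  let H : LinkType → ℝ → ℝ≥0∞ := fun t x => ∑ k : Fin 2, ENNReal.ofReal (q.antS.lobeProb k) * hk t k x
  have hH : ∀ t, Measurable (H t) := fun t =>
    Finset.measurable_sum _ fun k _ => (hkm t k).const_mul _
  rw [lintegral_linked_prod hq q.lamS (secondaryMarkLaw ν)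
    (g := fun t r m => 1 - expNeg (ENNReal.ofReal s * Φ t r m))
    fun t => measurable_one_sub_expNeg ((hΦ t).const_mul _)]
  congr 1
  have h1 : ∀ t, ∀ r ∈ Ioi (0 : ℝ), ENNReal.ofReal (q.p t r) *
      (∫⁻ m, 1 - expNeg (ENNReal.ofReal s * Φ t r m) ∂(secondaryMarkLaw ν)) *
        ENNReal.ofReal (2 * Real.pi * r) = ∑ T, ENNReal.ofReal (q.p t r) *
      (∫⁻ R in Ioi (0 : ℝ), H t (r / ℓ t T R) * ENNReal.ofReal (q.homeDensity T R)) *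
        ENNReal.ofReal (2 * Real.pi * r) := by
    intro t r (hr : 0 < r)
    rw [lintegral_secondaryMarkLaw hq hν (c := fun T R => s * ψ t (r / ℓ t T R))
      (Φ := fun m => ENNReal.ofReal s * Φ t r m)
      (((hΦ t).comp (measurable_const.prodMk measurable_id)).const_mul _)
      (fun T R hR => mul_nonneg hs.le (hψ0 t _ (div_pos hr (hℓpos t T R hR))))
      (fun F θ R T hR => ?_), ← Finset.sum_mul, ← Finset.mul_sum]
    · congr 2
      refine Finset.sum_congr rfl fun T _ => lintegral_congr fun R => ?_
      congr 1
      refine Finset.sum_congr rfl fun k _ => ?_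
      simp only [hk]
      rw [mul_left_comm, mul_assoc]
    · rw [hΦψ t r F θ R T hr hR, ← ENNReal.ofReal_mul hs.le]
      congr 1
      ring
  have hp : ∀ t, Measurable fun r => ENNReal.ofReal (q.p t r) := fun t =>
    (hq.measurable_p t).ennreal_ofReal
  -- Passing to normalised distance for each home type T and summing over T assembles `K`.
  have h2 : ∀ t, ∫⁻ r in Ioi (0 : ℝ), ENNReal.ofReal (q.p t r) *
      (∫⁻ m, 1 - expNeg (ENNReal.ofReal s * Φ t r m) ∂(secondaryMarkLaw ν)) *
        ENNReal.ofReal (2 * Real.pi * r) =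
      ∑ k : Fin 2, ENNReal.ofReal (q.antS.lobeProb k) *
        ∫⁻ x in Ioi (0 : ℝ), q.K t x * hk t k x * ENNReal.ofReal (2 * Real.pi * x) := by
    intro t
    have hm1 : ∀ T, Measurable fun r => ENNReal.ofReal (q.p t r) *
        (∫⁻ R in Ioi (0 : ℝ), H t (r / ℓ t T R) * ENNReal.ofReal (q.homeDensity T R)) *
        ENNReal.ofReal (2 * Real.pi * r) := fun T =>
      ((hp t).mul (measurable_home_average hq t T (hH t))).mul (by fun_prop)
    have hm2 : ∀ T, Measurable fun x => (∫⁻ R in Ioi (0 : ℝ), ENNReal.ofReal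
        (q.p t (x * (R ^ q.al T / q.C T) ^ (1 / q.al t) * q.C t ^ (1 / q.al t)) *
          (R ^ q.al T / q.C T) ^ (2 / q.al t) * q.homeDensity T R)) *
        ENNReal.ofReal (q.C t ^ (2 / q.al t)) * H t x * ENNReal.ofReal (2 * Real.pi * x) :=
      fun T => (((measurable_K_summand hq t T).mul_const _).mul (hH t)).mul (by fun_prop)
    rw [setLIntegral_congr_fun measurableSet_Ioi (h1 t), lintegral_finsetSum _ fun T _ => hm1 T]
    simp only [ℓ, lintegral_home_rescale hq t _ (hH t)]
    rw [← lintegral_finsetSum _ fun T _ => hm2 T]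
    have h3 : ∀ k, Measurable fun x => q.K t x * hk t k x * ENNReal.ofReal (2 * Real.pi * x) :=
      fun k => ((measurable_K hq t).mul (hkm t k)).mul (by fun_prop)
    simp_rw [← lintegral_const_mul _ (h3 _)]
    rw [← lintegral_finsetSum _ fun k _ => (h3 k).const_mul _]
    refine lintegral_congr fun x => ?_
    rw [← Finset.sum_mul, ← Finset.sum_mul, ← Finset.sum_mul]
    change q.K t x * H t x * _ = _
    simp only [H]
    rw [Finset.mul_sum, Finset.sum_mul]
    exact Finset.sum_congr rfl fun k _ => by ring
  simp_rw [h2]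
  rw [Finset.sum_comm]
  simp only [Finset.mul_sum, hk]

end Params

/-! ### Foreign and native interference profiles -/

namespace Params

variable {q : Params}

/-- Mean received power, at normalised distance `x`, from a foreign secondary base station. -/
noncomputable def foreignProfile (q : Params) (t : LinkType) (x : ℝ) : ℝ :=
  (Ioi (1 : ℝ)).indicator (fun x => q.xi * x ^ (-q.al t)) x

/-- Mean received power, at normalised distance `x`, from a native secondary base station. -/
noncomputable def nativeProfile (q : Params) (x : ℝ) : ℝ :=
  (Iic (1 : ℝ)).indicator (fun _ => q.xi) x

theorem measurable_foreignProfile (t : LinkType) : Measurable (q.foreignProfile t) :=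
  Measurable.indicator (by fun_prop) measurableSet_Ioi

theorem measurable_nativeProfile : Measurable q.nativeProfile :=
  Measurable.indicator measurable_const measurableSet_Iic

theorem foreignProfile_nonneg (hq : q.Valid) (t : LinkType) {x : ℝ} (hx : 0 < x) :
    0 ≤ q.foreignProfile t x :=
  indicator_apply_nonneg fun _ => mul_nonneg hq.xi_pos.le (Real.rpow_nonneg hx.le _)

theorem nativeProfile_nonneg (hq : q.Valid) (x : ℝ) : 0 ≤ q.nativeProfile x :=
  indicator_apply_nonneg fun _ => hq.xi_pos.le

/-- Substitute x = c v with c = (Bξ)^{1/α_t}: then Bξ x^{-α_t} = v^{-α_t}, and the cutoff x > 1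
becomes v > 1/c. -/
theorem EF_eq (hq : q.Valid) {B : ℝ} (hB : 0 < B) :
    q.EF B q.xi = ∑ t, ∫⁻ x in Ioi (0 : ℝ), q.K t x * ENNReal.ofReal
      (B * q.foreignProfile t x / (1 + B * q.foreignProfile t x)) *
      ENNReal.ofReal (2 * Real.pi * x) := by
  have hBx : 0 < B * q.xi := mul_pos hB hq.xi_pos
  refine Finset.sum_congr rfl fun t _ => ?_
  set c := (B * q.xi) ^ (1 / q.al t) with hc
  have hcpos : 0 < c := Real.rpow_pos_of_pos hBx _
  have ha := hq.al_pos t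
  rw [lintegral_Ioi_scale hcpos (fun x => q.K t x * ENNReal.ofReal
      (B * q.foreignProfile t x / (1 + B * q.foreignProfile t x))), hc, rpow_two_div hBx.le, ← hc]
  congr 1
  have hlow : (q.xi * B) ^ (-(1 / q.al t)) = c⁻¹ := by
    rw [hc, mul_comm q.xi, Real.rpow_neg hBx.le]
  rw [hlow]
  have hsub : Ioi c⁻¹ ⊆ Ioi (0 : ℝ) := Ioi_subset_Ioi (inv_pos.2 hcpos).le
  have hind : ∀ v ∈ Ioi (0 : ℝ), q.K t (c * v) * ENNReal.ofReal
      (B * q.foreignProfile t (c * v) / (1 + B * q.foreignProfile t (c * v))) *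
      ENNReal.ofReal (2 * Real.pi * v) = (Ioi c⁻¹).indicator (fun v =>
        q.K t (v * c) * ENNReal.ofReal (1 / (1 + v ^ q.al t) * (2 * Real.pi * v))) v := by
    intro v (hv : 0 < v)
    have hiff : v ∈ Ioi c⁻¹ ↔ c * v ∈ Ioi (1 : ℝ) := by
      rw [mem_Ioi, mem_Ioi, inv_lt_iff_one_lt_mul₀' hcpos]
    by_cases h : v ∈ Ioi c⁻¹
    · have hvp := Real.rpow_pos_of_pos hv (q.al t)
      rw [indicator_of_mem h, foreignProfile, indicator_of_mem (hiff.1 h), mul_comm c v, mul_assoc,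
        ← ENNReal.ofReal_mul' (by positivity)]
      congr 3
      have h1 : (v * c) ^ (-q.al t) = (v ^ q.al t)⁻¹ * (B * q.xi)⁻¹ := by
        rw [Real.rpow_neg (by positivity), Real.mul_rpow hv.le hcpos.le, mul_inv, hc,
          ← Real.rpow_mul hBx.le, one_div, inv_mul_cancel₀ ha.ne', Real.rpow_one]
      rw [h1]
      have hxi := hq.xi_pos
      field_simp
      ring
    · rw [indicator_of_notMem h, foreignProfile, indicator_of_notMem (fun h' => h (hiff.2 h'))]
      simp
  rw [setLIntegral_congr_fun measurableSet_Ioi hind, lintegral_indicator measurableSet_Ioi,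
    Measure.restrict_restrict measurableSet_Ioi, inter_eq_left.2 hsub]

/-- The native profile is the constant ξ up to normalised distance 1, so Bξ/(1 + Bξ) comes out of
the integral. -/
theorem EN_eq (hq : q.Valid) {B : ℝ} (hB : 0 < B) :
    q.EN B = ∑ t, ∫⁻ x in Ioi (0 : ℝ), q.K t x * ENNReal.ofReal
      (B * q.nativeProfile x / (1 + B * q.nativeProfile x)) *
      ENNReal.ofReal (2 * Real.pi * x) := by
  have hxi := hq.xi_pos
  have hind : ∀ t, ∀ x, q.K t x * ENNReal.ofReal
      (B * q.nativeProfile x / (1 + B * q.nativeProfile x)) *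
      ENNReal.ofReal (2 * Real.pi * x) = (Iic (1 : ℝ)).indicator (fun x =>
        ENNReal.ofReal (1 / (1 + (B * q.xi)⁻¹)) * (q.K t x * ENNReal.ofReal (2 * Real.pi * x))) x := by
    intro t x
    by_cases h : x ∈ Iic (1 : ℝ)
    · rw [indicator_of_mem h, nativeProfile, indicator_of_mem h, mul_comm (q.K t x), mul_assoc]
      congr 2
      field_simp
      ring
    · rw [indicator_of_notMem h, nativeProfile, indicator_of_notMem h]
      simp
  have hset : Iic (1 : ℝ) ∩ Ioi 0 = Ioc 0 1 := by ext; simp [and_comm]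
  have hm : ∀ t, Measurable fun x => q.K t x * ENNReal.ofReal (2 * Real.pi * x) := fun t =>
    (measurable_K hq t).mul (by fun_prop)
  simp only [hind, lintegral_indicator measurableSet_Iic, Measure.restrict_restrict measurableSet_Iic,
    hset, lintegral_const_mul _ (hm _)]
  rw [EN, ← Finset.mul_sum, LinkType.sum_univ, Measure.restrict_congr_set Ioo_ae_eq_Ioc,
    ← lintegral_add_left (hm _)]
  simp only [add_mul]

/-- Whether a base station at distance `r` over a type-`t` link prefers the typical user to a user
at distance and link type `y`. -/
def Prefers (q : Params) (t : LinkType) (r : ℝ) (y : ℝ × LinkType) : Prop :=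
  q.pathLoss y.2 y.1 ≤ q.pathLoss t r

open Classical in
/-- Received power at the typical user from a secondary base station at distance `r` over a type-`t`
link, in terms of the fading, the angle, and the link to the closest other user. -/
noncomputable def secondaryRecv (q : Params) (t : LinkType) (r : ℝ) (m : ℝ × ℝ × (ℝ × LinkType)) : ℝ :=
  (q.xi * (if q.Prefers t r m.2.2 then (r, t) else m.2.2).1 ^
    q.al (if q.Prefers t r m.2.2 then (r, t) else m.2.2).2 /
    q.C (if q.Prefers t r m.2.2 then (r, t) else m.2.2).2) *
    q.antS.gain m.2.1 * m.1 * q.pathLoss t r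

open Classical in
noncomputable def foreignRecv (q : Params) (t : LinkType) (r : ℝ) (m : ℝ × ℝ × (ℝ × LinkType)) :
    ℝ≥0∞ := if q.Prefers t r m.2.2 then 0 else ENNReal.ofReal (q.secondaryRecv t r m)

open Classical in
noncomputable def nativeRecv (q : Params) (t : LinkType) (r : ℝ) (m : ℝ × ℝ × (ℝ × LinkType)) :
    ℝ≥0∞ := if q.Prefers t r m.2.2 then ENNReal.ofReal (q.secondaryRecv t r m) else 0

theorem measurableSet_prefers (t : LinkType) :
    MeasurableSet {p : ℝ × (ℝ × ℝ × (ℝ × LinkType)) | q.Prefers t p.1 p.2.2.2} := by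
  have h1 : Measurable fun y : ℝ × LinkType => q.pathLoss y.2 y.1 :=
    measurable_from_prod_countable_left fun T => by
      simp only [pathLoss]
      fun_prop
  have h2 : Measurable fun r => q.pathLoss t r := by simp only [pathLoss]; fun_prop
  exact measurableSet_le (h1.comp (by fun_prop)) (h2.comp measurable_fst)

theorem measurable_secondaryRecv (t : LinkType) :
    Measurable (Function.uncurry (q.secondaryRecv t)) := by
  classical
  have h1 : Measurable fun y : ℝ × LinkType => q.xi * y.1 ^ q.al y.2 / q.C y.2 :=
    measurable_from_prod_countable_left fun T => by
      simp only
      fun_prop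
  have h2 : Measurable fun p : ℝ × (ℝ × ℝ × (ℝ × LinkType)) =>
      if q.Prefers t p.1 p.2.2.2 then (p.1, t) else p.2.2.2 :=
    Measurable.ite (measurableSet_prefers t) (measurable_fst.prodMk measurable_const) (by fun_prop)
  have h3 : Measurable fun r => q.pathLoss t r := by simp only [pathLoss]; fun_prop
  exact (((h1.comp h2).mul (q.antS.measurable_gain.comp (by fun_prop))).mul (by fun_prop)).mul
    (h3.comp measurable_fst)

theorem measurable_foreignRecv (t : LinkType) : Measurable (Function.uncurry (q.foreignRecv t)) := by
  classical
  exact Measurable.ite (measurableSet_prefers t) measurable_const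
    (measurable_secondaryRecv t).ennreal_ofReal

theorem measurable_nativeRecv (t : LinkType) : Measurable (Function.uncurry (q.nativeRecv t)) := by
  classical
  exact Measurable.ite (measurableSet_prefers t) (measurable_secondaryRecv t).ennreal_ofReal
    measurable_const

/-- The denominator is the length at which a type-t link ties with the link (R, T), so preference is
a threshold at 1 on the normalised distance. -/
theorem prefers_iff (hq : q.Valid) {t T : LinkType} {r R : ℝ} (hr : 0 < r) (hR : 0 < R) :
    q.Prefers t r (R, T) ↔
      r / ((R ^ q.al T / q.C T) ^ (1 / q.al t) * q.C t ^ (1 / q.al t)) ≤ 1 := by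
  have hrad := hq.radial_pos T hR
  have hℓ : (R ^ q.al T / q.C T) ^ (1 / q.al t) * q.C t ^ (1 / q.al t) =
      (q.radial T R * q.C t) ^ (1 / q.al t) := by
    rw [Real.mul_rpow hrad.le (hq.C_pos t).le, radial]
  rw [Prefers, hq.pathLoss_le_iff hR hr, hq.radial_le_iff t hr hrad.le, hℓ, div_le_one
    (Real.rpow_pos_of_pos (mul_pos hrad (hq.C_pos t)) _)]

/-- The power that meets the limit at the home user is ξ P̄ with P̄ = R^{α_T} / C_T. Since ℓ^{α_t} =
P̄ C_t, it arrives over the type-t link as ξ (r/ℓ)^{-α_t}. -/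
theorem foreignRecv_eq (hq : q.Valid) (t : LinkType) (r F θ R : ℝ) (T : LinkType) (hr : 0 < r)
    (hR : 0 < R) : q.foreignRecv t r (F, θ, (R, T)) = ENNReal.ofReal (q.antS.gain θ *
        q.foreignProfile t (r / ((R ^ q.al T / q.C T) ^ (1 / q.al t) * q.C t ^ (1 / q.al t))) * F) := by
  have hrad : 0 < R ^ q.al T / q.C T := hq.radial_pos T hR
  have hC := hq.C_pos t
  set ℓ := (R ^ q.al T / q.C T) ^ (1 / q.al t) * q.C t ^ (1 / q.al t) with hℓ
  have hℓpos : 0 < ℓ := by positivity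
  by_cases h : q.Prefers t r (R, T)
  · have h1 : r / ℓ ∉ Ioi (1 : ℝ) := not_lt.2 ((prefers_iff hq hr hR).1 h)
    simp [foreignRecv, h, foreignProfile, indicator_of_notMem h1]
  · have h1 : r / ℓ ∈ Ioi (1 : ℝ) := not_le.1 fun h' => h ((prefers_iff hq hr hR).2 h')
    simp only [foreignRecv, h, if_false, foreignProfile, indicator_of_mem h1, secondaryRecv]
    congr 1
    have hpow : ℓ ^ q.al t = (R ^ q.al T / q.C T) * q.C t := by
      rw [hℓ, ← Real.mul_rpow hrad.le hC.le, ← Real.rpow_mul (by positivity), one_div,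
        inv_mul_cancel₀ (hq.al_pos t).ne', Real.rpow_one]
    rw [Real.rpow_neg (by positivity), Real.div_rpow hr.le hℓpos.le, hpow, pathLoss,
      Real.rpow_neg hr.le, inv_div]
    ring

theorem rpow_mul_pathLoss (hq : q.Valid) (t : LinkType) {r : ℝ} (hr : 0 < r) :
    q.xi * r ^ q.al t / q.C t * q.pathLoss t r = q.xi := by
  have hC := hq.C_pos t
  have := Real.rpow_pos_of_pos hr (q.al t)
  rw [pathLoss, Real.rpow_neg hr.le]
  field_simp

/-- Power control inverts the very link over which the typical user is reached, so the distance
cancels. -/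
theorem nativeRecv_eq (hq : q.Valid) (t : LinkType) (r F θ R : ℝ) (T : LinkType) (hr : 0 < r)
    (hR : 0 < R) : q.nativeRecv t r (F, θ, (R, T)) = ENNReal.ofReal (q.antS.gain θ *
        q.nativeProfile (r / ((R ^ q.al T / q.C T) ^ (1 / q.al t) * q.C t ^ (1 / q.al t))) * F) := by
  by_cases h : q.Prefers t r (R, T)
  · have h1 := (prefers_iff hq hr hR).1 h
    simp only [nativeRecv, h, if_true, nativeProfile, indicator_of_mem (mem_Iic.2 h1), secondaryRecv]
    congr 1
    calc _ = q.xi * r ^ q.al t / q.C t * q.pathLoss t r * q.antS.gain θ * F := by ring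
      _ = _ := by rw [rpow_mul_pathLoss hq t hr]; ring
  · have h1 : r / ((R ^ q.al T / q.C T) ^ (1 / q.al t) * q.C t ^ (1 / q.al t)) ∉ Iic (1 : ℝ) :=
      fun h' => h ((prefers_iff hq hr hR).2 h')
    rw [nativeProfile, indicator_of_notMem h1]
    simp [nativeRecv, h]

/-- The intensity measure of the secondary base stations together with their marks. -/
noncomputable def secondaryIntensity (hq : q.Valid) (ν : Measure (ℝ × LinkType)) :
    Measure (Plane × (LinkType × (ℝ × ℝ × (ℝ × LinkType)))) :=
  (ENNReal.ofReal q.lamS • volume) ⊗ₘ (linkKernel hq ×ₖ Kernel.const _ (secondaryMarkLaw ν))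

theorem lintegral_foreign (hq : q.Valid) {ν : Measure (ℝ × LinkType)} [IsProbabilityMeasure ν]
    (hν : HasHomeDensity q ν) {s : ℝ} (hs : 0 < s) :
    ∫⁻ z, 1 - expNeg (ENNReal.ofReal s * q.foreignRecv z.2.1 ‖z.1‖ z.2.2) ∂(secondaryIntensity hq ν) =
      ENNReal.ofReal q.lamS * ∑ k : Fin 2, ENNReal.ofReal (q.antS.lobeProb k) *
        q.EF (s * q.antS.lobe k) q.xi := by
  rw [secondaryIntensity, lintegral_one_sub_expNeg_secondary hq hν measurable_foreignProfile
    (fun t x hx => foreignProfile_nonneg hq t hx) measurable_foreignRecv (foreignRecv_eq hq) hs]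
  simp only [EF_eq hq (mul_pos hs (hq.antS_valid.lobe_pos _))]

theorem lintegral_native (hq : q.Valid) {ν : Measure (ℝ × LinkType)} [IsProbabilityMeasure ν]
    (hν : HasHomeDensity q ν) {s : ℝ} (hs : 0 < s) :
    ∫⁻ z, 1 - expNeg (ENNReal.ofReal s * q.nativeRecv z.2.1 ‖z.1‖ z.2.2) ∂(secondaryIntensity hq ν) =
      ENNReal.ofReal q.lamS * ∑ k : Fin 2, ENNReal.ofReal (q.antS.lobeProb k) *
        q.EN (s * q.antS.lobe k) := by
  rw [secondaryIntensity, lintegral_one_sub_expNeg_secondary hq hν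
    (fun _ => measurable_nativeProfile) (fun t x _ => nativeProfile_nonneg hq x)
    measurable_nativeRecv (nativeRecv_eq hq) hs]
  simp only [EN_eq hq (mul_pos hs (hq.antS_valid.lobe_pos _))]

theorem measurable_marked {M : Type*} [MeasurableSpace M] {Φ : LinkType → ℝ → M → ℝ≥0∞}
    (hΦ : ∀ t, Measurable (Function.uncurry (Φ t))) :
    Measurable fun z : Plane × (LinkType × M) => Φ z.2.1 ‖z.1‖ z.2.2 := by
  have h : Measurable fun y : LinkType × (ℝ × M) => Φ y.1 y.2.1 y.2.2 :=
    measurable_linkType_prod fun t => hΦ t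
  exact h.comp (f := fun z : Plane × (LinkType × M) => (z.2.1, (‖z.1‖, z.2.2))) (by fun_prop)

/-- At each marked point one of the two integrands vanishes. This additivity is what makes the
Laplace transform of the total secondary interference factor. -/
theorem lintegral_foreign_add_native (hq : q.Valid) (ν : Measure (ℝ × LinkType)) (s : ℝ) :
    ∫⁻ z, 1 - expNeg (ENNReal.ofReal s * ENNReal.ofReal (q.secondaryRecv z.2.1 ‖z.1‖ z.2.2))
        ∂(secondaryIntensity hq ν) =
      ∫⁻ z, 1 - expNeg (ENNReal.ofReal s * q.foreignRecv z.2.1 ‖z.1‖ z.2.2) ∂(secondaryIntensity hq ν) +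
      ∫⁻ z, 1 - expNeg (ENNReal.ofReal s * q.nativeRecv z.2.1 ‖z.1‖ z.2.2)
        ∂(secondaryIntensity hq ν) := by
  rw [← lintegral_add_left (measurable_one_sub_expNeg
    ((measurable_marked measurable_foreignRecv).const_mul _))]
  refine lintegral_congr fun z => ?_
  by_cases h : q.Prefers z.2.1 ‖z.1‖ z.2.2.2.2 <;> simp [foreignRecv, nativeRecv, h]

end Params

/-! ### Laplace transforms of the secondary interference -/

namespace Network.IsModel

variable {Ω : Type*} [MeasurableSpace Ω] {N : Network Ω} {q : Params}
  {ν : Measure (ℝ × LinkType)} {P : Measure Ω} [IsProbabilityMeasure P]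

theorem hasPoissonLaplace_secondary (hN : N.IsModel q ν P) (hq : q.Valid) [IsProbabilityMeasure ν] :
    HasPoissonLaplace P (fun i ω =>
      (N.y i ω, (N.linkS i ω, N.fadS i ω, N.angS i ω, (N.R i ω, N.T i ω))))
      (Params.secondaryIntensity hq ν) := by
  have hmark : IsIndependentMarking P N.y
      (fun i ω => (N.linkS i ω, N.fadS i ω, N.angS i ω, (N.R i ω, N.T i ω)))
      (Params.linkKernel hq ×ₖ Kernel.const _ (Params.secondaryMarkLaw ν)) := by
    have : ⇑(Params.linkKernel hq ×ₖ Kernel.const _ (Params.secondaryMarkLaw ν)) =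
        fun v => (q.linkLaw ‖v‖).prod (fadingLaw.prod (angleLaw.prod ν)) := by
      funext v
      rw [Kernel.prod_apply]
      rfl
    rw [this]
    exact hN.markingS
  exact hmark.hasPoissonLaplace hN.poissonS.hasPoissonLaplace

theorem lintegral_expNeg_interfForeign (hN : N.IsModel q ν P) (hq : q.Valid)
    [IsProbabilityMeasure ν] (hν : q.HasHomeDensity ν) {s : ℝ} (hs : 0 < s) :
    ∫⁻ ω, expNeg (ENNReal.ofReal s * N.interfForeign q ω) ∂P =
      expNeg (ENNReal.ofReal q.lamS * ∑ k : Fin 2, ENNReal.ofReal (q.antS.lobeProb k) *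
        q.EF (s * q.antS.lobe k) q.xi) := by
  rw [← Params.lintegral_foreign hq hν hs, ← (hN.hasPoissonLaplace_secondary hq).laplace _
    ((Params.measurable_marked Params.measurable_foreignRecv).const_mul _)]
  refine lintegral_congr fun ω => ?_
  rw [ENNReal.tsum_mul_left]
  rfl

theorem lintegral_expNeg_interfNative (hN : N.IsModel q ν P) (hq : q.Valid)
    [IsProbabilityMeasure ν] (hν : q.HasHomeDensity ν) {s : ℝ} (hs : 0 < s) :
    ∫⁻ ω, expNeg (ENNReal.ofReal s * N.interfNative q ω) ∂P =
      expNeg (ENNReal.ofReal q.lamS * ∑ k : Fin 2, ENNReal.ofReal (q.antS.lobeProb k) *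
        q.EN (s * q.antS.lobe k)) := by
  rw [← Params.lintegral_native hq hν hs, ← (hN.hasPoissonLaplace_secondary hq).laplace _
    ((Params.measurable_marked Params.measurable_nativeRecv).const_mul _)]
  refine lintegral_congr fun ω => ?_
  rw [ENNReal.tsum_mul_left]
  rfl

theorem lintegral_expNeg_interfS (hN : N.IsModel q ν P) (hq : q.Valid)
    [IsProbabilityMeasure ν] (hν : q.HasHomeDensity ν) {s : ℝ} (hs : 0 < s) :
    ∫⁻ ω, expNeg (ENNReal.ofReal s * N.interfS q ω) ∂P =
      expNeg (ENNReal.ofReal q.lamS * ∑ k : Fin 2, ENNReal.ofReal (q.antS.lobeProb k) *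
        q.EF (s * q.antS.lobe k) q.xi) *
      expNeg (ENNReal.ofReal q.lamS * ∑ k : Fin 2, ENNReal.ofReal (q.antS.lobeProb k) *
        q.EN (s * q.antS.lobe k)) := by
  rw [← expNeg_add, ← Params.lintegral_foreign hq hν hs, ← Params.lintegral_native hq hν hs,
    ← Params.lintegral_foreign_add_native, ← (hN.hasPoissonLaplace_secondary hq).laplace
      (fun z => ENNReal.ofReal s * ENNReal.ofReal (q.secondaryRecv z.2.1 ‖z.1‖ z.2.2))
      ((Params.measurable_marked (Φ := fun t r m => ENNReal.ofReal (q.secondaryRecv t r m))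
        fun t => (Params.measurable_secondaryRecv t).ennreal_ofReal).const_mul _)]
  refine lintegral_congr fun ω => ?_
  rw [ENNReal.tsum_mul_left]
  rfl

end Network.IsModel

namespace Network

variable {Ω : Type*} (N : Network Ω) (q : Params)

theorem interfS_eq_add (ω : Ω) : N.interfS q ω = N.interfForeign q ω + N.interfNative q ω := by
  rw [interfS, interfForeign, interfNative, ← ENNReal.tsum_add]
  refine tsum_congr fun j => ?_
  by_cases h : N.IsNative q j ω <;> simp [h]

theorem powS_mul_lossS (hq : q.Valid) {i : ℕ} {ω : Ω} (h : N.IsNative q i ω) (hy : N.y i ω ≠ 0) :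
    N.powS q i ω * N.lossS q i ω = q.xi := by
  rw [powS, homeLink, if_pos h, lossS]
  exact Params.rpow_mul_pathLoss hq _ (norm_pos_iff.2 hy)

end Network

/-! ### The Laplace exponent of the primary network -/

namespace Params

variable {q : Params}

/-- Received power at the typical user from a primary base station at distance `r` over a type-`t`
link, in terms of the fading and the angle. -/
noncomputable def primaryRecv (q : Params) (t : LinkType) (r : ℝ) (m : ℝ × ℝ) : ℝ :=
  q.powP * q.antP.gain m.2 * m.1 * q.pathLoss t r

theorem measurable_pathLoss (t : LinkType) : Measurable (q.pathLoss t) := by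
  unfold pathLoss
  fun_prop

theorem measurable_primaryRecv (t : LinkType) : Measurable (Function.uncurry (q.primaryRecv t)) :=
  (((q.antP.measurable_gain.comp (by fun_prop)).const_mul _).mul (by fun_prop)).mul
    ((measurable_pathLoss t).comp measurable_fst)

/-- The weight by which a primary base station at distance `r` over a type-`t` link enters the
Laplace exponent, at argument `s`, when the serving base station is at radial distance `x`. -/
noncomputable def primaryExponent (q : Params) (s x : ℝ) (t : LinkType) (r : ℝ) (m : ℝ × ℝ) : ℝ≥0∞ :=
  (if q.radial t r < x then ∞ else 0) + ENNReal.ofReal s * ENNReal.ofReal (q.primaryRecv t r m)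

theorem measurable_primaryExponent (s x : ℝ) (t : LinkType) :
    Measurable (Function.uncurry (q.primaryExponent s x t)) := by
  refine Measurable.add ?_ ((measurable_primaryRecv t).ennreal_ofReal.const_mul _)
  exact Measurable.ite (measurableSet_lt ((measurable_radial t).comp measurable_fst)
    measurable_const) measurable_const measurable_const

/-- The intensity measure of the primary base stations together with their marks. -/
noncomputable def primaryIntensity (hq : q.Valid) : Measure (Plane × (LinkType × (ℝ × ℝ))) :=
  (ENNReal.ofReal q.lamP • volume) ⊗ₘ (linkKernel hq ×ₖ Kernel.const _ (fadingLaw.prod angleLaw))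

instance (hq : q.Valid) : SigmaFinite (primaryIntensity hq) := sigmaFinite_compProd _ _

/-- A radially closer base station has infinite weight and so contributes 1; for any other the
fading and the angle are averaged. -/
theorem lintegral_primary_marks (hq : q.Valid) {s : ℝ} (hs : 0 ≤ s) (t : LinkType) (x : ℝ) {r : ℝ}
    (hr : 0 < r) :
    ∫⁻ m, 1 - expNeg (q.primaryExponent s x t r m) ∂(fadingLaw.prod angleLaw) =
      if q.radial t r < x then 1 else ∑ k : Fin 2, ENNReal.ofReal (q.antP.lobeProb k) *
        ENNReal.ofReal (s * q.antP.lobe k * (q.powP * q.pathLoss t r) /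
          (1 + s * q.antP.lobe k * (q.powP * q.pathLoss t r))) := by
  by_cases h : q.radial t r < x
  · simp [primaryExponent, h]
  · have hpl : 0 < q.pathLoss t r := by
      rw [pathLoss_eq_inv_radial t hr.le]
      exact inv_pos.2 (hq.radial_pos t hr)
    have hpw := hq.powP_pos
    have hm : Measurable fun m => 1 - expNeg (q.primaryExponent s x t r m) :=
      measurable_one_sub_expNeg
        ((measurable_primaryExponent s x t).comp (measurable_const.prodMk measurable_id))
    rw [lintegral_prod_symm _ hm.aemeasurable, if_neg h, ← hq.antP_valid.lintegral_gain
      (fun G => ENNReal.ofReal (s * G * (q.powP * q.pathLoss t r) /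
        (1 + s * G * (q.powP * q.pathLoss t r))))]
    refine lintegral_congr fun θ => ?_
    have hG := hq.antP_valid.gain_pos θ
    rw [← lintegral_one_sub_expNeg_fadingLaw (by positivity)]
    refine lintegral_congr fun F => ?_
    simp only [primaryExponent, h, if_false, zero_add, primaryRecv]
    rw [← ENNReal.ofReal_mul hs]
    congr 3
    ring

theorem M_nonneg (hq : q.Valid) (t : LinkType) {z : ℝ} (hz : 0 ≤ z) : 0 ≤ q.M t z := by
  have hC := (hq.C_pos t).le
  have hpw := hq.powP_pos.le
  have := hq.p_nonneg t (r := z * q.powP ^ (1 / q.al t) * q.C t ^ (1 / q.al t)) (by positivity)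
  unfold M
  positivity

theorem measurable_M (hq : q.Valid) (t : LinkType) : Measurable (q.M t) :=
  (((hq.measurable_p t).comp (by fun_prop)).mul_const _).mul_const _

/-- The substitution r = (P_P C_t)^{1/α_t} z, after which the average received power is z^{-α_t} and
the radial distance is P_P z^{α_t}. -/
theorem lintegral_primary_rescale (hq : q.Valid) (t : LinkType) (J : ℝ → ℝ≥0∞) :
    ∫⁻ r in Ioi (0 : ℝ), ENNReal.ofReal (q.p t r) * J r * ENNReal.ofReal (2 * Real.pi * r) =
      ∫⁻ z in Ioi (0 : ℝ), ENNReal.ofReal (q.M t z) *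
        J (q.powP ^ (1 / q.al t) * q.C t ^ (1 / q.al t) * z) * ENNReal.ofReal (2 * Real.pi * z) := by
  have hC := hq.C_pos t
  have hpw := hq.powP_pos
  rw [lintegral_Ioi_scale (c := q.powP ^ (1 / q.al t) * q.C t ^ (1 / q.al t)) (by positivity)
    (fun r => ENNReal.ofReal (q.p t r) * J r), ← lintegral_const_mul' _ _ ENNReal.ofReal_ne_top]
  refine setLIntegral_congr_fun measurableSet_Ioi fun z (hz : 0 < z) => ?_
  have h1 : z * q.powP ^ (1 / q.al t) * q.C t ^ (1 / q.al t) =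
      q.powP ^ (1 / q.al t) * q.C t ^ (1 / q.al t) * z := by ring
  have h2 := hq.p_nonneg t (r := q.powP ^ (1 / q.al t) * q.C t ^ (1 / q.al t) * z) (by positivity)
  simp only [M, h1]
  rw [mul_pow, rpow_two_div hpw.le, rpow_two_div hC.le, mul_assoc (q.p t _), ENNReal.ofReal_mul h2]
  ring

theorem radial_rescale (hq : q.Valid) (t : LinkType) {z : ℝ} (hz : 0 < z) :
    q.radial t (q.powP ^ (1 / q.al t) * q.C t ^ (1 / q.al t) * z) = q.powP * z ^ q.al t := by
  have hC := hq.C_pos t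
  have hpw := hq.powP_pos
  have ha := (hq.al_pos t).ne'
  rw [radial, Real.mul_rpow (by positivity) hz.le, Real.mul_rpow (by positivity) (by positivity),
    ← Real.rpow_mul hpw.le, ← Real.rpow_mul hC.le, one_div, inv_mul_cancel₀ ha, Real.rpow_one,
    Real.rpow_one]
  field_simp

theorem EP_eq (hq : q.Valid) {B e : ℝ} (hB : 0 < B) (he : 0 < e) :
    q.EP B e = ∑ t, ∫⁻ z in Ioi (0 : ℝ), ENNReal.ofReal (q.M t z) *
      (Ici (e ^ (1 / q.al t))).indicator (fun z => ENNReal.ofReal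
        (B * (z ^ q.al t)⁻¹ / (1 + B * (z ^ q.al t)⁻¹))) z * ENNReal.ofReal (2 * Real.pi * z) := by
  refine Finset.sum_congr rfl fun t _ => ?_
  set c := B ^ (1 / q.al t) with hc
  have hcpos : 0 < c := Real.rpow_pos_of_pos hB _
  have ha := hq.al_pos t
  set a := e ^ (1 / q.al t) with haa
  have hapos : 0 < a := Real.rpow_pos_of_pos he _
  rw [lintegral_Ioi_scale hcpos (fun z => ENNReal.ofReal (q.M t z) *
      (Ici a).indicator (fun z => ENNReal.ofReal
        (B * (z ^ q.al t)⁻¹ / (1 + B * (z ^ q.al t)⁻¹))) z), hc, rpow_two_div hB.le, ← hc]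
  congr 1
  have hlow : (e / B) ^ (1 / q.al t) = a / c := Real.div_rpow he.le hB.le _
  have hac : 0 < a / c := div_pos hapos hcpos
  rw [hlow]
  have hind : ∀ v ∈ Ioi (0 : ℝ), ENNReal.ofReal (q.M t (c * v)) *
      (Ici a).indicator (fun z => ENNReal.ofReal
        (B * (z ^ q.al t)⁻¹ / (1 + B * (z ^ q.al t)⁻¹))) (c * v) * ENNReal.ofReal (2 * Real.pi * v) =
      (Ici (a / c)).indicator (fun v => ENNReal.ofReal
        (1 / (1 + v ^ q.al t) * q.M t (v * c) * (2 * Real.pi * v))) v := by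
    intro v (hv : 0 < v)
    have hiff : v ∈ Ici (a / c) ↔ c * v ∈ Ici a := by
      rw [mem_Ici, mem_Ici, div_le_iff₀' hcpos]
    by_cases h : v ∈ Ici (a / c)
    · have hvp := Real.rpow_pos_of_pos hv (q.al t)
      have hM := M_nonneg hq t (mul_pos hv hcpos).le
      rw [indicator_of_mem h, indicator_of_mem (hiff.1 h), mul_comm c v, ← ENNReal.ofReal_mul hM,
        ← ENNReal.ofReal_mul' (by positivity)]
      congr 2
      have h1 : (v * c) ^ q.al t = v ^ q.al t * B := by
        rw [Real.mul_rpow hv.le hcpos.le, hc, ← Real.rpow_mul hB.le, one_div,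
          inv_mul_cancel₀ ha.ne', Real.rpow_one]
      rw [h1, mul_comm (q.M t _)]
      congr 1
      field_simp
      ring
    · rw [indicator_of_notMem h, indicator_of_notMem (fun h' => h (hiff.2 h'))]
      simp
  have hsub : Ici (a / c) ⊆ Ioi (0 : ℝ) := fun v hv => hac.trans_le hv
  rw [setLIntegral_congr_fun measurableSet_Ioi hind, lintegral_indicator measurableSet_Ici,
    Measure.restrict_restrict measurableSet_Ici, inter_eq_left.2 hsub,
    Measure.restrict_congr_set Ioi_ae_eq_Ici]

theorem assocExponent_eq (hq : q.Valid) (t₀ : LinkType) (u : ℝ) :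
    q.assocExponent t₀ u = ENNReal.ofReal q.lamP * ∑ t, ∫⁻ z in Ioi (0 : ℝ),
      ENNReal.ofReal (q.M t z) * (Iio (u ^ (q.al t₀ / q.al t))).indicator 1 z *
        ENNReal.ofReal (2 * Real.pi * z) := by
  rw [assocExponent, Finset.mul_sum]
  refine Finset.sum_congr rfl fun t _ => ?_
  have hind : ∀ z ∈ Ioi (0 : ℝ),
      ENNReal.ofReal (q.M t z) * (Iio (u ^ (q.al t₀ / q.al t))).indicator 1 z *
        ENNReal.ofReal (2 * Real.pi * z) = (Iio (u ^ (q.al t₀ / q.al t))).indicator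
          (fun z => ENNReal.ofReal (2 * Real.pi) * ENNReal.ofReal (q.M t z * z)) z := by
    intro z (hz : 0 < z)
    by_cases h : z ∈ Iio (u ^ (q.al t₀ / q.al t))
    · have hM := M_nonneg hq t hz.le
      rw [indicator_of_mem h, indicator_of_mem h, Pi.one_apply, mul_one, ← ENNReal.ofReal_mul hM,
        ← ENNReal.ofReal_mul (by positivity)]
      congr 1
      ring
    · simp [indicator_of_notMem h]
  have hset : Iio (u ^ (q.al t₀ / q.al t)) ∩ Ioi 0 = Ioo 0 (u ^ (q.al t₀ / q.al t)) := by
    ext; simp [and_comm]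
  rw [setLIntegral_congr_fun measurableSet_Ioi hind, lintegral_indicator measurableSet_Iio,
    Measure.restrict_restrict measurableSet_Iio, hset,
    lintegral_const_mul' _ _ ENNReal.ofReal_ne_top, ← mul_assoc, ← ENNReal.ofReal_mul hq.lamP_pos.le]
  congr 2
  ring

/-- Each radial integral splits at z = u^{α_{t₀}/α_t}, where the average power equals that of the
server. The part below is the association exponent and the part above is E_P. -/
theorem lintegral_primaryExponent (hq : q.Valid) {s : ℝ} (hs : 0 < s) (t₀ : LinkType) {u : ℝ}
    (hu : 0 < u) :
    ∫⁻ z, 1 - expNeg (q.primaryExponent s (q.powP * u ^ q.al t₀) z.2.1 ‖z.1‖ z.2.2)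
      ∂(primaryIntensity hq) =
      ENNReal.ofReal q.lamP * ∑ k : Fin 2, ENNReal.ofReal (q.antP.lobeProb k) *
        q.EP (s * q.antP.lobe k) (u ^ q.al t₀) + q.assocExponent t₀ u := by
  have hpw := hq.powP_pos
  rw [primaryIntensity, lintegral_linked_prod hq q.lamP (fadingLaw.prod angleLaw)
    (g := fun t r m => 1 - expNeg (q.primaryExponent s (q.powP * u ^ q.al t₀) t r m))
    fun t => measurable_one_sub_expNeg (measurable_primaryExponent _ _ t), assocExponent_eq hq,
    ← mul_add]
  congr 1
  simp only [EP_eq hq (mul_pos hs (hq.antP_valid.lobe_pos _)) (Real.rpow_pos_of_pos hu (q.al t₀)),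
    Finset.mul_sum]
  rw [Finset.sum_comm, ← Finset.sum_add_distrib]
  refine Finset.sum_congr rfl fun t _ => ?_
  rw [lintegral_primary_rescale hq t (fun r => ∫⁻ m, 1 - expNeg
    (q.primaryExponent s (q.powP * u ^ q.al t₀) t r m) ∂(fadingLaw.prod angleLaw))]
  have ha : (u ^ q.al t₀) ^ (1 / q.al t) = u ^ (q.al t₀ / q.al t) := by
    rw [← Real.rpow_mul hu.le, mul_one_div]
  rw [ha]
  set a := u ^ (q.al t₀ / q.al t) with haa
  let hk : Fin 2 → ℝ → ℝ≥0∞ := fun k z => (Ici a).indicator (fun z => ENNReal.ofReal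
      (s * q.antP.lobe k * (z ^ q.al t)⁻¹ / (1 + s * q.antP.lobe k * (z ^ q.al t)⁻¹))) z
  have hkm : ∀ k, Measurable fun z => ENNReal.ofReal (q.M t z) * hk k z *
      ENNReal.ofReal (2 * Real.pi * z) := fun k => by
    have h1 : Measurable (hk k) := Measurable.indicator (by fun_prop) measurableSet_Ici
    exact ((measurable_M hq t).ennreal_ofReal.mul h1).mul (by fun_prop)
  change _ = (∑ k : Fin 2, ENNReal.ofReal (q.antP.lobeProb k) * ∫⁻ z in Ioi (0 : ℝ),
    ENNReal.ofReal (q.M t z) * hk k z * ENNReal.ofReal (2 * Real.pi * z)) + _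
  simp_rw [← lintegral_const_mul _ (hkm _)]
  rw [← lintegral_finsetSum _ fun k _ => (hkm k).const_mul _, ← lintegral_add_left
    (Finset.measurable_sum _ fun k _ => (hkm k).const_mul _)]
  refine setLIntegral_congr_fun measurableSet_Ioi fun z (hz : 0 < z) => ?_
  have hC := hq.C_pos t
  have hℓz : 0 < q.powP ^ (1 / q.al t) * q.C t ^ (1 / q.al t) * z := by positivity
  rw [lintegral_primary_marks hq hs.le t _ hℓz, radial_rescale hq t hz,
    pathLoss_eq_inv_radial t hℓz.le, radial_rescale hq t hz, mul_inv,
    mul_inv_cancel_left₀ hpw.ne']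
  have hiff : q.powP * z ^ q.al t < q.powP * u ^ q.al t₀ ↔ z < a := by
    rw [mul_lt_mul_iff_right₀ hpw, ← ha, one_div, Real.lt_rpow_inv_iff_of_pos hz.le (by positivity) (hq.al_pos t)]
  by_cases h : z < a
  · have h1 : z ∈ Iio a := h
    have h2 : z ∉ Ici a := not_le.2 h
    simp [hk, hiff, h]
  · have h1 : z ∉ Iio a := h
    have h2 : z ∈ Ici a := not_lt.1 h
    simp only [hk, hiff, h, if_false, indicator_of_notMem h1, indicator_of_mem h2, mul_zero,
      zero_mul, add_zero]
    rw [Finset.mul_sum, Finset.sum_mul]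
    exact Finset.sum_congr rfl fun k _ => by ring

end Params

/-! ### Conditioning on all but the fading of the serving base station -/

theorem ProbabilityTheory.IndepFun.lintegral_prodMk {Ω α β : Type*} [MeasurableSpace Ω]
    [MeasurableSpace α] [MeasurableSpace β] {P : Measure Ω} [IsProbabilityMeasure P] {X : Ω → α}
    {Y : Ω → β} (h : IndepFun X Y P) (hX : Measurable X) (hY : Measurable Y) {g : α × β → ℝ≥0∞}
    (hg : Measurable g) : ∫⁻ ω, g (X ω, Y ω) ∂P = ∫⁻ ω', ∫⁻ ω, g (X ω, Y ω') ∂P ∂P := by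
  have h1 := (indepFun_iff_map_prod_eq_prod_map_map hX.aemeasurable hY.aemeasurable).1 h
  have := Measure.isProbabilityMeasure_map (μ := P) hX.aemeasurable
  have := Measure.isProbabilityMeasure_map (μ := P) hY.aemeasurable
  rw [← lintegral_map (f := g) hg (hX.prodMk hY), h1, lintegral_prod_symm' _ hg,
    lintegral_map hg.lintegral_prod_left' hY]
  refine lintegral_congr fun ω' => ?_
  exact lintegral_map (f := fun x => g (x, Y ω')) (hg.comp (by fun_prop)) hX

theorem lintegral_lt_fading {T : Type*} [MeasurableSpace T] (μ : Measure T) [SFinite μ]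
    {G : T → ℝ≥0∞} (hG : Measurable G) :
    ∫⁻ a, {a : T × (ℝ × ℝ) | G a.1 < ENNReal.ofReal a.2.1}.indicator 1 a
        ∂(μ.prod (fadingLaw.prod angleLaw)) =
      ∫⁻ a, expNeg (G a.1) ∂(μ.prod (fadingLaw.prod angleLaw)) := by
  have hS : MeasurableSet {a : T × (ℝ × ℝ) | G a.1 < ENNReal.ofReal a.2.1} :=
    measurableSet_lt (by fun_prop) (by fun_prop)
  have hE : Measurable fun a : T × (ℝ × ℝ) => expNeg (G a.1) := by fun_prop
  rw [lintegral_prod _ (measurable_one.indicator hS).aemeasurable,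
    lintegral_prod _ hE.aemeasurable]
  refine lintegral_congr fun t => ?_
  have hS' : MeasurableSet {f : ℝ | G t < ENNReal.ofReal f} :=
    measurableSet_lt measurable_const (by fun_prop)
  have h1 : (fun y : ℝ × ℝ => {a : T × (ℝ × ℝ) | G a.1 < ENNReal.ofReal a.2.1}.indicator
      (1 : T × (ℝ × ℝ) → ℝ≥0∞) (t, y)) = ({f : ℝ | G t < ENNReal.ofReal f} ×ˢ univ).indicator 1 := by
    funext y
    simp [indicator_apply]
  rw [h1, lintegral_indicator_one (hS'.prod MeasurableSet.univ), Measure.prod_prod, measure_univ,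
    mul_one, fadingLaw_tail]
  simp

namespace Network.IsModel

variable {Ω : Type*} [MeasurableSpace Ω] {N : Network Ω} {q : Params}
  {ν : Measure (ℝ × LinkType)} {P : Measure Ω}

theorem markingP_kernel (hN : N.IsModel q ν P) (hq : q.Valid) :
    IsIndependentMarking P N.x (fun i ω => (N.linkP i ω, N.fadP i ω, N.angP i ω))
      (Params.linkKernel hq ×ₖ Kernel.const _ (fadingLaw.prod angleLaw)) := by
  have : ⇑(Params.linkKernel hq ×ₖ Kernel.const _ (fadingLaw.prod angleLaw)) =
      fun v => (q.linkLaw ‖v‖).prod (fadingLaw.prod angleLaw) := by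
    funext v
    rw [Kernel.prod_apply]
    rfl
  rw [this]
  exact hN.markingP

variable [IsProbabilityMeasure P]

theorem hasPoissonLaplace_primary (hN : N.IsModel q ν P) (hq : q.Valid) :
    HasPoissonLaplace P (fun i ω => (N.x i ω, (N.linkP i ω, N.fadP i ω, N.angP i ω)))
      (Params.primaryIntensity hq) :=
  (hN.markingP_kernel hq).hasPoissonLaplace hN.poissonP.hasPoissonLaplace

/-- The fading of the `i`th base station is exponential given everything else. -/
theorem measure_lt_fadP (hN : N.IsModel q ν P) (hq : q.Valid) (i : ℕ)
    {W : (ℕ → Plane × (LinkType × (ℝ × ℝ))) → ℝ≥0∞} (hW : Measurable W)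
    (hWi : ∀ z z', (∀ j, j ≠ i → z j = z' j) → (z i).1 = (z' i).1 → (z i).2.1 = (z' i).2.1 →
      W z = W z') :
    P {ω | W (fun j => (N.x j ω, (N.linkP j ω, N.fadP j ω, N.angP j ω))) <
        ENNReal.ofReal (N.fadP i ω)} =
      ∫⁻ ω, expNeg (W fun j => (N.x j ω, (N.linkP j ω, N.fadP j ω, N.angP j ω))) ∂P := by
  have hm := hN.markingP_kernel hq
  -- Reassembles the configuration from the data without the `i`th mark and that mark.
  let c : ((ℕ → Plane) × (ℕ → LinkType × (ℝ × ℝ))) × (LinkType × (ℝ × ℝ)) →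
      ℕ → Plane × (LinkType × (ℝ × ℝ)) := fun y j => (y.1.1 j, Function.update y.1.2 i y.2 j)
  have hc : Measurable c := by
    refine measurable_pi_iff.2 fun j => Measurable.prodMk (by fun_prop) ?_
    by_cases hj : j = i
    · subst hj
      simpa using measurable_snd
    · simp only [Function.update_of_ne hj]
      fun_prop
  have hWc : Measurable fun y => W (c y) := hW.comp hc
  let d : LinkType × (ℝ × ℝ) := (LinkType.los, 0, 0)
  have key : ∀ ω, c ((fun j => N.x j ω,
      Function.update (fun j => (N.linkP j ω, N.fadP j ω, N.angP j ω)) i d),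
      (N.linkP i ω, N.fadP i ω, N.angP i ω)) =
      fun j => (N.x j ω, (N.linkP j ω, N.fadP j ω, N.angP j ω)) := by
    intro ω
    funext j
    by_cases hj : j = i
    · subst hj; simp [c]
    · simp [c, hj]
  let S : Set (((ℕ → Plane) × (ℕ → LinkType × (ℝ × ℝ))) × (LinkType × (ℝ × ℝ))) :=
    {y | W (c y) < ENNReal.ofReal y.2.2.1}
  have hS : MeasurableSet S := measurableSet_lt hWc (by fun_prop)
  have h1 := hm.lintegral_resample hN.poissonP.measurable i d (measurable_one.indicator hS)
  have h2 := hm.lintegral_resample hN.poissonP.measurable i d (measurable_expNeg.comp hWc)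
  simp only [Function.comp_apply, key] at h2
  rw [h2]
  have hx := hN.poissonP.measurable
  have hmk := hm.measurable
  have hSω : MeasurableSet {ω | W (fun j => (N.x j ω, (N.linkP j ω, N.fadP j ω, N.angP j ω))) <
        ENNReal.ofReal (N.fadP i ω)} := by
    refine measurableSet_lt (hW.comp ?_) ?_
    · exact measurable_pi_iff.2 fun j => (hx j).prodMk (hmk j)
    · exact ((hmk i).snd.fst).ennreal_ofReal
  rw [← lintegral_indicator_one hSω]
  have h3 : ∀ ω, (S.indicator 1 ((fun j => N.x j ω,
      Function.update (fun j => (N.linkP j ω, N.fadP j ω, N.angP j ω)) i d),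
      (N.linkP i ω, N.fadP i ω, N.angP i ω)) : ℝ≥0∞) =
      {ω | W (fun j => (N.x j ω, (N.linkP j ω, N.fadP j ω, N.angP j ω))) <
        ENNReal.ofReal (N.fadP i ω)}.indicator 1 ω := by
    intro ω
    simp only [indicator_apply, S, mem_ofPred_eq, key]
    rfl
  simp only [h3] at h1
  rw [h1]
  refine lintegral_congr fun ω => ?_
  rw [Kernel.prod_apply, Kernel.const_apply]
  set b : (ℕ → Plane) × (ℕ → LinkType × (ℝ × ℝ)) := (fun j => N.x j ω,
      Function.update (fun j => (N.linkP j ω, N.fadP j ω, N.angP j ω)) i d) with hb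
  -- By `hWi` the threshold ignores the fading and angle of the `i`th station, which may be set to
  -- 0; its link type may still matter.
  have hG : ∀ a : LinkType × (ℝ × ℝ), W (c (b, a)) = W (c (b, (a.1, (0, 0)))) := by
    intro a
    refine hWi _ _ (fun j hj => ?_) rfl ?_
    · simp [c, hj]
    · simp [c]
  have h4 := lintegral_lt_fading (Params.linkKernel hq (N.x i ω))
    (G := fun t => W (c (b, (t, (0, 0))))) (Measurable.of_discrete)
  simp only [← hG] at h4
  exact h4

end Network.IsModel

/-! ### Primary weights driven by the radial distance of the server -/

namespace Params

variable {q : Params}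

theorem measurable_radial_marked {M : Type*} [MeasurableSpace M] :
    Measurable fun z : Plane × (LinkType × M) => q.radial z.2.1 ‖z.1‖ :=
  measurable_radial_norm.comp (g := fun z : Plane × LinkType => q.radial z.2 ‖z.1‖)
    (f := fun z : Plane × (LinkType × M) => (z.1, z.2.1)) (by fun_prop)

theorem primaryIntensity_radial (hq : q.Valid) {S : Set ℝ} (hS : MeasurableSet S) :
    primaryIntensity hq ((fun z => q.radial z.2.1 ‖z.1‖) ⁻¹' S) =
      linkedIntensity hq q.lamP ((fun z => q.radial z.2 ‖z.1‖) ⁻¹' S) := by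
  have hm : ∀ t, Measurable fun y : ℝ × (ℝ × ℝ) => (S.indicator 1 (q.radial t y.1) : ℝ≥0∞) :=
    fun t => (measurable_one.indicator hS).comp ((measurable_radial t).comp measurable_fst)
  have := lintegral_linked_prod hq q.lamP (fadingLaw.prod angleLaw)
    (g := fun t r _ => S.indicator 1 (q.radial t r)) hm
  simp only [lintegral_const, measure_univ, mul_one] at this
  rw [linkedIntensity_preimage hq q.lamP hS, ← this,
    ← lintegral_indicator_one (measurable_radial_marked hS)]
  rfl

theorem primaryIntensity_zero (hq : q.Valid) :
    primaryIntensity hq (({0} : Set Plane) ×ˢ univ) = 0 := by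
  rw [primaryIntensity, Measure.compProd_apply_prod (measurableSet_singleton _) MeasurableSet.univ]
  simp

/-- The weight of a primary base station in the Laplace exponent, as a function of the radial
distance `x` of the serving base station, if this distance is multiplied by `k` in the argument. -/
noncomputable def primaryWeight (q : Params) (k x : ℝ) (z : Plane × (LinkType × (ℝ × ℝ))) : ℝ≥0∞ :=
  q.primaryExponent (k * x) x z.2.1 ‖z.1‖ z.2.2

theorem measurable_primaryWeight (k : ℝ) :
    Measurable (Function.uncurry (q.primaryWeight k)) := by
  have h1 : Measurable fun y : ℝ × (Plane × (LinkType × (ℝ × ℝ))) =>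
      q.radial y.2.2.1 ‖y.2.1‖ := measurable_radial_marked.comp
        (g := fun z : Plane × (LinkType × (ℝ × ℝ)) => q.radial z.2.1 ‖z.1‖) measurable_snd
  have h2 : Measurable fun y : ℝ × (Plane × (LinkType × (ℝ × ℝ))) =>
      ENNReal.ofReal (q.primaryRecv y.2.2.1 ‖y.2.1‖ y.2.2.2) :=
    (measurable_marked (Φ := fun t r m => ENNReal.ofReal (q.primaryRecv t r m))
      fun t => (measurable_primaryRecv t).ennreal_ofReal).comp
        (g := fun z : Plane × (LinkType × (ℝ × ℝ)) =>
          ENNReal.ofReal (q.primaryRecv z.2.1 ‖z.1‖ z.2.2)) measurable_snd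
  exact (Measurable.ite (measurableSet_lt h1 measurable_fst) measurable_const
    measurable_const).add (Measurable.mul (by fun_prop) h2)

theorem monotone_primaryWeight {k : ℝ} (hk : 0 ≤ k) (z : Plane × (LinkType × (ℝ × ℝ))) :
    Monotone fun x => q.primaryWeight k x z := fun _ _ hxy =>
  add_le_add (monotone_ite_lt _ hxy) (mul_le_mul_left
    (ENNReal.ofReal_le_ofReal (mul_le_mul_of_nonneg_left hxy hk)) _)

/-- The dyadic floors approach x from below, and the strict inequality in the exclusion term makes
it left-continuous. -/
theorem tendsto_primaryWeight (k x : ℝ) (z : Plane × (LinkType × (ℝ × ℝ))) :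
    Filter.Tendsto (fun n => q.primaryWeight k (dyadicFloor n x) z) Filter.atTop
      (nhds (q.primaryWeight k x z)) :=
  (tendsto_ite_lt_dyadicFloor _ x).add (ENNReal.Tendsto.mul_const
    (ENNReal.tendsto_ofReal ((tendsto_dyadicFloor x).const_mul k)) (Or.inr ENNReal.ofReal_ne_top))

end Params

namespace Params

variable {q : Params}

/-- The interference of the secondary base stations as a function of the marked process. -/
noncomputable def secondarySum (q : Params)
    (z : ℕ → Plane × (LinkType × (ℝ × (ℝ × (ℝ × LinkType))))) : ℝ≥0∞ :=
  ∑' j, ENNReal.ofReal (q.secondaryRecv (z j).2.1 ‖(z j).1‖ (z j).2.2)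

theorem measurable_secondarySum : Measurable q.secondarySum := by
  refine Measurable.tsum fun j => ?_
  have h := measurable_marked (Φ := fun t r m => ENNReal.ofReal (q.secondaryRecv t r m))
    fun t => (measurable_secondaryRecv t).ennreal_ofReal
  exact h.comp (measurable_pi_apply j)

end Params

/-! ### The coverage event -/

namespace Network

variable {Ω : Type*} (N : Network Ω) (q : Params)

/-- The primary base stations with their marks. -/
def primary (i : ℕ) (ω : Ω) : Plane × (LinkType × (ℝ × ℝ)) :=
  (N.x i ω, (N.linkP i ω, N.fadP i ω, N.angP i ω))

/-- The secondary base stations with their marks. -/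
def secondary (i : ℕ) (ω : Ω) : Plane × (LinkType × (ℝ × (ℝ × (ℝ × LinkType)))) :=
  (N.y i ω, (N.linkS i ω, N.fadS i ω, N.angS i ω, (N.R i ω, N.T i ω)))

/-- The radial distance of the `i`th primary base station. -/
noncomputable def radialP (i : ℕ) (ω : Ω) : ℝ := q.radial (N.linkP i ω) ‖N.x i ω‖

variable {N q}

theorem interfS_eq_secondarySum (ω : Ω) :
    N.interfS q ω = q.secondarySum fun i => N.secondary i ω := rfl

theorem isTagged_iff (hq : q.Valid) {ω : Ω} (h0 : ∀ i, N.x i ω ≠ 0) (i : ℕ) :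
    N.IsTagged q i ω ↔ ∀ j, N.radialP q i ω ≤ N.radialP q j ω := by
  refine forall_congr' fun j => ?_
  rw [mul_le_mul_iff_right₀ hq.powP_pos]
  exact hq.pathLoss_le_iff (norm_pos_iff.2 (h0 j)) (norm_pos_iff.2 (h0 i))

/-- Coverage by the `i`th primary base station in terms of its fading. -/
theorem covered_by_iff (hq : q.Valid) {τ : ℝ} (hτ : 0 < τ) {ω : Ω} (h0 : ∀ i, N.x i ω ≠ 0)
    (i : ℕ) :
    N.IsTagged q i ω ∧ ENNReal.ofReal τ < N.sinr q i ω ↔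
      reducedSum N.primary (q.primaryWeight (τ / (q.powP * q.antP.mainGain)) (N.radialP q i ω)) i ω +
        ENNReal.ofReal (τ / (q.powP * q.antP.mainGain) * N.radialP q i ω * q.noise) +
        ENNReal.ofReal (τ / (q.powP * q.antP.mainGain) * N.radialP q i ω) * N.interfS q ω <
      ENNReal.ofReal (N.fadP i ω) := by
  have hpw := hq.powP_pos
  have hG := hq.antP_valid.mainGain_pos
  have hρ : 0 < N.radialP q i ω := hq.radial_pos _ (norm_pos_iff.2 (h0 i))
  set s := τ / (q.powP * q.antP.mainGain) * N.radialP q i ω with hs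
  have hspos : 0 < s := by positivity
  -- For a tagged station no infinite weight occurs, and the claim is the SINR inequality with
  -- denominators cleared. Otherwise a closer station makes the left side infinite.
  by_cases ht : N.IsTagged q i ω
  · have hmin := (isTagged_iff hq h0 i).1 ht
    have h1 : reducedSum N.primary
        (q.primaryWeight (τ / (q.powP * q.antP.mainGain)) (N.radialP q i ω)) i ω =
        ENNReal.ofReal s * N.interfP q i ω := by
      rw [interfP, reducedSum, ← ENNReal.tsum_mul_left]
      refine tsum_congr fun j => ?_
      by_cases hj : j = i
      · simp [hj]
      · have : ¬ q.radial (N.primary j ω).2.1 ‖(N.primary j ω).1‖ < N.radialP q i ω :=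
          not_lt.2 (hmin j)
        simp only [hj, if_false, Params.primaryWeight, Params.primaryExponent, this, zero_add]
        rfl
    have h2 : N.lossP q i ω = (N.radialP q i ω)⁻¹ :=
      Params.pathLoss_eq_inv_radial _ (norm_nonneg _)
    have h3 : ENNReal.ofReal (q.powP * q.antP.mainGain * N.fadP i ω * N.lossP q i ω) =
        ENNReal.ofReal (τ / s) * ENNReal.ofReal (N.fadP i ω) := by
      rw [← ENNReal.ofReal_mul (by positivity), h2, hs]
      congr 1
      field_simp
    have h4 : ENNReal.ofReal τ = ENNReal.ofReal (τ / s) * ENNReal.ofReal s := by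
      rw [← ENNReal.ofReal_mul (by positivity), div_mul_cancel₀ _ hspos.ne']
    have h5 : ENNReal.ofReal (τ / s) ≠ 0 := by simpa using div_pos hτ hspos
    rw [h1, sinr, ENNReal.lt_div_iff_mul_lt (Or.inr ENNReal.ofReal_ne_top)
      (Or.inr (by simpa using hτ)), h3, h4, mul_assoc,
      ENNReal.mul_lt_mul_iff_right h5 ENNReal.ofReal_ne_top, ENNReal.ofReal_mul hspos.le]
    simp only [ht, true_and]
    rw [mul_add, mul_add, add_comm (ENNReal.ofReal s * ENNReal.ofReal q.noise)]
  · refine iff_of_false (fun h => ht h.1) ?_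
    rw [isTagged_iff hq h0] at ht
    push Not at ht
    obtain ⟨j, hj⟩ := ht
    have hji : j ≠ i := by
      rintro rfl
      exact lt_irrefl _ hj
    have htop : reducedSum N.primary
        (q.primaryWeight (τ / (q.powP * q.antP.mainGain)) (N.radialP q i ω)) i ω = ∞ := by
      rw [reducedSum]
      refine ENNReal.tsum_eq_top_of_eq_top ⟨j, ?_⟩
      have : q.radial (N.primary j ω).2.1 ‖(N.primary j ω).1‖ < N.radialP q i ω := hj
      simp [hji, Params.primaryWeight, Params.primaryExponent, this]
    simp [htop]

end Network

namespace Network.IsModel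

variable {Ω : Type*} [MeasurableSpace Ω] {N : Network Ω} {q : Params}
  {ν : Measure (ℝ × LinkType)} {P : Measure Ω}

theorem measurable_secondary (hN : N.IsModel q ν P) : Measurable fun ω i => N.secondary i ω :=
  measurable_pi_iff.2 fun i => (hN.poissonS.measurable i).prodMk (hN.markingS.measurable i)

theorem measurable_primary (hN : N.IsModel q ν P) : Measurable fun ω i => N.primary i ω :=
  measurable_pi_iff.2 fun i => (hN.poissonP.measurable i).prodMk (hN.markingP.measurable i)

theorem measurable_interfS (hN : N.IsModel q ν P) : Measurable (N.interfS q) := by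
  have : N.interfS q = fun ω => q.secondarySum fun i => N.secondary i ω :=
    funext interfS_eq_secondarySum
  rw [this]
  exact Params.measurable_secondarySum.comp hN.measurable_secondary

theorem measurable_radialP (hN : N.IsModel q ν P) (i : ℕ) : Measurable (N.radialP q i) := by
  have h : Measurable (N.primary i) := measurable_pi_iff.1 hN.measurable_primary i
  have h' : Measurable fun z : Plane × (LinkType × (ℝ × ℝ)) => q.radial z.2.1 ‖z.1‖ :=
    Params.measurable_radial_marked
  have h'' := h'.comp h
  exact h''

theorem measurable_reducedSum_primary (hN : N.IsModel q ν P) (k : ℝ) (i : ℕ) :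
    Measurable fun ω => reducedSum N.primary (q.primaryWeight k (N.radialP q i ω)) i ω := by
  refine Measurable.tsum fun j => ?_
  split_ifs
  · exact measurable_const
  · have h := (Params.measurable_primaryWeight (q := q) k).comp
      ((hN.measurable_radialP i).prodMk (measurable_pi_iff.1 hN.measurable_primary j))
    exact h

theorem indepFun_primary_interfS (hN : N.IsModel q ν P) :
    IndepFun (fun ω i => N.primary i ω) (N.interfS q) P := by
  have h : IndepFun (fun ω i => N.primary i ω) (fun ω i => N.secondary i ω) P := hN.indep
  have : N.interfS q = fun ω => q.secondarySum fun i => N.secondary i ω :=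
    funext interfS_eq_secondarySum
  rw [this]
  exact h.comp measurable_id Params.measurable_secondarySum

variable [IsProbabilityMeasure P]

theorem ae_x_ne_zero (hN : N.IsModel q ν P) (hq : q.Valid) : ∀ᵐ ω ∂P, ∀ i, N.x i ω ≠ 0 := by
  filter_upwards [(hN.hasPoissonLaplace_primary hq).ae_notMem
    ((measurableSet_singleton _).prod MeasurableSet.univ) (Params.primaryIntensity_zero hq)]
    with ω h i h0
  exact h i ⟨h0, mem_univ _⟩

theorem ae_radialP_ne (hN : N.IsModel q ν P) (hq : q.Valid) :
    ∀ᵐ ω ∂P, ∀ i j, j ≠ i → N.radialP q j ω ≠ N.radialP q i ω :=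
  (hN.hasPoissonLaplace_primary hq).ae_param_ne Params.measurable_radial_marked
    (fun c => by
      rw [Params.primaryIntensity_radial hq measurableSet_Iic]
      exact Params.linkedIntensity_radial_le hq _ c)
    (fun c => by
      rw [Params.primaryIntensity_radial hq (measurableSet_singleton c)]
      exact Params.linkedIntensity_radial_eq hq _ c)

/-- Conditioning on everything but the fading of the `i`th primary base station. -/
theorem measure_covered_by (hN : N.IsModel q ν P) (hq : q.Valid) {k : ℝ} (i : ℕ) :
    P {ω | reducedSum N.primary (q.primaryWeight k (N.radialP q i ω)) i ω +
        ENNReal.ofReal (k * N.radialP q i ω * q.noise) +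
        ENNReal.ofReal (k * N.radialP q i ω) * N.interfS q ω < ENNReal.ofReal (N.fadP i ω)} =
      ∫⁻ ω, expNeg (ENNReal.ofReal (k * N.radialP q i ω * q.noise)) *
        (∫⁻ ω', expNeg (ENNReal.ofReal (k * N.radialP q i ω) * N.interfS q ω') ∂P) *
        expNeg (reducedSum N.primary (q.primaryWeight k (N.radialP q i ω)) i ω) ∂P := by
  let ρ : Plane × (LinkType × (ℝ × ℝ)) → ℝ := fun z => q.radial z.2.1 ‖z.1‖
  have hρ : Measurable ρ := Params.measurable_radial_marked
  have hρi : Measurable fun z : ℕ → Plane × (LinkType × (ℝ × ℝ)) => ρ (z i) :=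
    hρ.comp (measurable_pi_apply i)
  let A : (ℕ → Plane × (LinkType × (ℝ × ℝ))) → ℝ≥0∞ := fun z =>
    ∑' j, if j = i then 0 else q.primaryWeight k (ρ (z i)) (z j)
  have hA : Measurable A := by
    refine Measurable.tsum fun j => ?_
    split_ifs
    · exact measurable_const
    · have h := (Params.measurable_primaryWeight (q := q) k).comp
        (hρi.prodMk (measurable_pi_apply j))
      exact h
  -- The threshold for the fading, with the secondary interference frozen at the value `c`.
  let W : ℝ≥0∞ → (ℕ → Plane × (LinkType × (ℝ × ℝ))) → ℝ≥0∞ := fun c z =>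
    A z + ENNReal.ofReal (k * ρ (z i) * q.noise) + ENNReal.ofReal (k * ρ (z i)) * c
  have hW : Measurable fun y : (ℕ → Plane × (LinkType × (ℝ × ℝ))) × ℝ≥0∞ => W y.2 y.1 := by
    have h1 : Measurable fun y : (ℕ → Plane × (LinkType × (ℝ × ℝ))) × ℝ≥0∞ => ρ (y.1 i) :=
      hρi.comp measurable_fst
    have h2 : Measurable fun y : (ℕ → Plane × (LinkType × (ℝ × ℝ))) × ℝ≥0∞ => A y.1 :=
      hA.comp measurable_fst
    fun_prop
  have hind := hN.indepFun_primary_interfS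
  have hI := hN.measurable_interfS
  have hX := hN.measurable_primary
  let S : Set ((ℕ → Plane × (LinkType × (ℝ × ℝ))) × ℝ≥0∞) :=
    {y | W y.2 y.1 < ENNReal.ofReal (y.1 i).2.2.1}
  have hS : MeasurableSet S := measurableSet_lt hW (by fun_prop)
  have hSω : MeasurableSet {ω | W (N.interfS q ω) (fun j => N.primary j ω) <
      ENNReal.ofReal (N.fadP i ω)} := hS.preimage (hX.prodMk hI)
  calc P {ω | W (N.interfS q ω) (fun j => N.primary j ω) < ENNReal.ofReal (N.fadP i ω)}
    _ = ∫⁻ ω, S.indicator 1 (fun j => N.primary j ω, N.interfS q ω) ∂P := by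
      rw [← lintegral_indicator_one hSω]
      rfl
    -- Independence of the two networks lets the secondary interference be frozen at an independent
    -- sample `ω'`.
    _ = ∫⁻ ω', ∫⁻ ω, S.indicator 1 (fun j => N.primary j ω, N.interfS q ω') ∂P ∂P :=
      hind.lintegral_prodMk hX hI (measurable_one.indicator hS)
    _ = ∫⁻ ω', ∫⁻ ω, expNeg (W (N.interfS q ω') fun j => N.primary j ω) ∂P ∂P := by
      refine lintegral_congr fun ω' => ?_
      have hWc : Measurable (W (N.interfS q ω')) := by
        have h := hW.comp (measurable_id.prodMk (measurable_const (a := N.interfS q ω')))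
        exact h
      have := hN.measure_lt_fadP hq i hWc (fun z z' hz h1 h2 => by
        have hρz : ρ (z i) = ρ (z' i) := by simp only [ρ, h1, h2]
        have hAz : A z = A z' := tsum_congr fun j => by
          by_cases hj : j = i
          · simp [hj]
          · simp [hj, hz j hj, hρz]
        simp only [W, hρz, hAz])
      refine Eq.trans ?_ this
      have hSω' : MeasurableSet {ω | W (N.interfS q ω') (fun j => N.primary j ω) <
          ENNReal.ofReal (N.fadP i ω)} := hS.preimage (hX.prodMk measurable_const)
      exact lintegral_indicator_one hSω'
    -- With the order reversed, only one factor depends on `ω'`; its integral is the Laplace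
    -- transform of the secondary interference.
    _ = ∫⁻ ω, ∫⁻ ω', expNeg (W (N.interfS q ω') fun j => N.primary j ω) ∂P ∂P := by
      refine lintegral_lintegral_swap (Measurable.aemeasurable ?_)
      have h := measurable_expNeg.comp (hW.comp ((hX.comp measurable_snd).prodMk
        (hI.comp measurable_fst)))
      exact h
    _ = _ := by
      refine lintegral_congr fun ω => ?_
      have : ∀ ω', expNeg (W (N.interfS q ω') fun j => N.primary j ω) =
          (expNeg (ENNReal.ofReal (k * N.radialP q i ω * q.noise)) *
            expNeg (reducedSum N.primary (q.primaryWeight k (N.radialP q i ω)) i ω)) *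
          expNeg (ENNReal.ofReal (k * N.radialP q i ω) * N.interfS q ω') := fun ω' => by
        rw [← expNeg_add, ← expNeg_add, add_comm (ENNReal.ofReal _)]
        rfl
      simp_rw [this]
      rw [lintegral_const_mul _ (by fun_prop)]
      ring

/-- The coverage probability in terms of the Laplace transform of the secondary interference. -/
theorem measure_covered (hN : N.IsModel q ν P) (hq : q.Valid) {τ : ℝ} (hτ : 0 < τ) :
    P (N.covered q τ) = ∑' i, ∫⁻ ω,
      expNeg (ENNReal.ofReal (τ / (q.powP * q.antP.mainGain) * N.radialP q i ω * q.noise)) *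
        (∫⁻ ω', expNeg (ENNReal.ofReal (τ / (q.powP * q.antP.mainGain) * N.radialP q i ω) *
          N.interfS q ω') ∂P) *
        expNeg (reducedSum N.primary (q.primaryWeight (τ / (q.powP * q.antP.mainGain))
          (N.radialP q i ω)) i ω) ∂P := by
  simp_rw [← hN.measure_covered_by hq]
  rw [← measure_iUnion₀]
  · refine measure_congr ?_
    filter_upwards [hN.ae_x_ne_zero hq] with ω h0
    refine propext ?_
    change (∃ i, _) ↔ ω ∈ ⋃ i, _
    rw [mem_iUnion]
    exact exists_congr fun i => covered_by_iff hq hτ h0 i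
  -- Two stations covering the user at once would both be tagged, hence tied in radial distance,
  -- which has probability zero.
  · intro i j hij
    refine measure_mono_null ?_ (ae_iff.1 ((hN.ae_x_ne_zero hq).and (hN.ae_radialP_ne hq)))
    rintro ω ⟨h1, h2⟩ ⟨h0, hne⟩
    have h3 := (isTagged_iff hq h0 i).1 ((covered_by_iff hq hτ h0 i).2 h1).1 j
    have h4 := (isTagged_iff hq h0 j).1 ((covered_by_iff hq hτ h0 j).2 h2).1 i
    exact hne i j hij.symm (le_antisymm h4 h3)
  · intro i
    have h1 := hN.measurable_radialP i
    have h2 := hN.measurable_reducedSum_primary (τ / (q.powP * q.antP.mainGain)) i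
    have h3 := hN.measurable_interfS
    have h4 : Measurable (N.fadP i) := (hN.markingP.measurable i).snd.fst
    exact (measurableSet_lt (by fun_prop) (by fun_prop)).nullMeasurableSet

end Network.IsModel

theorem IsRadioClosest.hasHomeDensity {Ω : Type*} [MeasurableSpace Ω] {P : Measure Ω}
    [IsProbabilityMeasure P] {q : Params} (hq : q.Valid) {z : ℕ → Ω → Plane}
    {w : ℕ → Ω → LinkType} {D : Ω → ℝ} {L : Ω → LinkType} (h : IsRadioClosest q P z w D L) :
    q.HasHomeDensity (P.map fun ω => (D ω, L ω)) := by
  intro g hg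
  have hm : Measurable fun y : ℝ × LinkType => g y.2 y.1 :=
    measurable_from_prod_countable_left hg
  rw [lintegral_map hm (h.measurable_dist.prodMk h.measurable_link)]
  exact h.lintegral_eq hq hg

/-! ### Evaluation of the Campbell–Mecke integral and the coverage formula -/

namespace Network.IsModel

variable {Ω : Type*} [MeasurableSpace Ω] {N : Network Ω} {q : Params}
  {ν : Measure (ℝ × LinkType)} {P : Measure Ω} [IsProbabilityMeasure P]

/-- The Campbell–Mecke formula with the radial distance as parameter. The integrand depends on the
server only through this distance, which equals P_P u^{α_t} in the rescaled variable u. -/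
theorem tsum_lintegral_primary (hN : N.IsModel q ν P) (hq : q.Valid) {k : ℝ} (hk : 0 < k)
    {g : ℝ → ℝ≥0∞} (hg : Measurable g) :
    ∑' i, ∫⁻ ω, g (N.radialP q i ω) *
        expNeg (reducedSum N.primary (q.primaryWeight k (N.radialP q i ω)) i ω) ∂P =
      ENNReal.ofReal q.lamP * ∑ t, ∫⁻ u in Ioi (0 : ℝ), ENNReal.ofReal (q.M t u) *
        (g (q.powP * u ^ q.al t) * expNeg (ENNReal.ofReal q.lamP *
          ∑ j : Fin 2, ENNReal.ofReal (q.antP.lobeProb j) *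
            q.EP (k * (q.powP * u ^ q.al t) * q.antP.lobe j) (u ^ q.al t) +
          q.assocExponent t u)) * ENNReal.ofReal (2 * Real.pi * u) := by
  let F : ℝ → ℝ≥0∞ := fun x =>
    g x * expNeg (∫⁻ z, 1 - expNeg (q.primaryWeight k x z) ∂(Params.primaryIntensity hq))
  have hF : Measurable F := by
    have h1 : Measurable fun y : ℝ × (Plane × (LinkType × (ℝ × ℝ))) =>
        1 - expNeg (q.primaryWeight k y.1 y.2) :=
      measurable_one_sub_expNeg (Params.measurable_primaryWeight k)
    exact hg.mul (measurable_expNeg.comp h1.lintegral_prod_right')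
  have hρ : Measurable fun z : Plane × (LinkType × (ℝ × ℝ)) => q.radial z.2.1 ‖z.1‖ :=
    Params.measurable_radial_marked
  have hmecke := (hN.hasPoissonLaplace_primary hq).tsum_lintegral_mul_expNeg (hg.comp hρ) hρ
    (φ := q.primaryWeight k) (Params.measurable_primaryWeight k) (Params.monotone_primaryWeight hk.le)
    (Params.tendsto_primaryWeight k)
  refine hmecke.trans ?_
  have hFm : ∀ t, Measurable (Function.uncurry fun (r : ℝ) (_ : ℝ × ℝ) => F (q.radial t r)) :=
    fun t => hF.comp ((Params.measurable_radial t).comp measurable_fst)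
  have h1 := Params.lintegral_linked_prod hq q.lamP (fadingLaw.prod angleLaw)
    (g := fun t r _ => F (q.radial t r)) hFm
  refine h1.trans ?_
  congr 1
  refine Finset.sum_congr rfl fun t _ => ?_
  simp only [lintegral_const, measure_univ, mul_one]
  rw [Params.lintegral_primary_rescale hq t fun r => F (q.radial t r)]
  refine setLIntegral_congr_fun measurableSet_Ioi fun u (hu : 0 < u) => ?_
  have hx : 0 < q.powP * u ^ q.al t := mul_pos hq.powP_pos (Real.rpow_pos_of_pos hu _)
  simp only [Params.radial_rescale hq t hu, F]
  rw [← Params.lintegral_primaryExponent hq (mul_pos hk hx) t hu]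
  rfl

end Network.IsModel

theorem theorem2 {Ω : Type*} [MeasurableSpace Ω] (P : Measure Ω) [IsProbabilityMeasure P]
    (q : Params) (hq : q.Valid)
    -- the primary users as seen from a secondary base station
    (z : ℕ → Ω → Plane) (w : ℕ → Ω → LinkType) (D : Ω → ℝ) (L : Ω → LinkType)
    (hD : IsRadioClosest q P z w D L)
    (N : Network Ω) (hN : N.IsModel q (P.map fun ω => (D ω, L ω)) P)
    (τ : ℝ) (hτ : 0 < τ) :
    P (N.covered q τ) =
      ∑ t₀ : LinkType, ∫⁻ u in Ioi (0 : ℝ),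
        ENNReal.ofReal (2 * Real.pi * q.lamP * q.M t₀ u) *
        expNeg (ENNReal.ofReal (τ * u ^ q.al t₀ / q.antP.mainGain * q.noise)) *
        expNeg (
          ENNReal.ofReal q.lamP * ∑ k : Fin 2, ENNReal.ofReal (q.antP.lobeProb k) *
            q.EP (τ * u ^ q.al t₀ / q.antP.mainGain * q.antP.lobe k) (u ^ q.al t₀) +
          ENNReal.ofReal q.lamS * ∑ k : Fin 2, ENNReal.ofReal (q.antS.lobeProb k) *
            q.EF (τ * u ^ q.al t₀ / q.antP.mainGain * q.antS.lobe k) q.xi) *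
        expNeg (
          ENNReal.ofReal q.lamS * ∑ k : Fin 2, ENNReal.ofReal (q.antS.lobeProb k) *
            q.EN (τ * u ^ q.al t₀ / q.antP.mainGain * q.antS.lobe k)) *
        expNeg (q.assocExponent t₀ u) *
        ENNReal.ofReal u ∧
    (∀ ω, N.interfS q ω = N.interfForeign q ω + N.interfNative q ω) ∧
    (∀ i ω, N.IsNative q i ω → N.y i ω ≠ 0 → N.powS q i ω * N.lossS q i ω = q.xi) ∧
    (∀ s : ℝ, 0 < s →
      ∫⁻ ω, expNeg (ENNReal.ofReal s * N.interfForeign q ω) ∂P =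
        expNeg (ENNReal.ofReal q.lamS * ∑ k : Fin 2, ENNReal.ofReal (q.antS.lobeProb k) *
          q.EF (s * q.antS.lobe k) q.xi) ∧
      ∫⁻ ω, expNeg (ENNReal.ofReal s * N.interfNative q ω) ∂P =
        expNeg (ENNReal.ofReal q.lamS * ∑ k : Fin 2, ENNReal.ofReal (q.antS.lobeProb k) *
          q.EN (s * q.antS.lobe k))) := by
  have hν := hD.hasHomeDensity hq
  have : IsProbabilityMeasure (P.map fun ω => (D ω, L ω)) :=
    Measure.isProbabilityMeasure_map (hD.measurable_dist.prodMk hD.measurable_link).aemeasurable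
  refine ⟨?_, N.interfS_eq_add q, fun i ω h hy => N.powS_mul_lossS q hq h hy, fun s hs =>
    ⟨hN.lintegral_expNeg_interfForeign hq hν hs, hN.lintegral_expNeg_interfNative hq hν hs⟩⟩
  have hpw := hq.powP_pos
  have hG := hq.antP_valid.mainGain_pos
  have hI := hN.measurable_interfS
  -- Chosen so that k times the radial distance P_P u^{α_t} of the server is s_t(u) = τ u^{α_t} /
  -- G_{P,1}.
  let k : ℝ := τ / (q.powP * q.antP.mainGain)
  have hk : 0 < k := by positivity
  let g : ℝ → ℝ≥0∞ := fun x => expNeg (ENNReal.ofReal (k * x * q.noise)) *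
    ∫⁻ ω, expNeg (ENNReal.ofReal (k * x) * N.interfS q ω) ∂P
  have hg : Measurable g := by
    refine Measurable.mul (by fun_prop) (Measurable.lintegral_prod_right' (f := fun y : ℝ × Ω =>
      expNeg (ENNReal.ofReal (k * y.1) * N.interfS q y.2)) ?_)
    have h2 : Measurable fun y : ℝ × Ω => N.interfS q y.2 := hI.comp measurable_snd
    fun_prop
  refine (hN.measure_covered hq hτ).trans ((hN.tsum_lintegral_primary hq hk hg).trans ?_)
  rw [Finset.mul_sum]
  refine Finset.sum_congr rfl fun t _ => ?_
  rw [← lintegral_const_mul' _ _ ENNReal.ofReal_ne_top]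
  refine setLIntegral_congr_fun measurableSet_Ioi fun u (hu : 0 < u) => ?_
  have hup := Real.rpow_pos_of_pos hu (q.al t)
  have hs : k * (q.powP * u ^ q.al t) = τ * u ^ q.al t / q.antP.mainGain := by
    simp only [k]
    field_simp
  have hspos : 0 < τ * u ^ q.al t / q.antP.mainGain := by positivity
  have hM := Params.M_nonneg hq t hu.le
  have hc : ENNReal.ofReal (2 * Real.pi * q.lamP * q.M t u) =
      ENNReal.ofReal (2 * Real.pi) * ENNReal.ofReal q.lamP * ENNReal.ofReal (q.M t u) := by
    rw [ENNReal.ofReal_mul (mul_nonneg (by positivity) hq.lamP_pos.le),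
      ENNReal.ofReal_mul (by positivity)]
  have hu2 : ENNReal.ofReal (2 * Real.pi * u) = ENNReal.ofReal (2 * Real.pi) * ENNReal.ofReal u :=
    ENNReal.ofReal_mul (by positivity)
  simp only [g, hs]
  rw [hN.lintegral_expNeg_interfS hq hν hspos, hc, hu2, expNeg_add, expNeg_add]
  ring
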